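/- **Setting.** Let $O_1,\dots,O_n$ ($n\ge1$) be i.i.d. copies of $O=(Y,D,Z,X)$, with real outcome $Y$, binary treatment $D$, binary instrument $Z$ and covariates $X$; $\tilde E$ is the sample average and $E$ the expectation. Let $f=(1,f_1,\dots,f_p)^{T}$, $g=(1,g_1,\dots,g_{q_1})^{T}$, $h=(1,h_1,\dots,h_{q_2})^{T}$ be known functions of $X$, with $f$ a subvector of $g$ and of $h$. Let $\pi(x;\gamma)=[1+e^{-\gamma^{T}f(x)}]^{-1}$, $w_1(x;\gamma)=\{1-\pi(x;\gamma)\}/\pi(x;\gamma)$, $m_1(x;\alpha_1)=\psi_D\{\alpha_1^{T}g(x)\}$, $m_{11}(x;\alpha_{11})=\psi_Y\{\alpha_{11}^{T}h(x)\}$, where $\psi_D,\psi_Y$ are strictly increasing and differentiable, $\psi_D(-\infty)=0$, $\psi_D(\infty)=1$; $\Psi_D(u)=\int_0^u\psi_D$, $\Psi_Y(u)=\int_0^u\psi_Y$. Consider the losses $\ell_0(\gamma)=Ze^{-\gamma^{T}f}+(1-Z)\gamma^{T}f$, $\ell_1(\alpha_1;\gamma)=Zw_1(X;\gamma)[-D\alpha_1^{T}g+\Psi_D(\alpha_1^{T}g)]$,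 $\ell_2(\alpha_{11};\gamma,\alpha_1)=Zw_1(X;\gamma)[-DY\alpha_{11}^{T}h+m_1(X;\alpha_1)\Psi_Y(\alpha_{11}^{T}h)]$. The target values $\bar\gamma_1$, $\bar\alpha_1$, $\bar\alpha_{11}$ are minimizers of $E\,\ell_0(\gamma)$, $E\,\ell_1(\alpha_1;\bar\gamma_1)$, $E\,\ell_2(\alpha_{11};\bar\gamma_1,\bar\alpha_1)$. For $0<\varepsilon<1$ put $\lambda_0=\{\log((1+p)/\varepsilon)/n\}^{1/2}$, $\lambda_1=\{\log((1+q_1)/\varepsilon)/n\}^{1/2}$, $\lambda_2=\{\log((1+q_2)/\varepsilon)/n\}^{1/2}$. The estimators $\hat\gamma_1$, $\hat\alpha_1$, $\hat\alpha_{11}$ are any minimizers of $\tilde E\,\ell_0(\gamma)+A_0\lambda_0\sum_{j\ge1}|\gamma_j|$, $\tilde E\,\ell_1(\alpha_1;\hat\gamma_1)+A_1\lambda_1\sum_{j\ge1}|\alpha_{1,j}|$, $\tilde E\,\ell_2(\alpha_{11};\hat\gamma_1,\hat\alpha_1)+A_2\lambda_2\sum_{j\ge1}|\alpha_{11,j}|$.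 Write $\hat\pi_1=\pi(\cdot;\hat\gamma_1)$, $\bar\pi_1=\pi(\cdot;\bar\gamma_1)$, and similarly $\hat m_1,\bar m_1,\hat m_{11},\bar m_{11}$, and $$\varphi(O;\pi,m_1,m_{11})=\frac{Z}{\pi(X)}DY-\Big\{\frac{Z}{\pi(X)}-1\Big\}m_1(X)m_{11}(X).$$ For a vector $b=(b_0,b_1,\dots,b_k)$ let $S_b=\{0\}\cup\{j\ge 1:b_j\ne0\}$. A compatibility condition holds for a matrix $\Sigma$ with subset $S$ and constants $\nu>0$, $\mu>1$ if $\nu^2(\sum_{j\in S}|b_j|)^2\le|S|\,b^{T}\Sigma b$ whenever $\sum_{j\notin S}|b_j|\le\mu\sum_{j\in S}|b_j|$. **Assumptions.** With constants $C_{f0},C_{g0},C_{h0}\ge1$, $C_{f1}\in\mathbb R$, $C_{g1},C_{g2},C_{h1},C_{h2},\sigma_0,\sigma_1,\nu_0,\nu_1,\nu_2>0$ and $\mu_0,\mu_1,\mu_2>1$: (1) almost surely, $\max_j|f_j(X)|\le C_{f0}$ and $\bar\gamma_1^{T}f(X)\ge C_{f1}$; the compatibility condition holds for $E\{Zw_1(X;\bar\gamma_1)ff^{T}\}$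 with $S_{\bar\gamma_1},\nu_0,\mu_0$. (2) almost surely, $\max_j|g_j(X)|\le C_{g0}$ and $|\bar\alpha_1^{T}g(X)|\le C_{g1}$; $\psi_D'(u)\le\psi_D'(\tilde u)e^{C_{g2}|u-\tilde u|}$ for all $u,\tilde u$; the compatibility condition holds for $E\{Zw_1(X;\bar\gamma_1)gg^{T}\}$ with $S_{\bar\alpha_1},\nu_1,\mu_1$. (3) almost surely, $\max_j|h_j(X)|\le C_{h0}$ and $|\bar\alpha_{11}^{T}h(X)|\le C_{h1}$; $\psi_Y'(u)\le\psi_Y'(\tilde u)e^{C_{h2}|u-\tilde u|}$ for all $u,\tilde u$; the residual $e=DY-\bar m_1(X)\bar m_{11}(X)$ is uniformly sub-Gaussian given $X$, i.e. $\sigma_0^2E\{\exp(e^2/\sigma_0^2)-1\mid X\}\le\sigma_1^2$ almost surely; the compatibility condition holds for $E\{Zw_1(X;\bar\gamma_1)hh^{T}\}$ with $S_{\bar\alpha_{11}},\nu_2,\mu_2$. (4) $\lambda_0\le1$ and $|S_{\bar\gamma_1}|\lambda_0+|S_{\bar\alpha_1}|\lambda_1\max(1,\lambda_1/\lambda_2)+|S_{\bar\alpha_{11}}|\lambda_2\le\eta$.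 (5) The instrument propensity score model is correctly specified: $P(Z=1\mid X)=\pi(X;\gamma^*)$ almost surely for some $\gamma^*$. **Theorem 3.** There are an absolute constant $c_0>0$; a constant $B_1>0$ depending only on $(C_{f1},C_{h0},\sigma_0,\sigma_1)$; and thresholds for $A_0,A_1$, depending only on $\psi_D$ and the constants in (1), (2), $C_{h0},\sigma_0,\sigma_1$, such that, for all $A_0$, $A_1$ above their thresholds and all $A_2>B_1(\mu_2+1)/(\mu_2-1)$, there are positive constants $\eta,M_{30},M_{31},M_{32},M_{40},M_{41}$, depending only on $\psi_D,\psi_Y,A_0,A_1,A_2$ and the constants in (1)--(3) (in particular not on $n,p,q_1,q_2,\varepsilon$, the regressors or the distributions), for which under (1)--(5): with probability at least $1-(14+c_0)\varepsilon$, $$\big|\tilde E\{\varphi(O;\hat\pi_1,\hat m_1,\hat m_{11})\}-\tilde E\{\varphi(O;\bar\pi_1,\bar m_1,\bar m_{11})\}\big|\le M_{30}|S_{\bar\gamma_1}|\lambda_0(\lambda_1\vee\lambda_2)+M_{31}|S_{\bar\alpha_1}|\lambda_1(\lambda_1\vee\lambda_2)+M_{32}|S_{\bar\alpha_{11}}|\lambda_2^2,$$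 and, with probability at least $1-(8+c_0)\varepsilon$, $$\tilde E\big[\{\varphi(O;\hat\pi_1,\hat m_1,\hat m_{11})-\varphi(O;\bar\pi_1,\bar m_1,\bar m_{11})\}^2\big]\le M_{40}\big(|S_{\bar\gamma_1}|\lambda_0^2+|S_{\bar\alpha_1}|\lambda_1^2+|S_{\bar\alpha_{11}}|\lambda_2^2\big)+M_{41}\big(|S_{\bar\gamma_1}|\lambda_0+|S_{\bar\alpha_1}|\lambda_1+|S_{\bar\alpha_{11}}|\lambda_2\big)^2.$$ -/

import Mathlib

open MeasureTheory ProbabilityTheory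

universe u v

noncomputable section

namespace RCAL

/-! ### Observations -/

/-- An observation `(Y, D, Z, X)`: outcome, binary treatment, binary instrument, covariates. -/
abbrev Obs (𝒳 : Type*) := ℝ × Bool × Bool × 𝒳

namespace Obs

variable {𝒳 : Type*}

/-- The outcome `Y`. -/
def Y (o : Obs 𝒳) : ℝ := o.1

/-- The treatment `D`, as a number in `{0, 1}`. -/
def D (o : Obs 𝒳) : ℝ := if o.2.1 then 1 else 0

/-- The instrument `Z`, as a number in `{0, 1}`. -/
def Z (o : Obs 𝒳) : ℝ := if o.2.2.1 then 1 else 0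

/-- The covariates `X`. -/
def X (o : Obs 𝒳) : 𝒳 := o.2.2.2

end Obs

/-- The sample average `Ẽ{b(O)}` over the data `O₁, …, Oₙ`. -/
def sampleMean {𝒳 : Type*} {n : ℕ} (data : Fin n → Obs 𝒳) (b : Obs 𝒳 → ℝ) : ℝ :=
  (∑ i, b (data i)) / n

/-! ### Models -/

/-- The logistic instrument propensity score `π(x; γ)`. -/
def propensity {𝒳 : Type*} {p : ℕ} (f : 𝒳 → Fin (p + 1) → ℝ) (γ : Fin (p + 1) → ℝ) (x : 𝒳) : ℝ :=
  Real.sigmoid (γ ⬝ᵥ f x)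

/-- The weight `w₁(x; γ) = {1 - π(x; γ)} / π(x; γ)`. -/
def weight {𝒳 : Type*} {p : ℕ} (f : 𝒳 → Fin (p + 1) → ℝ) (γ : Fin (p + 1) → ℝ) (x : 𝒳) : ℝ :=
  (1 - propensity f γ x) / propensity f γ x

/-- A regression function `ψ{αᵀ g(x)}` with inverse link `ψ`; it serves both as `m₁(x; α₁)` and as
`m₁₁(x; α₁₁)`. -/
def regression {𝒳 : Type*} {k : ℕ} (ψ : ℝ → ℝ) (g : 𝒳 → Fin (k + 1) → ℝ) (α : Fin (k + 1) → ℝ)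
    (x : 𝒳) : ℝ :=
  ψ (α ⬝ᵥ g x)

/-- The antiderivative `Ψ(u) = ∫₀ᵘ ψ`. -/
def antideriv (ψ : ℝ → ℝ) (u : ℝ) : ℝ := ∫ t in (0 : ℝ)..u, ψ t

/-- The augmented inverse probability weighted function `φ_{D₁Y₁₁}(O; π, m₁, m₁₁)`. -/
def aipw {𝒳 : Type*} (π m₁ m₁₁ : 𝒳 → ℝ) (o : Obs 𝒳) : ℝ :=
  o.Z / π o.X * (o.D * o.Y) - (o.Z / π o.X - 1) * (m₁ o.X * m₁₁ o.X)

/-- `φ_{D₁Y₁₁}` at the functions `π(·; γ)`, `m₁(·; α₁)`, `m₁₁(·; α₁₁)` given by parameters. -/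
def aipwParam {𝒳 : Type*} {p q₁ q₂ : ℕ} (ψD ψY : ℝ → ℝ)
    (f : 𝒳 → Fin (p + 1) → ℝ) (g : 𝒳 → Fin (q₁ + 1) → ℝ) (h : 𝒳 → Fin (q₂ + 1) → ℝ)
    (γ : Fin (p + 1) → ℝ) (α₁ : Fin (q₁ + 1) → ℝ) (α₁₁ : Fin (q₂ + 1) → ℝ) : Obs 𝒳 → ℝ :=
  aipw (propensity f γ) (regression ψD g α₁) (regression ψY h α₁₁)

/-! ### Loss functions, per observation -/

/-- Calibration loss for `γ`. -/
def lossCAL {𝒳 : Type*} {p : ℕ} (f : 𝒳 → Fin (p + 1) → ℝ) (γ : Fin (p + 1) → ℝ)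
    (o : Obs 𝒳) : ℝ :=
  o.Z * Real.exp (-(γ ⬝ᵥ f o.X)) + (1 - o.Z) * (γ ⬝ᵥ f o.X)

/-- Weighted likelihood loss for `α₁`, with weights at `γ`. -/
def lossD {𝒳 : Type*} {p q₁ : ℕ} (ψD : ℝ → ℝ)
    (f : 𝒳 → Fin (p + 1) → ℝ) (g : 𝒳 → Fin (q₁ + 1) → ℝ)
    (γ : Fin (p + 1) → ℝ) (α₁ : Fin (q₁ + 1) → ℝ) (o : Obs 𝒳) : ℝ :=
  o.Z * weight f γ o.X * (-(o.D * (α₁ ⬝ᵥ g o.X)) + antideriv ψD (α₁ ⬝ᵥ g o.X))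

/-- Weighted likelihood loss for `α₁₁`, with weights at `γ` and treatment regression at `α₁`. -/
def lossDY {𝒳 : Type*} {p q₁ q₂ : ℕ} (ψD ψY : ℝ → ℝ)
    (f : 𝒳 → Fin (p + 1) → ℝ) (g : 𝒳 → Fin (q₁ + 1) → ℝ) (h : 𝒳 → Fin (q₂ + 1) → ℝ)
    (γ : Fin (p + 1) → ℝ) (α₁ : Fin (q₁ + 1) → ℝ) (α₁₁ : Fin (q₂ + 1) → ℝ) (o : Obs 𝒳) : ℝ :=
  o.Z * weight f γ o.X *
    (-(o.D * o.Y * (α₁₁ ⬝ᵥ h o.X)) + regression ψD g α₁ o.X * antideriv ψY (α₁₁ ⬝ᵥ h o.X))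

/-- The Lasso penalty `‖b_{1:k}‖₁`; the intercept `b₀` is not penalized. -/
def penalty {k : ℕ} (b : Fin (k + 1) → ℝ) : ℝ := ∑ j : Fin k, |b j.succ|

/-- `γ` minimizes the expected loss `E(loss)` under the law `ρ`: a target value. -/
def IsTarget {𝒳 : Type*} [MeasurableSpace 𝒳] {k : ℕ} (ρ : Measure (Obs 𝒳))
    (loss : (Fin (k + 1) → ℝ) → Obs 𝒳 → ℝ) (b : Fin (k + 1) → ℝ) : Prop :=
  IsMinOn (fun c => ∫ o, loss c o ∂ρ) Set.univ b

/-- `b` minimizes the Lasso penalized sample loss `Ẽ(loss) + lam ‖b_{1:k}‖₁`. -/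
def IsLasso {𝒳 : Type*} {k n : ℕ} (data : Fin n → Obs 𝒳)
    (loss : (Fin (k + 1) → ℝ) → Obs 𝒳 → ℝ) (lam : ℝ) (b : Fin (k + 1) → ℝ) : Prop :=
  IsMinOn (fun c => sampleMean data (loss c) + lam * penalty c) Set.univ b

/-- `(γ, α₁, α₁₁)` is a triple of regularized calibrated estimates from the data, computed in
sequence, with Lasso tuning parameters `lam₀, lam₁, lam₂`. -/
structure IsFitted {𝒳 : Type*} {n p q₁ q₂ : ℕ} (ψD ψY : ℝ → ℝ)
    (f : 𝒳 → Fin (p + 1) → ℝ) (g : 𝒳 → Fin (q₁ + 1) → ℝ) (h : 𝒳 → Fin (q₂ + 1) → ℝ)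
    (data : Fin n → Obs 𝒳) (lam₀ lam₁ lam₂ : ℝ)
    (γ : Fin (p + 1) → ℝ) (α₁ : Fin (q₁ + 1) → ℝ) (α₁₁ : Fin (q₂ + 1) → ℝ) : Prop where
  fit_γ : IsLasso data (lossCAL f) lam₀ γ
  fit_α₁ : IsLasso data (lossD ψD f g γ) lam₁ α₁
  fit_α₁₁ : IsLasso data (lossDY ψD ψY f g h γ α₁) lam₂ α₁₁

/-! ### Sparsity, rates, compatibility, sub-Gaussian residuals -/

open Classical in
/-- `S_b = {0} ∪ {j : b_j ≠ 0}`. -/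
def activeSet {k : ℕ} (b : Fin (k + 1) → ℝ) : Finset (Fin (k + 1)) :=
  Finset.univ.filter fun j => j = 0 ∨ b j ≠ 0

/-- The size `|S_b|`, as a real number. -/
def sparsity {k : ℕ} (b : Fin (k + 1) → ℝ) : ℝ := ((activeSet b).card : ℝ)

/-- The rate `{log((1 + k)/ε)/n}^{1/2}`. -/
def rate (n k : ℕ) (ε : ℝ) : ℝ := Real.sqrt (Real.log ((1 + k) / ε) / n)

/-- The matrix `E{Z w₁(X; γ) g(X) g(X)ᵀ}`. -/
def gram {𝒳 : Type*} [MeasurableSpace 𝒳] {p k : ℕ} (ρ : Measure (Obs 𝒳))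
    (f : 𝒳 → Fin (p + 1) → ℝ) (γ : Fin (p + 1) → ℝ) (g : 𝒳 → Fin (k + 1) → ℝ) :
    Matrix (Fin (k + 1)) (Fin (k + 1)) ℝ :=
  Matrix.of fun i j => ∫ o, o.Z * weight f γ o.X * (g o.X i * g o.X j) ∂ρ

/-- Compatibility condition for `M` with the subset `S` and constants `ν`, `μ`. -/
def Compatible {k : ℕ} (M : Matrix (Fin (k + 1)) (Fin (k + 1)) ℝ) (S : Finset (Fin (k + 1)))
    (ν μ : ℝ) : Prop :=
  ∀ b : Fin (k + 1) → ℝ, ∑ j ∈ Sᶜ, |b j| ≤ μ * ∑ j ∈ S, |b j| →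
    ν ^ 2 * (∑ j ∈ S, |b j|) ^ 2 ≤ (S.card : ℝ) * (b ⬝ᵥ M.mulVec b)

/-- The sigma-algebra generated by the covariates `X`. -/
abbrev covariateAlgebra (𝒳 : Type*) [m : MeasurableSpace 𝒳] : MeasurableSpace (Obs 𝒳) :=
  m.comap Obs.X

/-- `e` is uniformly sub-Gaussian given `X` with parameters `(σ₀, σ₁)`:
`σ₀² E{exp(e²/σ₀²) - 1 | X} ≤ σ₁²` almost surely. -/
def CondSubGaussian {𝒳 : Type*} [MeasurableSpace 𝒳] (ρ : Measure (Obs 𝒳)) (e : Obs 𝒳 → ℝ)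
    (σ₀ σ₁ : ℝ) : Prop :=
  Integrable (fun o => Real.exp (e o ^ 2 / σ₀ ^ 2)) ρ ∧
    ∀ᵐ o ∂ρ, σ₀ ^ 2 *
      (ρ[fun o' => Real.exp (e o' ^ 2 / σ₀ ^ 2) - 1 | covariateAlgebra 𝒳]) o ≤ σ₁ ^ 2

/-! ### Standing conditions and assumptions -/

/-- Inverse link of the treatment model: increasing, differentiable, with limits `0` and `1`. -/
structure IsTreatmentLink (ψ : ℝ → ℝ) : Prop where
  strictMono : StrictMono ψ
  differentiable : Differentiable ℝ ψ
  tendsto_bot : Filter.Tendsto ψ Filter.atBot (nhds 0)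
  tendsto_top : Filter.Tendsto ψ Filter.atTop (nhds 1)

/-- Inverse link of the outcome model: increasing and differentiable. -/
structure IsOutcomeLink (ψ : ℝ → ℝ) : Prop where
  strictMono : StrictMono ψ
  differentiable : Differentiable ℝ ψ

/-- `ψ'(u) ≤ ψ'(v) exp(C |u - v|)` for all `u`, `v`. -/
def DerivRatioBound (ψ : ℝ → ℝ) (C : ℝ) : Prop :=
  ∀ u v : ℝ, deriv ψ u ≤ deriv ψ v * Real.exp (C * |u - v|)

/-- A vector of known (measurable) functions of the covariates with first component `1`. -/
structure IsRegressor {𝒳 : Type*} [MeasurableSpace 𝒳] {k : ℕ}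
    (g : 𝒳 → Fin (k + 1) → ℝ) : Prop where
  measurable : Measurable g
  intercept : ∀ x, g x 0 = 1

/-- `f` is a subvector of `g`. -/
def IsSubvector {𝒳 : Type*} {p k : ℕ} (f : 𝒳 → Fin (p + 1) → ℝ) (g : 𝒳 → Fin (k + 1) → ℝ) : Prop :=
  ∃ ι : Fin (p + 1) → Fin (k + 1), Function.Injective ι ∧ ∀ x j, f x j = g x (ι j)

/-- The instrument propensity score model is correctly specified:
`P(Z = 1 | X) = π(X; γ*)` almost surely for some `γ*`. -/
def PropensityCorrect {𝒳 : Type*} [MeasurableSpace 𝒳] {p : ℕ} (ρ : Measure (Obs 𝒳))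
    (f : 𝒳 → Fin (p + 1) → ℝ) : Prop :=
  ∃ γ : Fin (p + 1) → ℝ,
    ρ[fun o => o.Z | covariateAlgebra 𝒳] =ᵐ[ρ] fun o => propensity f γ o.X

/-- Conditions on the instrument propensity score model, at the target value `γ`. -/
structure PropensityAssumption {𝒳 : Type*} [MeasurableSpace 𝒳] {p : ℕ} (ρ : Measure (Obs 𝒳))
    (f : 𝒳 → Fin (p + 1) → ℝ) (γ : Fin (p + 1) → ℝ) (Cf₀ Cf₁ ν₀ μ₀ : ℝ) : Prop where
  bounded : ∀ᵐ o ∂ρ, ∀ j, |f o.X j| ≤ Cf₀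
  lower : ∀ᵐ o ∂ρ, Cf₁ ≤ γ ⬝ᵥ f o.X
  compatible : Compatible (gram ρ f γ f) (activeSet γ) ν₀ μ₀

/-- Conditions on the treatment model, at the target values `γ`, `α₁`. -/
structure TreatmentAssumption {𝒳 : Type*} [MeasurableSpace 𝒳] {p q₁ : ℕ} (ρ : Measure (Obs 𝒳))
    (f : 𝒳 → Fin (p + 1) → ℝ) (g : 𝒳 → Fin (q₁ + 1) → ℝ)
    (γ : Fin (p + 1) → ℝ) (α₁ : Fin (q₁ + 1) → ℝ) (Cg₀ Cg₁ ν₁ μ₁ : ℝ) : Prop where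
  bounded : ∀ᵐ o ∂ρ, ∀ j, |g o.X j| ≤ Cg₀
  predictor : ∀ᵐ o ∂ρ, |α₁ ⬝ᵥ g o.X| ≤ Cg₁
  compatible : Compatible (gram ρ f γ g) (activeSet α₁) ν₁ μ₁

/-- Conditions on the outcome model, at the target values `γ`, `α₁`, `α₁₁`. -/
structure OutcomeAssumption {𝒳 : Type*} [MeasurableSpace 𝒳] {p q₁ q₂ : ℕ} (ρ : Measure (Obs 𝒳))
    (ψD ψY : ℝ → ℝ)
    (f : 𝒳 → Fin (p + 1) → ℝ) (g : 𝒳 → Fin (q₁ + 1) → ℝ) (h : 𝒳 → Fin (q₂ + 1) → ℝ)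
    (γ : Fin (p + 1) → ℝ) (α₁ : Fin (q₁ + 1) → ℝ) (α₁₁ : Fin (q₂ + 1) → ℝ)
    (Ch₀ Ch₁ σ₀ σ₁ ν₂ μ₂ : ℝ) : Prop where
  bounded : ∀ᵐ o ∂ρ, ∀ j, |h o.X j| ≤ Ch₀
  subGaussian : CondSubGaussian ρ
    (fun o => o.D * o.Y - regression ψD g α₁ o.X * regression ψY h α₁₁ o.X) σ₀ σ₁
  predictor : ∀ᵐ o ∂ρ, |α₁₁ ⬝ᵥ h o.X| ≤ Ch₁
  compatible : Compatible (gram ρ f γ h) (activeSet α₁₁) ν₂ μ₂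

end RCAL

end

open RCAL

/-!
Each of the three estimates is a Lasso estimate for a convex loss, and the target values solve the
population estimating equations. `lasso_bound` gives the error of such an estimate from the
curvature of the loss, which the ratio bound on the derivative of the link keeps comparable to a
quadratic (`curvature_lower`), and from the compatibility condition. The gradient at the target
value consists of a centred moment of size `λ`, absorbed by the penalty, and of a part `R √Q` due to
the nuisance parameters estimated before, absorbed by the curvature `Q`; so `R² + |S| λ²` is the
rate, and the three applications `bound_γ`, `bound_α`, `bound_β` accumulate these rates.

With `w = (1 - π) / π` and `δ` the error of the product `m₁ m₁₁`, the error of `φ` is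
`Z (ŵ - w) e - Z (ŵ - w) δ + (1 - Z / π) δ` (`Sample.dphi`). The first term is linear in `γ` up to a
quadratic remainder, and its linear part is small by the estimating equation of `α₁₁`, because the
regressors of the propensity score are among those of the outcome model. The second term is a
product of two errors. For the third term the propensity score has to be correct: then the target
`γ` gives the true propensity score (`propensity_target_eq`), so `1 - Z / π` has mean zero given `X`
and all of its moments with functions of `X` are centred. This makes the linear part of `δ`
negligible and also bounds the quadratic part over the units with `Z = 0`, which are invisible to
the weighted losses (`Sample.Good.avg_abs_r_dG_le`). Altogether `Sample.aipw_bound` is a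
deterministic statement about samples whose moments are close to their expectations.

Only eleven families of moments are needed, each of at most `(1 + k)²` averages of variables with an
exponential moment. The Bernstein type inequality `measure_exists_abs_avg_sub_gt_le` shows that each
of them is within a constant times `{log((1 + k)/ε)/n}^{1/2}` of its expectation except on an event
of probability `2 ε`. The eleven events have total probability at most `22 ε`, whence `c₀ = 14` is
large enough for both conclusions. The thresholds for `A₀, A₁, A₂` come from the concentration
constants of the three gradients only; all other constants enter `η` and `M`.
-/

namespace RCAL

/-! ### Link functions with a bounded log-derivative ratio -/

/-- Mean value theorem, regardless of the order of `u` and `v`. -/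
lemma exists_deriv_mul_sub {ψ : ℝ → ℝ} (hψ : Differentiable ℝ ψ) (u v : ℝ) :
    ∃ ξ, |ξ - v| ≤ |u - v| ∧ ψ u - ψ v = deriv ψ ξ * (u - v) := by
  rcases lt_trichotomy u v with huv | huv | huv
  · obtain ⟨c, hc, h⟩ := exists_deriv_eq_slope ψ huv hψ.continuous.continuousOn
      hψ.differentiableOn
    refine ⟨c, ?_, ?_⟩
    · rw [abs_of_nonpos (by linarith [hc.2]), abs_of_nonpos (by linarith)]
      linarith [hc.1]
    · rw [h]
      field_simp [sub_ne_zero.2 huv.ne']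
      ring
  · exact ⟨v, by simp, by simp [huv]⟩
  · obtain ⟨c, hc, h⟩ := exists_deriv_eq_slope ψ huv hψ.continuous.continuousOn
      hψ.differentiableOn
    refine ⟨c, ?_, ?_⟩
    · rw [abs_of_nonneg (by linarith [hc.1]), abs_of_nonneg (by linarith)]
      linarith [hc.2]
    · rw [h]
      field_simp [sub_ne_zero.2 huv.ne']

/-- If the derivative vanished at one point, the ratio bound would make it vanish everywhere. -/
lemma deriv_zero_pos {ψ : ℝ → ℝ} {C : ℝ} (hm : StrictMono ψ) (hψ : Differentiable ℝ ψ)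
    (hr : DerivRatioBound ψ C) : 0 < deriv ψ 0 := by
  obtain ⟨ξ, -, h⟩ := exists_deriv_mul_sub hψ 1 0
  have h1 : 0 < ψ 1 - ψ 0 := sub_pos.2 (hm one_pos)
  rw [h] at h1
  have h2 := hr ξ 0
  by_contra hneg
  nlinarith [Real.exp_pos (C * |ξ - 0|)]

lemma deriv_le_of_abs_le {ψ : ℝ → ℝ} {C R v : ℝ} (hC : 0 ≤ C) (hr : DerivRatioBound ψ C)
    (h0 : 0 ≤ deriv ψ 0) (hv : |v| ≤ R) : deriv ψ v ≤ deriv ψ 0 * Real.exp (C * R) := by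
  refine (hr v 0).trans (mul_le_mul_of_nonneg_left (Real.exp_le_exp.2 ?_) h0)
  simpa using mul_le_mul_of_nonneg_left hv hC

lemma le_deriv_of_abs_le {ψ : ℝ → ℝ} {C R v : ℝ} (hC : 0 ≤ C) (hr : DerivRatioBound ψ C)
    (hm : Monotone ψ) (hv : |v| ≤ R) : deriv ψ 0 * Real.exp (-(C * R)) ≤ deriv ψ v := by
  have h1 : deriv ψ 0 ≤ deriv ψ v * Real.exp (C * R) := by
    refine (hr 0 v).trans (mul_le_mul_of_nonneg_left (Real.exp_le_exp.2 ?_) hm.deriv_nonneg)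
    simpa using mul_le_mul_of_nonneg_left hv hC
  rw [Real.exp_neg, ← div_eq_mul_inv, div_le_iff₀ (Real.exp_pos _)]
  exact h1

/-- Quadratic lower bound for the symmetrized Bregman divergence. The mean value theorem is applied
only on the initial part of the segment from `v` to `u`, of relative length
`1 / (1 + C |u - v|)`: there the derivative has dropped at most by a factor `e`, and monotonicity
disposes of the rest. -/
lemma curvature_lower {ψ : ℝ → ℝ} {C : ℝ} (hC : 0 ≤ C) (hr : DerivRatioBound ψ C)
    (hm : Monotone ψ) (hψ : Differentiable ℝ ψ) (u v : ℝ) :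
    Real.exp (-1) * deriv ψ v * (u - v) ^ 2 / (1 + C * |u - v|) ≤ (ψ u - ψ v) * (u - v) := by
  have hpos : 0 < 1 + C * |u - v| := by positivity
  set s := 1 / (1 + C * |u - v|) with hs
  have hs0 : 0 < s := by positivity
  have hs1 : s ≤ 1 := by
    rw [hs, div_le_one hpos]; nlinarith [mul_nonneg hC (abs_nonneg (u - v))]
  obtain ⟨ξ, hξ, h⟩ := exists_deriv_mul_sub hψ (v + s * (u - v)) v
  have h1 : v + s * (u - v) - v = s * (u - v) := by ring
  rw [h1] at hξ h
  have hξ1 : C * |v - ξ| ≤ 1 := by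
    rw [abs_sub_comm]
    calc C * |ξ - v| ≤ C * |s * (u - v)| := mul_le_mul_of_nonneg_left hξ hC
      _ = C * |u - v| / (1 + C * |u - v|) := by
        rw [abs_mul, abs_of_pos hs0, hs]; ring
      _ ≤ 1 := by rw [div_le_one hpos]; linarith
  have hd : Real.exp (-1) * deriv ψ v ≤ deriv ψ ξ := by
    have := hr v ξ
    have h2 : deriv ψ v ≤ deriv ψ ξ * Real.exp 1 :=
      this.trans (mul_le_mul_of_nonneg_left (Real.exp_le_exp.2 hξ1) hm.deriv_nonneg)
    rw [Real.exp_neg, inv_mul_eq_div, div_le_iff₀ (Real.exp_pos _)]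
    exact h2
  have hmono : (ψ (v + s * (u - v)) - ψ v) * (u - v) ≤ (ψ u - ψ v) * (u - v) := by
    rcases le_total v u with huv | huv
    · have : v + s * (u - v) ≤ u := by nlinarith
      exact mul_le_mul_of_nonneg_right (by linarith [hm this]) (by linarith)
    · have : u ≤ v + s * (u - v) := by nlinarith
      nlinarith [hm this]
  rw [h] at hmono
  refine le_trans ?_ hmono
  calc Real.exp (-1) * deriv ψ v * (u - v) ^ 2 / (1 + C * |u - v|)
      = Real.exp (-1) * deriv ψ v * (s * (u - v) ^ 2) := by rw [hs]; ring
    _ ≤ deriv ψ ξ * (s * (u - v) ^ 2) := mul_le_mul_of_nonneg_right hd (by positivity)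
    _ = _ := by ring

lemma abs_sub_le_deriv {ψ : ℝ → ℝ} {C : ℝ} (hC : 0 ≤ C) (hr : DerivRatioBound ψ C)
    (hm : Monotone ψ) (hψ : Differentiable ℝ ψ) (u v : ℝ) :
    |ψ u - ψ v| ≤ deriv ψ v * Real.exp (C * |u - v|) * |u - v| := by
  obtain ⟨ξ, hξ, h⟩ := exists_deriv_mul_sub hψ u v
  rw [h, abs_mul, abs_of_nonneg hm.deriv_nonneg]
  refine mul_le_mul_of_nonneg_right ((hr ξ v).trans ?_) (abs_nonneg _)
  exact mul_le_mul_of_nonneg_left (Real.exp_le_exp.2 (mul_le_mul_of_nonneg_left hξ hC))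
    hm.deriv_nonneg

/-- Second order Taylor bound without a second derivative: the ratio bound controls the variation of
`deriv ψ`. -/
lemma abs_taylor_le_deriv {ψ : ℝ → ℝ} {C : ℝ} (hC : 0 ≤ C) (hr : DerivRatioBound ψ C)
    (hm : Monotone ψ) (hψ : Differentiable ℝ ψ) (u v : ℝ) :
    |ψ u - ψ v - deriv ψ v * (u - v)| ≤
      deriv ψ v * (C * Real.exp (C * |u - v|)) * (u - v) ^ 2 := by
  obtain ⟨ξ, hξ, h⟩ := exists_deriv_mul_sub hψ u v
  have hv : 0 ≤ deriv ψ v := hm.deriv_nonneg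
  set x := C * |u - v| with hx
  have hx0 : 0 ≤ x := by positivity
  have hexp : Real.exp x - 1 ≤ x * Real.exp x := by
    have := Real.add_one_le_exp (-x)
    have h2 : Real.exp (-x) * Real.exp x = 1 := by rw [← Real.exp_add]; simp
    nlinarith [Real.exp_pos x]
  have h1 : deriv ψ ξ ≤ deriv ψ v * Real.exp x :=
    (hr ξ v).trans (mul_le_mul_of_nonneg_left
      (Real.exp_le_exp.2 (mul_le_mul_of_nonneg_left hξ hC)) hv)
  have h2 : deriv ψ v ≤ deriv ψ ξ * Real.exp x := by
    refine (hr v ξ).trans (mul_le_mul_of_nonneg_left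
      (Real.exp_le_exp.2 (mul_le_mul_of_nonneg_left ?_ hC)) hm.deriv_nonneg)
    rwa [abs_sub_comm]
  have h3 : |deriv ψ ξ - deriv ψ v| ≤ deriv ψ v * (Real.exp x - 1) := by
    rw [abs_le]
    constructor
    · have h4 : deriv ψ v * Real.exp (-x) ≤ deriv ψ ξ := by
        rw [Real.exp_neg, ← div_eq_mul_inv, div_le_iff₀ (Real.exp_pos _)]; exact h2
      have h5 : 2 ≤ Real.exp x + Real.exp (-x) := by
        have := Real.add_one_le_exp (-x)
        have := Real.add_one_le_exp (x)
        linarith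
      nlinarith
    · linarith
  rw [h, ← sub_mul, abs_mul]
  calc |deriv ψ ξ - deriv ψ v| * |u - v| ≤ deriv ψ v * (x * Real.exp x) * |u - v| := by
        refine mul_le_mul_of_nonneg_right (h3.trans ?_) (abs_nonneg _)
        exact mul_le_mul_of_nonneg_left hexp hv
    _ = deriv ψ v * (C * Real.exp x) * |u - v| ^ 2 := by rw [hx]; ring
    _ = _ := by rw [sq_abs]

/-- The calibration loss is of the same type as the other two, with link `-e^{-u}`. -/
lemma hasDerivAt_neg_exp_neg (u : ℝ) :
    HasDerivAt (fun t : ℝ => -Real.exp (-t)) (Real.exp (-u)) u := by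
  exact ((hasDerivAt_neg u).exp).neg.congr_deriv (by simp)

lemma deriv_neg_exp_neg (u : ℝ) : deriv (fun t : ℝ => -Real.exp (-t)) u = Real.exp (-u) :=
  (hasDerivAt_neg_exp_neg u).deriv

lemma differentiable_neg_exp_neg : Differentiable ℝ (fun t : ℝ => -Real.exp (-t)) :=
  fun u => (hasDerivAt_neg_exp_neg u).differentiableAt

lemma monotone_neg_exp_neg : Monotone (fun t : ℝ => -Real.exp (-t)) := fun u v h => by
  have := Real.exp_le_exp.2 (neg_le_neg h)
  simpa using this

lemma derivRatioBound_neg_exp_neg : DerivRatioBound (fun t : ℝ => -Real.exp (-t)) 1 := by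
  intro u v
  rw [deriv_neg_exp_neg, deriv_neg_exp_neg, ← Real.exp_add, one_mul]
  refine Real.exp_le_exp.2 ?_
  linarith [neg_abs_le (u - v)]

lemma abs_exp_neg_sub_le (u v : ℝ) :
    |Real.exp (-u) - Real.exp (-v)| ≤ Real.exp (-v) * Real.exp |u - v| * |u - v| := by
  have := abs_sub_le_deriv zero_le_one derivRatioBound_neg_exp_neg monotone_neg_exp_neg
    differentiable_neg_exp_neg u v
  rw [deriv_neg_exp_neg, one_mul] at this
  rwa [abs_sub_comm, show Real.exp (-v) - Real.exp (-u) = -Real.exp (-u) - -Real.exp (-v) by ring]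

lemma abs_exp_neg_taylor_le (u v : ℝ) :
    |Real.exp (-u) - Real.exp (-v) + Real.exp (-v) * (u - v)| ≤
      Real.exp (-v) * Real.exp |u - v| * (u - v) ^ 2 := by
  have := abs_taylor_le_deriv zero_le_one derivRatioBound_neg_exp_neg monotone_neg_exp_neg
    differentiable_neg_exp_neg u v
  rw [deriv_neg_exp_neg, one_mul, one_mul] at this
  rwa [← abs_neg, show -(Real.exp (-u) - Real.exp (-v) + Real.exp (-v) * (u - v)) =
    -Real.exp (-u) - -Real.exp (-v) - Real.exp (-v) * (u - v) by ring]

/-- Convexity of the antiderivative of a monotone function. -/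
lemma antideriv_sub_le {ψ : ℝ → ℝ} (hm : Monotone ψ) (u v : ℝ) :
    antideriv ψ v - antideriv ψ u ≤ ψ v * (v - u) := by
  have hi : ∀ a b : ℝ, IntervalIntegrable ψ volume a b := fun a b => hm.intervalIntegrable
  rw [antideriv, antideriv, intervalIntegral.integral_interval_sub_left (hi _ _) (hi _ _)]
  rcases le_total u v with h | h
  · calc ∫ t in u..v, ψ t ≤ ∫ _t in u..v, ψ v :=
        intervalIntegral.integral_mono_on h (hi _ _) intervalIntegrable_const
          fun x hx => hm hx.2
      _ = _ := by simp [mul_comm]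
  · rw [intervalIntegral.integral_symm]
    have : ∫ _t in v..u, ψ v ≤ ∫ t in v..u, ψ t :=
        intervalIntegral.integral_mono_on h intervalIntegrable_const (hi _ _)
          fun x hx => hm hx.1
    simp only [intervalIntegral.integral_const, smul_eq_mul] at this
    linarith

lemma continuous_antideriv {ψ : ℝ → ℝ} (hψ : Monotone ψ) : Continuous (antideriv ψ) :=
  intervalIntegral.continuous_primitive (fun _ _ => hψ.intervalIntegrable) 0

/-- Convexity of `e^{-u}`, in the same form as `antideriv_sub_le`. -/
lemma exp_neg_sub_le (u v : ℝ) :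
    Real.exp (-v) - Real.exp (-u) ≤ -Real.exp (-v) * (v - u) := by
  have h := Real.add_one_le_exp (v - u)
  have h2 : Real.exp (-u) = Real.exp (-v) * Real.exp (v - u) := by
    rw [← Real.exp_add]; congr 1; ring
  rw [h2]
  nlinarith [Real.exp_pos (-v)]

lemma IsTreatmentLink.pos {ψ : ℝ → ℝ} (h : IsTreatmentLink ψ) (u : ℝ) : 0 < ψ u :=
  (h.strictMono.monotone.le_of_tendsto h.tendsto_bot (u - 1)).trans_lt
    (h.strictMono (by linarith))

lemma IsTreatmentLink.le_one {ψ : ℝ → ℝ} (h : IsTreatmentLink ψ) (u : ℝ) : ψ u ≤ 1 :=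
  h.strictMono.monotone.ge_of_tendsto h.tendsto_top u

lemma one_div_sigmoid (u : ℝ) : 1 / Real.sigmoid u = 1 + Real.exp (-u) := by
  rw [Real.sigmoid_def, one_div, inv_inv]

lemma weight_eq_exp {𝒳 : Type*} {p : ℕ} (f : 𝒳 → Fin (p + 1) → ℝ) (γ : Fin (p + 1) → ℝ) (x : 𝒳) :
    weight f γ x = Real.exp (-(γ ⬝ᵥ f x)) := by
  have h : Real.sigmoid (γ ⬝ᵥ f x) ≠ 0 := (Real.sigmoid_pos _).ne'
  have := one_div_sigmoid (γ ⬝ᵥ f x)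
  rw [weight, propensity, sub_div, div_self h, this]
  ring

/-! ### Averages over the sample -/

/-- The average of a finite family of numbers; `sampleMean data b` is the average of `b (data i)`. -/
noncomputable def avg {n : ℕ} (a : Fin n → ℝ) : ℝ := (∑ i, a i) / n

lemma sampleMean_eq_avg {𝒳 : Type*} {n : ℕ} (data : Fin n → Obs 𝒳) (b : Obs 𝒳 → ℝ) :
    sampleMean data b = avg fun i => b (data i) := rfl

section avg

variable {n : ℕ}

lemma avg_mono {a b : Fin n → ℝ} (h : ∀ i, a i ≤ b i) : avg a ≤ avg b :=
  div_le_div_of_nonneg_right (Finset.sum_le_sum fun i _ => h i) (Nat.cast_nonneg n)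

lemma avg_nonneg {a : Fin n → ℝ} (h : ∀ i, 0 ≤ a i) : 0 ≤ avg a :=
  div_nonneg (Finset.sum_nonneg fun i _ => h i) (Nat.cast_nonneg n)

lemma avg_add (a b : Fin n → ℝ) : (avg fun i => a i + b i) = avg a + avg b := by
  simp only [avg, Finset.sum_add_distrib, add_div]

lemma avg_sub (a b : Fin n → ℝ) : (avg fun i => a i - b i) = avg a - avg b := by
  simp only [avg, Finset.sum_sub_distrib, sub_div]

lemma avg_const_mul (c : ℝ) (a : Fin n → ℝ) : (avg fun i => c * a i) = c * avg a := by
  simp only [avg, ← Finset.mul_sum, mul_div_assoc]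

lemma avg_sum {ι : Type*} (s : Finset ι) (a : ι → Fin n → ℝ) :
    (avg fun i => ∑ j ∈ s, a j i) = ∑ j ∈ s, avg (a j) := by
  simp only [avg]
  rw [Finset.sum_comm, Finset.sum_div]

lemma abs_avg_le (a : Fin n → ℝ) : |avg a| ≤ avg fun i => |a i| := by
  simp only [avg]
  rw [abs_div, Nat.abs_cast]
  exact div_le_div_of_nonneg_right (Finset.abs_sum_le_sum_abs _ _) (Nat.cast_nonneg n)

/-- Cauchy–Schwarz inequality for a weighted average. -/
lemma avg_mul_mul_le {q : Fin n → ℝ} (hq : ∀ i, 0 ≤ q i) (a b : Fin n → ℝ) :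
    (avg fun i => q i * (|a i| * |b i|)) ≤
      √(avg fun i => q i * a i ^ 2) * √(avg fun i => q i * b i ^ 2) := by
  rw [← Real.sqrt_mul (avg_nonneg fun i => mul_nonneg (hq i) (sq_nonneg _))]
  refine Real.le_sqrt_of_sq_le ?_
  have h := Finset.sum_mul_sq_le_sq_mul_sq Finset.univ (fun i => √(q i) * |a i|)
    (fun i => √(q i) * |b i|)
  have e1 : ∀ i, √(q i) * |a i| * (√(q i) * |b i|) = q i * (|a i| * |b i|) := fun i => by
    rw [mul_mul_mul_comm, Real.mul_self_sqrt (hq i)]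
  simp only [e1, mul_pow, Real.sq_sqrt (hq _), sq_abs] at h
  simp only [avg]
  rw [div_pow, div_mul_div_comm, ← sq]
  exact div_le_div_of_nonneg_right h (sq_nonneg _)

/-- The `ℓ₁` norm of a vector. -/
noncomputable def l1norm {k : ℕ} (b : Fin k → ℝ) : ℝ := ∑ j, |b j|

lemma l1norm_nonneg {k : ℕ} (b : Fin k → ℝ) : 0 ≤ l1norm b :=
  Finset.sum_nonneg fun _ _ => abs_nonneg _

lemma abs_dotProduct_le {k : ℕ} {x : Fin k → ℝ} {C : ℝ} (h : ∀ j, |x j| ≤ C) (b : Fin k → ℝ) :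
    |b ⬝ᵥ x| ≤ C * l1norm b := by
  rw [dotProduct, l1norm, Finset.mul_sum]
  refine (Finset.abs_sum_le_sum_abs _ _).trans (Finset.sum_le_sum fun j _ => ?_)
  rw [abs_mul, mul_comm]
  exact mul_le_mul_of_nonneg_right (h j) (abs_nonneg _)

lemma abs_avg_mul_dotProduct_le {k : ℕ} {x : Fin n → Fin k → ℝ} {a : Fin n → ℝ} {C : ℝ}
    (h : ∀ j, |avg fun i => a i * x i j| ≤ C) (b : Fin k → ℝ) :
    |avg fun i => a i * (b ⬝ᵥ x i)| ≤ C * l1norm b := by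
  have e : (avg fun i => a i * (b ⬝ᵥ x i)) = b ⬝ᵥ fun j => avg fun i => a i * x i j := by
    simp only [dotProduct, Finset.mul_sum]
    rw [avg_sum]
    refine Finset.sum_congr rfl fun j _ => ?_
    rw [← avg_const_mul]
    congr 1; ext i; ring
  rw [e]
  exact abs_dotProduct_le h b

/-- An entrywise bound for a matrix of sample moments bounds its quadratic form by the squared
`ℓ₁` norm. -/
lemma abs_avg_quad_sub_le {k : ℕ} {x : Fin n → Fin k → ℝ} {a : Fin n → ℝ} {C : ℝ}
    {M : Matrix (Fin k) (Fin k) ℝ}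
    (h : ∀ j l, |(avg fun i => a i * (x i j * x i l)) - M j l| ≤ C) (b : Fin k → ℝ) :
    |(avg fun i => a i * (b ⬝ᵥ x i) ^ 2) - b ⬝ᵥ M.mulVec b| ≤ C * l1norm b ^ 2 := by
  have e : (avg fun i => a i * (b ⬝ᵥ x i) ^ 2) =
      b ⬝ᵥ fun j => b ⬝ᵥ fun l => avg fun i => a i * (x i j * x i l) := by
    simp only [dotProduct, sq, Finset.mul_sum, Finset.sum_mul]
    rw [avg_sum, Finset.sum_comm]
    simp only [avg_sum]
    rw [Finset.sum_comm]
    refine Finset.sum_congr rfl fun j _ => Finset.sum_congr rfl fun l _ => ?_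
    rw [← avg_const_mul, ← avg_const_mul]
    congr 1; ext i; ring
  have e2 : b ⬝ᵥ M.mulVec b = b ⬝ᵥ fun j => b ⬝ᵥ fun l => M j l := by
    simp only [Matrix.mulVec, dotProduct, mul_comm]
  rw [e, e2, ← dotProduct_sub, sq, ← mul_assoc]
  refine abs_dotProduct_le (fun j => ?_) b
  simp only [Pi.sub_apply]
  rw [← dotProduct_sub]
  exact abs_dotProduct_le (fun l => h j l) b

end avg

/-! ### The Lasso error bound -/

lemma zero_mem_activeSet {k : ℕ} (b : Fin (k + 1) → ℝ) : 0 ∈ activeSet b := by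
  simp [activeSet]

lemma one_le_sparsity {k : ℕ} (b : Fin (k + 1) → ℝ) : 1 ≤ sparsity b := by
  rw [sparsity, Nat.one_le_cast]
  exact Finset.card_pos.2 ⟨0, zero_mem_activeSet b⟩

lemma l1norm_eq_add {k : ℕ} (S : Finset (Fin k)) (b : Fin k → ℝ) :
    l1norm b = ∑ j ∈ S, |b j| + ∑ j ∈ Sᶜ, |b j| :=
  (Finset.sum_add_sum_compl S _).symm

/-- The unpenalized intercept belongs to the active set, where only its absolute value is lost. -/
lemma sub_le_penalty_sub {k : ℕ} (b c : Fin (k + 1) → ℝ) :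
    ∑ j ∈ (activeSet c)ᶜ, |(b - c) j| - ∑ j ∈ activeSet c, |(b - c) j| ≤
      penalty b - penalty c := by
  have e : ∀ b : Fin (k + 1) → ℝ, penalty b = ∑ j, |b j| - |b 0| := fun b => by
    rw [Fin.sum_univ_succ, penalty]; ring
  have h1 : penalty b - penalty c = ∑ j, (|b j| - |c j|) - (|b 0| - |c 0|) := by
    rw [e, e, Finset.sum_sub_distrib]; ring
  have h2 : ∑ j ∈ (activeSet c)ᶜ, (|b j| - |c j|) = ∑ j ∈ (activeSet c)ᶜ, |(b - c) j| := by
    refine Finset.sum_congr rfl fun j hj => ?_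
    have : c j = 0 := by
      simp only [activeSet, Finset.mem_compl, Finset.mem_filter, Finset.mem_univ, true_and,
        not_or, not_not] at hj
      exact hj.2
    simp [this]
  have h0 := zero_mem_activeSet c
  have h3 : -∑ j ∈ (activeSet c).erase 0, |(b - c) j| ≤
      ∑ j ∈ (activeSet c).erase 0, (|b j| - |c j|) := by
    rw [← Finset.sum_neg_distrib]
    refine Finset.sum_le_sum fun j _ => ?_
    have := abs_sub_abs_le_abs_sub (c j) (b j)
    rw [abs_sub_comm] at this
    simp only [Pi.sub_apply]
    linarith
  have h4 := Finset.add_sum_erase _ (fun j => |b j| - |c j|) h0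
  have h5 := Finset.add_sum_erase _ (fun j => |(b - c) j|) h0
  have h6 := Finset.sum_add_sum_compl (activeSet c) (fun j => |b j| - |c j|)
  rw [h1, ← h6, ← h4, h2, ← h5]
  have := abs_nonneg ((b - c) 0)
  linarith

lemma penalty_segment_le {k : ℕ} (b c : Fin (k + 1) → ℝ) {t : ℝ} (h0 : 0 ≤ t) (h1 : t ≤ 1) :
    penalty (b + t • (c - b)) ≤ penalty b + t * (penalty c - penalty b) := by
  have : penalty b + t * (penalty c - penalty b) = ∑ j : Fin k, ((1 - t) * |b j.succ| +
      t * |c j.succ|) := by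
    simp only [penalty, Finset.sum_add_distrib, ← Finset.mul_sum]; ring
  rw [this, penalty]
  refine Finset.sum_le_sum fun j _ => ?_
  have e : (b + t • (c - b)) j.succ = (1 - t) * b j.succ + t * c j.succ := by
    simp; ring
  rw [e]
  refine (abs_add_le _ _).trans ?_
  rw [abs_mul, abs_mul, abs_of_nonneg h0, abs_of_nonneg (sub_nonneg.2 h1)]

/-- First order optimality of a penalized estimate `b` along the segment to `c`, for a loss
`a Ψ(u) - y u` with `Ψ` convex and `Ψ' = ψ`, rearranged to bound the symmetrized Bregman divergence
between `b` and `c` by the gradient at `c`. -/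
lemma lasso_first_order {n k : ℕ} {x : Fin n → Fin (k + 1) → ℝ} {a y : Fin n → ℝ} {Ψ ψ : ℝ → ℝ}
    {L : ℝ} {b : Fin (k + 1) → ℝ} (ha : ∀ i, 0 ≤ a i) (hL : 0 ≤ L)
    (hΨ : ∀ u v, Ψ v - Ψ u ≤ ψ v * (v - u)) (hψ : Continuous ψ)
    (hmin : ∀ c, (avg fun i => a i * Ψ (b ⬝ᵥ x i) - y i * (b ⬝ᵥ x i)) + L * penalty b ≤
      (avg fun i => a i * Ψ (c ⬝ᵥ x i) - y i * (c ⬝ᵥ x i)) + L * penalty c)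
    (c : Fin (k + 1) → ℝ) :
    (avg fun i => a i * ((ψ (b ⬝ᵥ x i) - ψ (c ⬝ᵥ x i)) * (b ⬝ᵥ x i - c ⬝ᵥ x i))) +
        L * (penalty b - penalty c) ≤
      avg fun i => (y i - a i * ψ (c ⬝ᵥ x i)) * ((b - c) ⬝ᵥ x i) := by
  set δ := c - b with hδ
  have key : ∀ t : ℝ, 0 < t → t ≤ 1 → 0 ≤
      (avg fun i => (a i * ψ (b ⬝ᵥ x i + t * (δ ⬝ᵥ x i)) - y i) * (δ ⬝ᵥ x i)) +
        L * (penalty c - penalty b) := by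
    intro t ht ht1
    have h1 := hmin (b + t • δ)
    have h2 := mul_le_mul_of_nonneg_left (penalty_segment_le b c ht.le ht1) hL
    have h3 : (avg fun i => a i * Ψ ((b + t • δ) ⬝ᵥ x i) - y i * ((b + t • δ) ⬝ᵥ x i)) -
        (avg fun i => a i * Ψ (b ⬝ᵥ x i) - y i * (b ⬝ᵥ x i)) ≤
        avg fun i => t * ((a i * ψ (b ⬝ᵥ x i + t * (δ ⬝ᵥ x i)) - y i) * (δ ⬝ᵥ x i)) := by
      rw [← avg_sub]
      refine avg_mono fun i => ?_
      rw [add_dotProduct, smul_dotProduct, smul_eq_mul]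
      have := mul_le_mul_of_nonneg_left
        (hΨ (b ⬝ᵥ x i) (b ⬝ᵥ x i + t * (δ ⬝ᵥ x i))) (ha i)
      nlinarith
    rw [avg_const_mul] at h3
    refine nonneg_of_mul_nonneg_right (a := t) ?_ ht
    nlinarith
  have hlim : Filter.Tendsto (fun t : ℝ =>
      (avg fun i => (a i * ψ (b ⬝ᵥ x i + t * (δ ⬝ᵥ x i)) - y i) * (δ ⬝ᵥ x i)) +
        L * (penalty c - penalty b)) (nhdsWithin 0 (Set.Ioi 0))
      (nhds ((avg fun i => (a i * ψ (b ⬝ᵥ x i + 0 * (δ ⬝ᵥ x i)) - y i) * (δ ⬝ᵥ x i)) +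
        L * (penalty c - penalty b))) := by
    refine tendsto_nhdsWithin_of_tendsto_nhds (Continuous.tendsto ?_ 0)
    simp only [avg]
    fun_prop
  have h0 := ge_of_tendsto hlim (by
    filter_upwards [Ioc_mem_nhdsGT (zero_lt_one (α := ℝ))] with t ht
    exact key t ht.1 ht.2)
  simp only [zero_mul, add_zero] at h0
  have h1 : (avg fun i => (y i - a i * ψ (c ⬝ᵥ x i)) * ((b - c) ⬝ᵥ x i)) -
      (avg fun i => a i * ((ψ (b ⬝ᵥ x i) - ψ (c ⬝ᵥ x i)) * (b ⬝ᵥ x i - c ⬝ᵥ x i))) =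
      avg fun i => (a i * ψ (b ⬝ᵥ x i) - y i) * (δ ⬝ᵥ x i) := by
    rw [← avg_sub]
    congr 1; ext i
    rw [hδ, sub_dotProduct, sub_dotProduct]
    ring
  linarith

/-- The scalar inequality behind the Lasso error bound. Here `a` and `c` are the `ℓ₁` norms of the
error on and off the active set, of size `s`, `Q` is the sample quadratic form of the error, and `T`
is the contribution to the basic inequality that is not due to the present regression. -/
lemma lasso_scalar_bound {A B κ C ν μ G d : ℝ} (hB : 0 ≤ B) (hκ : 0 < κ) (hC : 0 ≤ C)
    (hν : 0 < ν) (hμ : 1 < μ) (hG : 0 ≤ G) (hd : 0 < d) (hA : A + B + d ≤ μ * (A - B - d)) :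
    ∃ M η : ℝ, 0 < M ∧ 0 < η ∧ ∀ a c Q s lam T : ℝ, 0 ≤ a → 0 ≤ c → 0 ≤ Q → 1 ≤ s → 0 < lam →
      0 ≤ T → κ * Q / (1 + C * (a + c)) + A * lam * (c - a) ≤ B * lam * (a + c) + T →
      (c ≤ μ * a → ν ^ 2 * a ^ 2 ≤ s * (Q + G * lam * (a + c) ^ 2)) →
      s * lam ≤ η → T ≤ lam →
      lam * (a + c) ≤ M * (T + s * lam ^ 2) ∧ Q ≤ M * (T + s * lam ^ 2) := by
  have hABd : 0 < A - B - d := by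
    by_contra h
    nlinarith
  have hA0 : 0 < A := by linarith
  set U := A + B + d with hU
  have hU0 : 0 < U := by positivity
  set K := 4 * U / (ν ^ 2 * κ) with hK
  have hK0 : 0 < K := by positivity
  set M1 := (1 + 2 * C / d) * ((A + B) * (2 / d) + 1) / κ with hM1
  set M2 := U * K * (1 + C * (1 + μ) * K) / κ with hM2
  have hM1p : 0 < M1 := by positivity
  have hM2p : 0 < M2 := by positivity
  set η := min 1 (min (ν ^ 2 / (2 * (G * (1 + μ) ^ 2 + 1)))
    (ν ^ 2 * κ / (4 * (U * C * (1 + μ) + 1)))) with hη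
  have hη0 : 0 < η := by positivity
  have hη1 : η ≤ 1 := min_le_left _ _
  have hη2 : η * (G * (1 + μ) ^ 2) ≤ ν ^ 2 / 2 := by
    have h : η ≤ ν ^ 2 / (2 * (G * (1 + μ) ^ 2 + 1)) := (min_le_right _ _).trans (min_le_left _ _)
    rw [le_div_iff₀ (by positivity)] at h
    nlinarith
  have hη3 : η * (U * C * (1 + μ)) ≤ ν ^ 2 * κ / 4 := by
    have h : η ≤ ν ^ 2 * κ / (4 * (U * C * (1 + μ) + 1)) :=
      (min_le_right _ _).trans (min_le_right _ _)
    rw [le_div_iff₀ (by positivity)] at h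
    nlinarith
  refine ⟨2 / d + (1 + μ) * K + M1 + M2, η, by positivity, hη0, ?_⟩
  intro a c Q s lam T ha hc hQ hs hlam hT h1 h2 hsl hTl
  have hsl2 : 0 ≤ s * lam ^ 2 := by positivity
  have hMle : ∀ x y : ℝ, 0 ≤ x → x ≤ 2 / d + (1 + μ) * K + M1 + M2 → y ≤ x * (T + s * lam ^ 2) →
      y ≤ (2 / d + (1 + μ) * K + M1 + M2) * (T + s * lam ^ 2) := fun x y _ hx hy =>
    hy.trans (mul_le_mul_of_nonneg_right hx (by positivity))
  have p1 : 0 < 2 / d := by positivity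
  have p2 : 0 < (1 + μ) * K := by positivity
  have hden : 0 < 1 + C * (a + c) := by positivity
  by_cases hcase : d * lam * (a + c) ≤ 2 * T
  · -- the extraneous term dominates
    have e1 : lam * (a + c) ≤ 2 / d * T := by
      rw [div_mul_eq_mul_div, le_div_iff₀ hd]; linarith
    have e2 : a + c ≤ 2 / d := by
      have : lam * (a + c) ≤ lam * (2 / d) := by
        refine e1.trans ?_
        rw [mul_comm lam]
        exact mul_le_mul_of_nonneg_left hTl p1.le
      exact le_of_mul_le_mul_left this hlam
    refine ⟨hMle (2 / d) _ p1.le (by linarith) (e1.trans ?_), hMle M1 _ hM1p.le (by linarith) ?_⟩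
    · exact mul_le_mul_of_nonneg_left (by linarith) p1.le
    · have e3 : κ * Q / (1 + C * (a + c)) ≤ ((A + B) * (2 / d) + 1) * T := by
        have : A * lam * (c - a) ≥ -(A * (lam * (a + c))) := by
          have : 0 ≤ A * lam * c := by positivity
          linarith
        have e4 := mul_le_mul_of_nonneg_left e1 (by positivity : 0 ≤ A + B)
        linarith
      rw [div_le_iff₀ hden] at e3
      have e4 : 1 + C * (a + c) ≤ 1 + 2 * C / d := by
        have := mul_le_mul_of_nonneg_left e2 hC
        have e : C * (2 / d) = 2 * C / d := by ring
        linarith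
      have e5 : κ * Q ≤ ((A + B) * (2 / d) + 1) * T * (1 + 2 * C / d) :=
        e3.trans (mul_le_mul_of_nonneg_left e4 (by positivity))
      have e6 : Q ≤ M1 * T := by
        rw [hM1, div_mul_eq_mul_div, le_div_iff₀ hκ]
        linarith
      exact e6.trans (mul_le_mul_of_nonneg_left (by linarith) hM1p.le)
  · -- otherwise the error lies in the cone of the compatibility condition
    push Not at hcase
    have hA2 : κ * Q / (1 + C * (a + c)) + (A - B - d) * lam * c ≤ U * lam * a := by
      rw [hU]; linarith
    have hfrac : 0 ≤ κ * Q / (1 + C * (a + c)) := by positivity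
    have hcone : c ≤ μ * a := by
      have e1 : (A - B - d) * c ≤ U * a := by
        have : lam * ((A - B - d) * c) ≤ lam * (U * a) := by linarith
        exact le_of_mul_le_mul_left this hlam
      have e2 : (A - B - d) * c ≤ (A - B - d) * (μ * a) := by
        have := mul_le_mul_of_nonneg_right hA ha
        linarith
      exact le_of_mul_le_mul_left e2 hABd
    have hac : a + c ≤ (1 + μ) * a := by linarith
    have ha0 : 0 < a := by
      rcases ha.lt_or_eq with h | h
      · exact h
      · exfalso
        rw [← h] at hcone hcase
        have : c = 0 := by linarith
        rw [this] at hcase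
        linarith
    have hquad : ν ^ 2 / 2 * a ^ 2 ≤ s * Q := by
      have e1 := h2 hcone
      have e2 : (a + c) ^ 2 ≤ (1 + μ) ^ 2 * a ^ 2 := by
        rw [← mul_pow]; exact pow_le_pow_left₀ (by positivity) hac 2
      have e3 : s * (G * lam * (a + c) ^ 2) ≤ η * (G * (1 + μ) ^ 2) * a ^ 2 := by
        calc s * (G * lam * (a + c) ^ 2) = s * lam * (G * (a + c) ^ 2) := by ring
          _ ≤ η * (G * ((1 + μ) ^ 2 * a ^ 2)) :=
            mul_le_mul hsl (mul_le_mul_of_nonneg_left e2 hG) (by positivity) hη0.le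
          _ = _ := by ring
      have e4 := mul_le_mul_of_nonneg_right hη2 (sq_nonneg a)
      linarith
    have hQle : κ * Q ≤ U * lam * a * (1 + C * (1 + μ) * a) := by
      have e1 : κ * Q / (1 + C * (a + c)) ≤ U * lam * a := by
        have : 0 ≤ (A - B - d) * lam * c := by positivity
        linarith
      rw [div_le_iff₀ hden] at e1
      refine e1.trans (mul_le_mul_of_nonneg_left ?_ (by positivity))
      have := mul_le_mul_of_nonneg_left hac hC
      linarith
    have haK : a ≤ K * (s * lam) := by
      have e1 : ν ^ 2 / 2 * κ * a * a ≤ (s * lam * U * (1 + C * (1 + μ) * a)) * a := by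
        have := mul_le_mul_of_nonneg_left hQle (by positivity : 0 ≤ s)
        have := mul_le_mul_of_nonneg_right hquad hκ.le
        linarith
      have e2 := le_of_mul_le_mul_right e1 ha0
      have e3 : s * lam * (U * C * (1 + μ)) ≤ ν ^ 2 * κ / 4 :=
        (mul_le_mul_of_nonneg_right hsl (by positivity)).trans hη3
      have e4 : ν ^ 2 * κ / 4 * a ≤ s * lam * U := by
        have := mul_le_mul_of_nonneg_right e3 ha
        linarith
      rw [hK, div_mul_eq_mul_div, le_div_iff₀ (by positivity)]
      linarith
    refine ⟨hMle ((1 + μ) * K) _ p2.le (by linarith) ?_, hMle M2 _ hM2p.le (by linarith) ?_⟩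
    · calc lam * (a + c) ≤ lam * ((1 + μ) * (K * (s * lam))) := by
            refine mul_le_mul_of_nonneg_left (hac.trans ?_) hlam.le
            exact mul_le_mul_of_nonneg_left haK (by linarith)
        _ = (1 + μ) * K * (s * lam ^ 2) := by ring
        _ ≤ _ := mul_le_mul_of_nonneg_left (by linarith) p2.le
    · have e0 : a ≤ K := haK.trans (mul_le_of_le_one_right hK0.le (hsl.trans hη1))
      have e1 : κ * Q ≤ U * lam * (K * (s * lam)) * (1 + C * (1 + μ) * K) := by
        refine hQle.trans (mul_le_mul ?_ ?_ (by positivity) (by positivity))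
        · exact mul_le_mul_of_nonneg_left haK (by positivity)
        · have := mul_le_mul_of_nonneg_left e0 (by positivity : 0 ≤ C * (1 + μ))
          linarith
      have e2 : Q ≤ M2 * (s * lam ^ 2) := by
        rw [hM2, div_mul_eq_mul_div, le_div_iff₀ hκ]
        linarith
      exact e2.trans (mul_le_mul_of_nonneg_left (by linarith) hM2p.le)

/-- **Error bound for a weighted Lasso estimate.** The gradient at the target `c` is allowed to have
a part `R √Q` that comes from the estimation of nuisance parameters. -/
theorem lasso_bound {A B κ C ν μ G : ℝ} (hB : 0 ≤ B) (hκ : 0 < κ) (hC : 0 ≤ C)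
    (hν : 0 < ν) (hμ : 1 < μ) (hG : 0 ≤ G) (hA : B * (μ + 1) / (μ - 1) < A) :
    ∃ M η : ℝ, 0 < M ∧ 0 < η ∧ ∀ (n k : ℕ) (x : Fin n → Fin (k + 1) → ℝ) (a y q : Fin n → ℝ)
      (Ψ ψ : ℝ → ℝ) (b c : Fin (k + 1) → ℝ) (V : Matrix (Fin (k + 1)) (Fin (k + 1)) ℝ)
      (lam R : ℝ), 0 < lam → 0 ≤ R → (∀ i, 0 ≤ a i) → (∀ i, 0 ≤ q i) →
      (∀ u v, Ψ v - Ψ u ≤ ψ v * (v - u)) → Continuous ψ →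
      (∀ c, (avg fun i => a i * Ψ (b ⬝ᵥ x i) - y i * (b ⬝ᵥ x i)) + A * lam * penalty b ≤
        (avg fun i => a i * Ψ (c ⬝ᵥ x i) - y i * (c ⬝ᵥ x i)) + A * lam * penalty c) →
      (∀ i, κ * (q i * ((b - c) ⬝ᵥ x i) ^ 2) / (1 + C * l1norm (b - c)) ≤
        a i * ((ψ (b ⬝ᵥ x i) - ψ (c ⬝ᵥ x i)) * (b ⬝ᵥ x i - c ⬝ᵥ x i))) →
      (avg fun i => (y i - a i * ψ (c ⬝ᵥ x i)) * ((b - c) ⬝ᵥ x i)) ≤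
        B * lam * l1norm (b - c) + R * √(avg fun i => q i * ((b - c) ⬝ᵥ x i) ^ 2) →
      (∀ j l, |(avg fun i => q i * (x i j * x i l)) - V j l| ≤ G * lam) →
      Compatible V (activeSet c) ν μ →
      sparsity c * lam ≤ η → R ^ 2 ≤ η * lam →
      lam * l1norm (b - c) ≤ M * (R ^ 2 + sparsity c * lam ^ 2) ∧
        (avg fun i => q i * ((b - c) ⬝ᵥ x i) ^ 2) ≤ M * (R ^ 2 + sparsity c * lam ^ 2) := by
  have hμ1 : 0 < μ - 1 := by linarith
  have hA' : B * (μ + 1) < A * (μ - 1) := by rwa [div_lt_iff₀ hμ1] at hA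
  -- `d` splits the slack in `hA`: once for the cone, once for the nuisance part of the gradient
  set d := (A * (μ - 1) - B * (μ + 1)) / (2 * (μ + 1)) with hd
  have hd0 : 0 < d := by have := sub_pos.2 hA'; positivity
  have hd2 : 2 * (μ + 1) * d = A * (μ - 1) - B * (μ + 1) := by
    rw [hd]; field_simp
  obtain ⟨M, η, hM, hη, H⟩ := lasso_scalar_bound (A := A) (B := B + d) (κ := κ / 2) (C := C)
    (ν := ν) (μ := μ) (G := G) (d := d) (by positivity) (by positivity) hC hν hμ hG hd0
    (by nlinarith)
  refine ⟨M * (1 / (2 * κ) + 1), min η (min (2 * κ * d / (C + 1)) (2 * κ)), by positivity,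
    by positivity, ?_⟩
  intro n k x a y q Ψ ψ b c V lam R hlam hR ha hq hΨ hψ hmin hcurv hgrad hgram hcomp hs hRl
  have hA0 : 0 < A := by
    refine lt_of_le_of_lt ?_ hA
    have : 0 ≤ μ + 1 := by linarith
    positivity
  set Q := avg fun i => q i * ((b - c) ⬝ᵥ x i) ^ 2 with hQ
  have hQ0 : 0 ≤ Q := avg_nonneg fun i => mul_nonneg (hq i) (sq_nonneg _)
  set N := l1norm (b - c) with hN
  have hN0 : 0 ≤ N := l1norm_nonneg _
  have hden : 0 < 1 + C * N := by positivity
  set α := ∑ j ∈ activeSet c, |(b - c) j| with hα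
  set β := ∑ j ∈ (activeSet c)ᶜ, |(b - c) j| with hβ
  have hNab : N = α + β := l1norm_eq_add _ _
  have hfo := lasso_first_order ha (by positivity : 0 ≤ A * lam) hΨ hψ hmin c
  have hpen := mul_le_mul_of_nonneg_left (sub_le_penalty_sub b c) (by positivity : 0 ≤ A * lam)
  have hcurv' : κ * Q / (1 + C * N) ≤
      avg fun i => a i * ((ψ (b ⬝ᵥ x i) - ψ (c ⬝ᵥ x i)) * (b ⬝ᵥ x i - c ⬝ᵥ x i)) := by
    refine le_trans (le_of_eq ?_) (avg_mono hcurv)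
    have : ∀ i, κ * (q i * ((b - c) ⬝ᵥ x i) ^ 2) / (1 + C * N) =
      κ / (1 + C * N) * (q i * ((b - c) ⬝ᵥ x i) ^ 2) := fun i => by ring
    simp only [this]
    rw [avg_const_mul]; ring
  -- weighted arithmetic-geometric mean inequality
  have hamgm : R * √Q ≤ κ / 2 * Q / (1 + C * N) + R ^ 2 * (1 + C * N) / (2 * κ) := by
    have h1 : R * √Q = (R * √(1 + C * N) / √κ) * (√κ * √Q / √(1 + C * N)) := by
      field_simp
    have h2 := two_mul_le_add_sq (R * √(1 + C * N) / √κ) (√κ * √Q / √(1 + C * N))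
    rw [div_pow, div_pow, mul_pow, mul_pow, Real.sq_sqrt hden.le, Real.sq_sqrt hκ.le,
      Real.sq_sqrt hQ0] at h2
    rw [h1]
    have e1 : R ^ 2 * (1 + C * N) / (2 * κ) = R ^ 2 * (1 + C * N) / κ / 2 := by ring
    have e2 : κ / 2 * Q / (1 + C * N) = κ * Q / (1 + C * N) / 2 := by ring
    rw [e1, e2]
    linarith
  have hRd : R ^ 2 * (C * N) / (2 * κ) ≤ d * lam * N := by
    have h1 : R ^ 2 ≤ 2 * κ * d / (C + 1) * lam := hRl.trans
      (mul_le_mul_of_nonneg_right ((min_le_right _ _).trans (min_le_left _ _)) hlam.le)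
    rw [div_mul_eq_mul_div, le_div_iff₀ (by positivity)] at h1
    rw [div_le_iff₀ (by positivity)]
    nlinarith [sq_nonneg R]
  have hT : R ^ 2 / (2 * κ) ≤ lam := by
    rw [div_le_iff₀ (by positivity), mul_comm]
    exact hRl.trans
      (mul_le_mul_of_nonneg_right ((min_le_right _ _).trans (min_le_right _ _)) hlam.le)
  have hfin := H α β Q (sparsity c) lam (R ^ 2 / (2 * κ))
    (Finset.sum_nonneg fun _ _ => abs_nonneg _) (Finset.sum_nonneg fun _ _ => abs_nonneg _) hQ0
    (one_le_sparsity c) hlam (by positivity) (by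
      rw [← hNab]
      have e1 : R ^ 2 * (1 + C * N) / (2 * κ) = R ^ 2 / (2 * κ) + R ^ 2 * (C * N) / (2 * κ) := by
        ring
      have e2 : κ * Q / (1 + C * N) = 2 * (κ / 2 * Q / (1 + C * N)) := by ring
      rw [e1] at hamgm
      rw [e2] at hcurv'
      linarith) (by
      intro hcone
      rw [← hNab]
      refine (hcomp (b - c) hcone).trans ?_
      refine mul_le_mul_of_nonneg_left ?_ (Nat.cast_nonneg _)
      have := (abs_le.1 (abs_avg_quad_sub_le hgram (b - c))).1
      linarith) (hs.trans (min_le_left _ _)) hT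
  rw [← hNab] at hfin
  have hle : M * (R ^ 2 / (2 * κ) + sparsity c * lam ^ 2) ≤
      M * (1 / (2 * κ) + 1) * (R ^ 2 + sparsity c * lam ^ 2) := by
    have h1 : 0 ≤ sparsity c * lam ^ 2 := by
      have := one_le_sparsity c
      positivity
    have h2 : 0 < 1 / (2 * κ) := by positivity
    have h3 : R ^ 2 / (2 * κ) = 1 / (2 * κ) * R ^ 2 := by ring
    rw [mul_assoc, h3]
    refine mul_le_mul_of_nonneg_left ?_ hM.le
    nlinarith [sq_nonneg R]
  exact ⟨hfin.1.trans hle, hfin.2.trans hle⟩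

/-! ### Samples with regular moments -/

/-- The links and the constants on which the error bounds depend. `CF, cF, CG, Ca, CH, Cb` bound the
regressors and the target linear predictors, `C₂, C₃` are the constants of the links, `B₀, B₁, B₂`
bound the gradients at the target values and `K` the other centred moments, `A₀, A₁, A₂` are the
tuning constants and `νᵢ, μᵢ` the compatibility constants. -/
structure Constants where
  (ψD ψY : ℝ → ℝ)
  (CF cF CG Ca C₂ CH Cb C₃ B₀ B₁ B₂ K A₀ A₁ A₂ ν₀ μ₀ ν₁ μ₁ ν₂ μ₂ : ℝ)

/-- Admissible constants. -/
structure Constants.Valid (c : Constants) : Prop where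
  linkD : IsTreatmentLink c.ψD
  linkY : IsOutcomeLink c.ψY
  ratioD : DerivRatioBound c.ψD c.C₂
  ratioY : DerivRatioBound c.ψY c.C₃
  CF : 0 ≤ c.CF
  CG : 0 ≤ c.CG
  CH : 0 ≤ c.CH
  C₂ : 0 ≤ c.C₂
  C₃ : 0 ≤ c.C₃
  B₀ : 0 ≤ c.B₀
  B₁ : 0 ≤ c.B₁
  B₂ : 0 ≤ c.B₂
  K : 0 ≤ c.K
  ν₀ : 0 < c.ν₀
  ν₁ : 0 < c.ν₁
  ν₂ : 0 < c.ν₂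
  μ₀ : 1 < c.μ₀
  μ₁ : 1 < c.μ₁
  μ₂ : 1 < c.μ₂
  A₀ : c.B₀ * (c.μ₀ + 1) / (c.μ₀ - 1) < c.A₀
  A₁ : c.B₁ * (c.μ₁ + 1) / (c.μ₁ - 1) < c.A₁
  A₂ : c.B₂ * (c.μ₂ + 1) / (c.μ₂ - 1) < c.A₂

/-- A realized sample together with the target values `γ, α, β` of `γ₁, α₁, α₁₁`, the estimates
`γ', α', β'`, the population moment matrices and the rates. -/
structure Sample (n p q₁ q₂ : ℕ) where
  (Z D Y : Fin n → ℝ)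
  (F : Fin n → Fin (p + 1) → ℝ)
  (G : Fin n → Fin (q₁ + 1) → ℝ)
  (H : Fin n → Fin (q₂ + 1) → ℝ)
  (γ γ' : Fin (p + 1) → ℝ)
  (α α' : Fin (q₁ + 1) → ℝ)
  (β β' : Fin (q₂ + 1) → ℝ)
  (VF : Matrix (Fin (p + 1)) (Fin (p + 1)) ℝ)
  (VG : Matrix (Fin (q₁ + 1)) (Fin (q₁ + 1)) ℝ)
  (VH : Matrix (Fin (q₂ + 1)) (Fin (q₂ + 1)) ℝ)
  (l₀ l₁ l₂ : ℝ)

namespace Sample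

variable {n p q₁ q₂ : ℕ} (s : Sample n p q₁ q₂) (c : Constants)

/-- The weight `w₁` at the target value. -/
noncomputable def w (i : Fin n) : ℝ := Real.exp (-(s.γ ⬝ᵥ s.F i))

/-- The weight `w₁` at the estimate. -/
noncomputable def w' (i : Fin n) : ℝ := Real.exp (-(s.γ' ⬝ᵥ s.F i))

/-- `Z w₁` at the target value. -/
noncomputable def q (i : Fin n) : ℝ := s.Z i * s.w i

/-- The balancing variable `1 - Z / π` at the target value. -/
noncomputable def r (i : Fin n) : ℝ := 1 - s.Z i - s.Z i * s.w i

/-- `m₁` at the target value. -/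
noncomputable def m1 (i : Fin n) : ℝ := c.ψD (s.α ⬝ᵥ s.G i)

/-- `m₁` at the estimate. -/
noncomputable def m1' (i : Fin n) : ℝ := c.ψD (s.α' ⬝ᵥ s.G i)

/-- `m₁₁` at the target value. -/
noncomputable def m2 (i : Fin n) : ℝ := c.ψY (s.β ⬝ᵥ s.H i)

/-- `m₁₁` at the estimate. -/
noncomputable def m2' (i : Fin n) : ℝ := c.ψY (s.β' ⬝ᵥ s.H i)

/-- The residual `DY - m₁ m₁₁` at the target values. -/
noncomputable def e (i : Fin n) : ℝ := s.D i * s.Y i - s.m1 c i * s.m2 c i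

/-- The error of the linear predictor of the propensity score. -/
noncomputable def dF (i : Fin n) : ℝ := (s.γ' - s.γ) ⬝ᵥ s.F i

/-- The error of the linear predictor of the treatment model. -/
noncomputable def dG (i : Fin n) : ℝ := (s.α' - s.α) ⬝ᵥ s.G i

/-- The error of the linear predictor of the outcome model. -/
noncomputable def dH (i : Fin n) : ℝ := (s.β' - s.β) ⬝ᵥ s.H i

/-- The `ℓ₁` error of `γ'`. -/
noncomputable def N₀ : ℝ := l1norm (s.γ' - s.γ)

/-- The `ℓ₁` error of `α'`. -/
noncomputable def N₁ : ℝ := l1norm (s.α' - s.α)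

/-- The `ℓ₁` error of `β'`. -/
noncomputable def N₂ : ℝ := l1norm (s.β' - s.β)

/-- The weighted prediction error of `γ'`. -/
noncomputable def Q₀ : ℝ := avg fun i => s.q i * s.dF i ^ 2

/-- The weighted prediction error of `α'`. -/
noncomputable def Q₁ : ℝ := avg fun i => s.q i * s.dG i ^ 2

/-- The weighted prediction error of `β'`. -/
noncomputable def Q₂ : ℝ := avg fun i => s.q i * s.dH i ^ 2

/-- The prediction error of `γ'`, weighted also with the squared residuals. -/
noncomputable def Qe : ℝ := avg fun i => s.q i * s.e c i ^ 2 * s.dF i ^ 2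

/-- The rate `|S_γ| λ₀²`. -/
noncomputable def r₀ : ℝ := sparsity s.γ * s.l₀ ^ 2

/-- The rate `|S_γ| λ₀² + |S_α| λ₁²`. -/
noncomputable def r₁ : ℝ := s.r₀ + sparsity s.α * s.l₁ ^ 2

/-- The rate `|S_γ| λ₀² + |S_α| λ₁² + |S_β| λ₂²`. -/
noncomputable def r₂ : ℝ := s.r₁ + sparsity s.β * s.l₂ ^ 2

/-- A sample on which the regressors obey their almost sure bounds, all moments that enter the error
analysis are close to their expectations, and `γ', α', β'` are the Lasso estimates. -/
structure Good : Prop where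
  Z01 : ∀ i, s.Z i = 0 ∨ s.Z i = 1
  D01 : ∀ i, s.D i = 0 ∨ s.D i = 1
  F_le : ∀ i j, |s.F i j| ≤ c.CF
  γ_ge : ∀ i, c.cF ≤ s.γ ⬝ᵥ s.F i
  G_le : ∀ i j, |s.G i j| ≤ c.CG
  α_le : ∀ i, |s.α ⬝ᵥ s.G i| ≤ c.Ca
  H_le : ∀ i j, |s.H i j| ≤ c.CH
  β_le : ∀ i, |s.β ⬝ᵥ s.H i| ≤ c.Cb
  l₀_pos : 0 < s.l₀
  l₀_le_l₁ : s.l₀ ≤ s.l₁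
  l₀_le_l₂ : s.l₀ ≤ s.l₂
  grad₀ : ∀ j, |avg fun i => s.r i * s.F i j| ≤ c.B₀ * s.l₀
  grad₁ : ∀ j, |avg fun i => s.q i * (s.D i - s.m1 c i) * s.G i j| ≤ c.B₁ * s.l₁
  grad₂ : ∀ j, |avg fun i => s.q i * s.e c i * s.H i j| ≤ c.B₂ * s.l₂
  resid : ∀ j, |avg fun i => s.q i * s.e c i * s.F i j| ≤ c.B₂ * s.l₂
  gram₀ : ∀ j l, |(avg fun i => s.q i * (s.F i j * s.F i l)) - s.VF j l| ≤ c.K * s.l₀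
  gram₁ : ∀ j l, |(avg fun i => s.q i * (s.G i j * s.G i l)) - s.VG j l| ≤ c.K * s.l₁
  gram₂ : ∀ j l, |(avg fun i => s.q i * (s.H i j * s.H i l)) - s.VH j l| ≤ c.K * s.l₂
  noise : ∀ b, (avg fun i => s.q i * s.e c i ^ 2 * (b ⬝ᵥ s.F i) ^ 2) ≤
    c.K * (b ⬝ᵥ s.VF.mulVec b + s.l₀ * l1norm b ^ 2)
  bal₁ : ∀ j l, |avg fun i => s.r i * (s.G i j * s.G i l)| ≤ c.K * s.l₁
  bal₂ : ∀ j l, |avg fun i => s.r i * (s.H i j * s.H i l)| ≤ c.K * s.l₂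
  lin₁ : ∀ j, |avg fun i => s.r i * (s.m2 c i * deriv c.ψD (s.α ⬝ᵥ s.G i)) * s.G i j| ≤
    c.K * s.l₁
  lin₂ : ∀ j, |avg fun i => s.r i * (s.m1 c i * deriv c.ψY (s.β ⬝ᵥ s.H i)) * s.H i j| ≤
    c.K * s.l₂
  compat₀ : Compatible s.VF (activeSet s.γ) c.ν₀ c.μ₀
  compat₁ : Compatible s.VG (activeSet s.α) c.ν₁ c.μ₁
  compat₂ : Compatible s.VH (activeSet s.β) c.ν₂ c.μ₂
  fit₀ : ∀ b, (avg fun i => s.Z i * Real.exp (-(s.γ' ⬝ᵥ s.F i)) + (1 - s.Z i) * (s.γ' ⬝ᵥ s.F i)) +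
      c.A₀ * s.l₀ * penalty s.γ' ≤
    (avg fun i => s.Z i * Real.exp (-(b ⬝ᵥ s.F i)) + (1 - s.Z i) * (b ⬝ᵥ s.F i)) +
      c.A₀ * s.l₀ * penalty b
  fit₁ : ∀ b, (avg fun i => s.Z i * s.w' i * (-(s.D i * (s.α' ⬝ᵥ s.G i)) +
      antideriv c.ψD (s.α' ⬝ᵥ s.G i))) + c.A₁ * s.l₁ * penalty s.α' ≤
    (avg fun i => s.Z i * s.w' i * (-(s.D i * (b ⬝ᵥ s.G i)) +
      antideriv c.ψD (b ⬝ᵥ s.G i))) + c.A₁ * s.l₁ * penalty b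
  fit₂ : ∀ b, (avg fun i => s.Z i * s.w' i * (-(s.D i * s.Y i * (s.β' ⬝ᵥ s.H i)) +
      s.m1' c i * antideriv c.ψY (s.β' ⬝ᵥ s.H i))) + c.A₂ * s.l₂ * penalty s.β' ≤
    (avg fun i => s.Z i * s.w' i * (-(s.D i * s.Y i * (b ⬝ᵥ s.H i)) +
      s.m1' c i * antideriv c.ψY (b ⬝ᵥ s.H i))) + c.A₂ * s.l₂ * penalty b

variable {s c}

lemma Good.Z_nonneg (hs : s.Good c) (i : Fin n) : 0 ≤ s.Z i := by
  rcases hs.Z01 i with h | h <;> simp [h]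

lemma w_pos (i : Fin n) : 0 < s.w i := Real.exp_pos _

lemma w'_pos (i : Fin n) : 0 < s.w' i := Real.exp_pos _

lemma Good.q_nonneg (hs : s.Good c) (i : Fin n) : 0 ≤ s.q i :=
  mul_nonneg (hs.Z_nonneg i) (w_pos i).le

lemma Good.l₁_pos (hs : s.Good c) : 0 < s.l₁ := hs.l₀_pos.trans_le hs.l₀_le_l₁

lemma Good.l₂_pos (hs : s.Good c) : 0 < s.l₂ := hs.l₀_pos.trans_le hs.l₀_le_l₂

lemma r₀_nonneg : 0 ≤ s.r₀ := mul_nonneg (Nat.cast_nonneg _) (sq_nonneg _)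

lemma r₀_le_r₁ : s.r₀ ≤ s.r₁ :=
  le_add_of_nonneg_right (mul_nonneg (Nat.cast_nonneg _) (sq_nonneg _))

lemma r₁_le_r₂ : s.r₁ ≤ s.r₂ :=
  le_add_of_nonneg_right (mul_nonneg (Nat.cast_nonneg _) (sq_nonneg _))

lemma N₀_nonneg : 0 ≤ s.N₀ := l1norm_nonneg _

lemma N₁_nonneg : 0 ≤ s.N₁ := l1norm_nonneg _

lemma N₂_nonneg : 0 ≤ s.N₂ := l1norm_nonneg _

lemma Good.Q₀_nonneg (hs : s.Good c) : 0 ≤ s.Q₀ :=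
  avg_nonneg fun i => mul_nonneg (hs.q_nonneg i) (sq_nonneg _)

lemma Good.Q₁_nonneg (hs : s.Good c) : 0 ≤ s.Q₁ :=
  avg_nonneg fun i => mul_nonneg (hs.q_nonneg i) (sq_nonneg _)

lemma Good.Qe_nonneg (hs : s.Good c) : 0 ≤ s.Qe c :=
  avg_nonneg fun i => mul_nonneg (mul_nonneg (hs.q_nonneg i) (sq_nonneg _)) (sq_nonneg _)

lemma dF_eq (i : Fin n) : s.γ' ⬝ᵥ s.F i - s.γ ⬝ᵥ s.F i = s.dF i := (sub_dotProduct _ _ _).symm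

lemma dG_eq (i : Fin n) : s.α' ⬝ᵥ s.G i - s.α ⬝ᵥ s.G i = s.dG i := (sub_dotProduct _ _ _).symm

lemma dH_eq (i : Fin n) : s.β' ⬝ᵥ s.H i - s.β ⬝ᵥ s.H i = s.dH i := (sub_dotProduct _ _ _).symm

lemma Good.abs_dF_le (hs : s.Good c) (i : Fin n) : |s.dF i| ≤ c.CF * s.N₀ :=
  abs_dotProduct_le (hs.F_le i) _

lemma Good.abs_dG_le (hs : s.Good c) (i : Fin n) : |s.dG i| ≤ c.CG * s.N₁ :=
  abs_dotProduct_le (hs.G_le i) _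

lemma Good.abs_dH_le (hs : s.Good c) (i : Fin n) : |s.dH i| ≤ c.CH * s.N₂ :=
  abs_dotProduct_le (hs.H_le i) _

end Sample

/-- Curvature of a loss with weight `a`, measured in the weight `q` with `θ q ≤ a`. -/
lemma weighted_curvature {ψ : ℝ → ℝ} {C X d θ q a u v : ℝ} (hC : 0 ≤ C)
    (hr : DerivRatioBound ψ C) (hm : Monotone ψ) (hψ : Differentiable ℝ ψ) (hX : |u - v| ≤ X)
    (hd : d ≤ deriv ψ v) (hd0 : 0 ≤ d) (hq : 0 ≤ q) (hθ : 0 ≤ θ) (ha : θ * q ≤ a) :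
    θ * Real.exp (-1) * d * (q * (u - v) ^ 2) / (1 + C * X) ≤ a * ((ψ u - ψ v) * (u - v)) := by
  have h0 : 0 ≤ (ψ u - ψ v) * (u - v) := by
    rcases le_total u v with h | h
    · exact mul_nonneg_of_nonpos_of_nonpos (sub_nonpos.2 (hm h)) (sub_nonpos.2 h)
    · exact mul_nonneg (sub_nonneg.2 (hm h)) (sub_nonneg.2 h)
  have h1 : Real.exp (-1) * d * (u - v) ^ 2 / (1 + C * X) ≤ (ψ u - ψ v) * (u - v) := by
    refine le_trans ?_ (curvature_lower hC hr hm hψ u v)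
    refine div_le_div₀ ?_ ?_ (by positivity) ?_
    · have := hd0.trans hd
      positivity
    · gcongr
    · gcongr
  calc θ * Real.exp (-1) * d * (q * (u - v) ^ 2) / (1 + C * X)
      = θ * q * (Real.exp (-1) * d * (u - v) ^ 2 / (1 + C * X)) := by ring
    _ ≤ θ * q * ((ψ u - ψ v) * (u - v)) := mul_le_mul_of_nonneg_left h1 (mul_nonneg hθ hq)
    _ ≤ _ := mul_le_mul_of_nonneg_right ha h0

namespace Sample

variable {n p q₁ q₂ : ℕ} {c : Constants}

/-! ### Error bounds for the three estimates -/

/-- The hypothesis on the sparsity, split into its terms. -/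
structure Small (s : Sample n p q₁ q₂) (η : ℝ) : Prop where
  γ : sparsity s.γ * s.l₀ ≤ η
  α : sparsity s.α * s.l₁ ≤ η
  α' : sparsity s.α * s.l₁ ^ 2 ≤ η * s.l₂
  β : sparsity s.β * s.l₂ ≤ η

lemma Small.mono {s : Sample n p q₁ q₂} {η η' : ℝ} (h : s.Small η) (hη : η ≤ η')
    (hl : 0 ≤ s.l₂) : s.Small η' :=
  ⟨h.γ.trans hη, h.α.trans hη, h.α'.trans (mul_le_mul_of_nonneg_right hη hl), h.β.trans hη⟩

lemma Small.r₀_le {s : Sample n p q₁ q₂} {η l : ℝ} (h : s.Small η) (hη : 0 ≤ η) (h0 : 0 ≤ s.l₀)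
    (hl : s.l₀ ≤ l) : s.r₀ ≤ η * l := by
  rw [r₀, sq, ← mul_assoc]
  exact mul_le_mul h.γ hl h0 hη

/-- The calibration loss of `γ` is a weighted Lasso loss with link `-e^{-u}`, without nuisance
parameters. -/
theorem bound_γ (hc : c.Valid) : ∃ M η : ℝ, 0 < M ∧ 0 < η ∧
    ∀ {n p q₁ q₂ : ℕ} (s : Sample n p q₁ q₂), s.Good c → s.Small η →
      s.l₀ * s.N₀ ≤ M * s.r₀ ∧ s.Q₀ ≤ M * s.r₀ ∧ s.N₀ ≤ 1 := by
  obtain ⟨M, η, hM, hη, H⟩ := lasso_bound (κ := Real.exp (-1)) (C := c.CF) (G := c.K)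
    hc.B₀ (Real.exp_pos _) hc.CF hc.ν₀ hc.μ₀ hc.K hc.A₀
  refine ⟨M, min η (1 / M), hM, by positivity, fun {n p q₁ q₂} s hs hsm => ?_⟩
  have key := H n p s.F s.Z (fun i => -(1 - s.Z i)) s.q (fun u => Real.exp (-u))
    (fun u => -Real.exp (-u)) s.γ' s.γ s.VF s.l₀ 0 hs.l₀_pos le_rfl hs.Z_nonneg hs.q_nonneg
    exp_neg_sub_le (by fun_prop) (fun b => by simpa only [neg_mul, sub_neg_eq_add] using hs.fit₀ b)
    (fun i => ?_) ?_ hs.gram₀ hs.compat₀ (hsm.γ.trans (min_le_left _ _))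
    (by have := hs.l₀_pos; simp only [ne_eq, OfNat.ofNat_ne_zero, not_false_eq_true, zero_pow]
        positivity)
  · simp only [ne_eq, OfNat.ofNat_ne_zero, not_false_eq_true, zero_pow, zero_add] at key
    refine ⟨key.1, key.2, ?_⟩
    have h1 : s.l₀ * s.N₀ ≤ s.l₀ * 1 := by
      refine key.1.trans ?_
      have : sparsity s.γ * s.l₀ ≤ 1 / M := hsm.γ.trans (min_le_right _ _)
      rw [le_div_iff₀ hM] at this
      have h2 := mul_le_mul_of_nonneg_right this hs.l₀_pos.le
      linarith
    exact le_of_mul_le_mul_left h1 hs.l₀_pos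
  · have h := weighted_curvature (q := s.Z i * s.w i / s.w i) (θ := 1) (a := s.Z i) zero_le_one
      derivRatioBound_neg_exp_neg monotone_neg_exp_neg
      differentiable_neg_exp_neg (u := s.γ' ⬝ᵥ s.F i) (v := s.γ ⬝ᵥ s.F i) (X := c.CF * s.N₀)
      (by rw [dF_eq]; exact hs.abs_dF_le i) (deriv_neg_exp_neg _).ge (Real.exp_pos _).le
      (by have := hs.Z_nonneg i; have := w_pos (s := s) i; positivity) zero_le_one
      (by rw [mul_div_cancel_right₀ _ (w_pos i).ne', one_mul])
    refine le_trans (le_of_eq ?_) h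
    rw [mul_div_cancel_right₀ _ (w_pos i).ne', dF_eq, one_mul, one_mul, q, w, N₀]
    simp only [dF]
    ring
  · rw [zero_mul, add_zero]
    refine le_trans (le_of_eq ?_) ((le_abs_self _).trans
      (abs_avg_mul_dotProduct_le hs.grad₀ (-(s.γ' - s.γ)) |>.trans_eq ?_))
    · congr 1; ext i
      rw [neg_dotProduct, r, w]
      ring
    · simp [l1norm, abs_sub_comm]

end Sample

namespace Sample

variable {n p q₁ q₂ : ℕ} {s : Sample n p q₁ q₂} {c : Constants}

lemma Good.abs_dF_le' (hs : s.Good c) (hc : c.Valid) (h : s.N₀ ≤ 1) (i : Fin n) :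
    |s.dF i| ≤ c.CF := (hs.abs_dF_le i).trans (mul_le_of_le_one_right hc.CF h)

lemma Good.abs_dG_le' (hs : s.Good c) (hc : c.Valid) (h : s.N₁ ≤ 1) (i : Fin n) :
    |s.dG i| ≤ c.CG := (hs.abs_dG_le i).trans (mul_le_of_le_one_right hc.CG h)

lemma Good.abs_dH_le' (hs : s.Good c) (hc : c.Valid) (h : s.N₂ ≤ 1) (i : Fin n) :
    |s.dH i| ≤ c.CH := (hs.abs_dH_le i).trans (mul_le_of_le_one_right hc.CH h)

lemma w'_eq (i : Fin n) : s.w' i = s.w i * Real.exp (-s.dF i) := by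
  rw [w', w, ← Real.exp_add, ← dF_eq]; congr 1; ring

lemma Good.le_w' (hs : s.Good c) (hc : c.Valid) (h : s.N₀ ≤ 1) (i : Fin n) :
    Real.exp (-c.CF) * s.w i ≤ s.w' i := by
  rw [w'_eq, mul_comm]
  refine mul_le_mul_of_nonneg_left (Real.exp_le_exp.2 ?_) (w_pos i).le
  have := (abs_le.1 (hs.abs_dF_le' hc h i)).2
  linarith

lemma Good.w'_le (hs : s.Good c) (hc : c.Valid) (h : s.N₀ ≤ 1) (i : Fin n) :
    s.w' i ≤ Real.exp c.CF * s.w i := by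
  rw [w'_eq, mul_comm]
  refine mul_le_mul_of_nonneg_right (Real.exp_le_exp.2 ?_) (w_pos i).le
  have := (abs_le.1 (hs.abs_dF_le' hc h i)).1
  linarith

lemma Good.abs_w'_sub_le (hs : s.Good c) (hc : c.Valid) (h : s.N₀ ≤ 1) (i : Fin n) :
    |s.w' i - s.w i| ≤ Real.exp c.CF * s.w i * |s.dF i| := by
  have := abs_exp_neg_sub_le (s.γ' ⬝ᵥ s.F i) (s.γ ⬝ᵥ s.F i)
  rw [dF_eq] at this
  refine this.trans (mul_le_mul_of_nonneg_right ?_ (abs_nonneg _))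
  rw [mul_comm]
  exact mul_le_mul_of_nonneg_right (Real.exp_le_exp.2 (hs.abs_dF_le' hc h i)) (w_pos i).le

lemma Good.abs_w'_taylor_le (hs : s.Good c) (hc : c.Valid) (h : s.N₀ ≤ 1) (i : Fin n) :
    |s.w' i - s.w i + s.w i * s.dF i| ≤ Real.exp c.CF * s.w i * s.dF i ^ 2 := by
  have := abs_exp_neg_taylor_le (s.γ' ⬝ᵥ s.F i) (s.γ ⬝ᵥ s.F i)
  rw [dF_eq] at this
  refine this.trans (mul_le_mul_of_nonneg_right ?_ (sq_nonneg _))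
  rw [mul_comm]
  exact mul_le_mul_of_nonneg_right (Real.exp_le_exp.2 (hs.abs_dF_le' hc h i)) (w_pos i).le

/-- The loss of `α₁` has the estimated weights `w'`; replacing them by `w` in the gradient costs
`O(√Q₀ √Q₁)` by the Cauchy–Schwarz inequality. -/
theorem bound_α (hc : c.Valid) {M₀ : ℝ} (hM₀ : 0 < M₀) : ∃ M η : ℝ, 0 < M ∧ 0 < η ∧
    ∀ {n p q₁ q₂ : ℕ} (s : Sample n p q₁ q₂), s.Good c → s.Small η → s.N₀ ≤ 1 →
      s.Q₀ ≤ M₀ * s.r₀ →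
      s.l₁ * s.N₁ ≤ M * s.r₁ ∧ s.Q₁ ≤ M * s.r₁ ∧ s.N₁ ≤ 1 := by
  have hd0 := deriv_zero_pos hc.linkD.strictMono hc.linkD.differentiable hc.ratioD
  have hmono := hc.linkD.strictMono.monotone
  set κ := Real.exp (-c.CF) * Real.exp (-1) * (deriv c.ψD 0 * Real.exp (-(c.C₂ * c.Ca))) with hκ
  have hκ0 : 0 < κ := by positivity
  obtain ⟨M, η, hM, hη, H⟩ := lasso_bound (κ := κ) (C := c.C₂ * c.CG) (G := c.K)
    hc.B₁ hκ0 (mul_nonneg hc.C₂ hc.CG) hc.ν₁ hc.μ₁ hc.K hc.A₁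
  set E := Real.exp c.CF with hE
  have hE0 : 0 < E := Real.exp_pos _
  set M' := M * (E ^ 2 * M₀ + 1) with hM'
  have hM'0 : 0 < M' := by positivity
  refine ⟨M', min η (min (η / (E ^ 2 * M₀)) (1 / (2 * M'))), hM'0, by positivity,
    fun {n p q₁ q₂} s hs hsm hN₀ hQ₀ => ?_⟩
  have hl₁ := hs.l₁_pos
  have hsl : 0 ≤ sparsity s.α * s.l₁ ^ 2 := mul_nonneg (Nat.cast_nonneg _) (sq_nonneg _)
  have hR2 : (E * √s.Q₀) ^ 2 = E ^ 2 * s.Q₀ := by rw [mul_pow, Real.sq_sqrt hs.Q₀_nonneg]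
  have key := H n q₁ s.G (fun i => s.Z i * s.w' i) (fun i => s.Z i * s.w' i * s.D i) s.q
    (antideriv c.ψD) c.ψD s.α' s.α s.VG s.l₁ (E * √s.Q₀) hl₁ (by positivity)
    (fun i => mul_nonneg (hs.Z_nonneg i) (w'_pos i).le) hs.q_nonneg
    (antideriv_sub_le hmono) hc.linkD.differentiable.continuous
    (fun b => ?_) (fun i => ?_) ?_ hs.gram₁ hs.compat₁ (hsm.α.trans (min_le_left _ _)) ?_
  · rw [hR2] at key
    have hle : M * (E ^ 2 * s.Q₀ + sparsity s.α * s.l₁ ^ 2) ≤ M' * s.r₁ := by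
      rw [hM', mul_assoc]
      refine mul_le_mul_of_nonneg_left ?_ hM.le
      have h1 := mul_le_mul_of_nonneg_left hQ₀ (sq_nonneg E)
      have h2 : 0 ≤ E ^ 2 * M₀ * (sparsity s.α * s.l₁ ^ 2) := by positivity
      have h3 := r₀_nonneg (s := s)
      rw [r₁]
      linarith
    refine ⟨key.1.trans hle, key.2.trans hle, ?_⟩
    refine le_of_mul_le_mul_left ((key.1.trans hle).trans ?_) hl₁
    have h1 : s.r₁ ≤ 1 / (2 * M') * s.l₁ + 1 / (2 * M') * s.l₁ := by
      refine add_le_add ?_ ?_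
      · exact (hsm.mono ((min_le_right _ _).trans (min_le_right _ _)) hs.l₂_pos.le).r₀_le
          (by positivity) hs.l₀_pos.le hs.l₀_le_l₁
      · rw [sq, ← mul_assoc]
        exact mul_le_mul_of_nonneg_right
          (hsm.α.trans ((min_le_right _ _).trans (min_le_right _ _))) hl₁.le
    refine (mul_le_mul_of_nonneg_left h1 hM'0.le).trans_eq ?_
    field_simp
    ring
  · convert hs.fit₁ b using 3 <;> · ext i; ring
  · have h := weighted_curvature (q := s.q i) (θ := Real.exp (-c.CF)) (a := s.Z i * s.w' i) hc.C₂
      hc.ratioD hmono hc.linkD.differentiable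
      (u := s.α' ⬝ᵥ s.G i) (v := s.α ⬝ᵥ s.G i) (X := c.CG * s.N₁)
      (by rw [dG_eq]; exact hs.abs_dG_le i)
      (le_deriv_of_abs_le hc.C₂ hc.ratioD hmono (hs.α_le i)) (by positivity) (hs.q_nonneg i)
      (Real.exp_pos _).le (by
        have := mul_le_mul_of_nonneg_left (hs.le_w' hc hN₀ i) (hs.Z_nonneg i)
        rw [q]; linarith)
    rw [← mul_assoc c.C₂] at h
    rw [dG_eq] at h ⊢
    exact h
  · have e1 : (avg fun i => (s.Z i * s.w' i * s.D i - s.Z i * s.w' i * c.ψD (s.α ⬝ᵥ s.G i)) *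
        ((s.α' - s.α) ⬝ᵥ s.G i)) =
        (avg fun i => s.q i * (s.D i - s.m1 c i) * ((s.α' - s.α) ⬝ᵥ s.G i)) +
        avg fun i => s.Z i * (s.w' i - s.w i) * (s.D i - s.m1 c i) * s.dG i := by
      rw [← avg_add]
      congr 1; ext i
      simp only [q, m1, dG]
      ring
    rw [e1]
    refine add_le_add ((le_abs_self _).trans (abs_avg_mul_dotProduct_le hs.grad₁ _)) ?_
    calc (avg fun i => s.Z i * (s.w' i - s.w i) * (s.D i - s.m1 c i) * s.dG i)
        ≤ avg fun i => E * (s.q i * (|s.dF i| * |s.dG i|)) := avg_mono fun i => by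
          refine (le_abs_self _).trans ?_
          have hm : |s.D i - s.m1 c i| ≤ 1 := by
            have h1 := (hc.linkD.pos (s.α ⬝ᵥ s.G i))
            have h2 := (hc.linkD.le_one (s.α ⬝ᵥ s.G i))
            rw [abs_le, m1]
            rcases hs.D01 i with h | h <;> rw [h] <;> constructor <;> linarith
          rw [abs_mul, abs_mul, abs_mul, abs_of_nonneg (hs.Z_nonneg i)]
          have h1 : s.Z i * |s.w' i - s.w i| * |s.D i - s.m1 c i| ≤
              s.Z i * (E * s.w i * |s.dF i|) * 1 :=
            mul_le_mul (mul_le_mul_of_nonneg_left (hs.abs_w'_sub_le hc hN₀ i) (hs.Z_nonneg i))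
              hm (abs_nonneg _)
              (mul_nonneg (hs.Z_nonneg i) (by have := w_pos (s := s) i; positivity))
          refine (mul_le_mul_of_nonneg_right h1 (abs_nonneg _)).trans_eq ?_
          rw [q]; ring
      _ = E * avg fun i => s.q i * (|s.dF i| * |s.dG i|) := avg_const_mul _ _
      _ ≤ E * (√s.Q₀ * √s.Q₁) :=
        mul_le_mul_of_nonneg_left (avg_mul_mul_le hs.q_nonneg _ _) hE0.le
      _ = _ := by rw [← mul_assoc]; rfl
  · rw [hR2]
    have h1 := (hsm.mono ((min_le_right _ _).trans (min_le_left _ _)) hs.l₂_pos.le).r₀_le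
      (by positivity) hs.l₀_pos.le hs.l₀_le_l₁
    calc E ^ 2 * s.Q₀ ≤ E ^ 2 * (M₀ * (η / (E ^ 2 * M₀) * s.l₁)) :=
          mul_le_mul_of_nonneg_left (hQ₀.trans (mul_le_mul_of_nonneg_left h1 hM₀.le))
            (sq_nonneg _)
      _ = η * s.l₁ := by field_simp

/-- The residuals are unbounded, but their conditional second moments are not, so the extra weight
`e²` does not change the order of the prediction error. -/
lemma Good.Qe_le (hs : s.Good c) (hc : c.Valid) {M₀ : ℝ} (h1 : s.l₀ * s.N₀ ≤ M₀ * s.r₀)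
    (h2 : s.Q₀ ≤ M₀ * s.r₀) (h3 : s.N₀ ≤ 1) : s.Qe c ≤ c.K * (2 + c.K) * M₀ * s.r₀ := by
  have h4 := hs.noise (s.γ' - s.γ)
  have h5 := (abs_le.1 (abs_avg_quad_sub_le hs.gram₀ (s.γ' - s.γ))).1
  change s.Qe c ≤ _ at h4
  change -_ ≤ s.Q₀ - _ at h5
  change _ ≤ c.K * (_ + s.l₀ * s.N₀ ^ 2) at h4
  change -(c.K * s.l₀ * s.N₀ ^ 2) ≤ _ at h5
  have h6 : s.l₀ * s.N₀ ^ 2 ≤ M₀ * s.r₀ := by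
    calc s.l₀ * s.N₀ ^ 2 = s.l₀ * s.N₀ * s.N₀ := by ring
      _ ≤ s.l₀ * s.N₀ * 1 :=
        mul_le_mul_of_nonneg_left h3 (mul_nonneg hs.l₀_pos.le N₀_nonneg)
      _ ≤ _ := by rwa [mul_one]
  refine h4.trans ?_
  have h7 := mul_le_mul_of_nonneg_left h6 hc.K
  rw [mul_assoc, mul_assoc]
  refine mul_le_mul_of_nonneg_left ?_ hc.K
  linarith

end Sample

namespace Constants

/-- A bound for `m₁₁` at the target value. -/
noncomputable def Lm (c : Constants) : ℝ := max |c.ψY (-c.Cb)| |c.ψY c.Cb|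

/-- A Lipschitz constant for `m₁` near the target value. -/
noncomputable def LD (c : Constants) : ℝ :=
  deriv c.ψD 0 * Real.exp (c.C₂ * c.Ca) * Real.exp (c.C₂ * c.CG)

/-- A Lipschitz constant for `m₁₁` near the target value. -/
noncomputable def LY (c : Constants) : ℝ :=
  deriv c.ψY 0 * Real.exp (c.C₃ * c.Cb) * Real.exp (c.C₃ * c.CH)

lemma Valid.LD_pos {c : Constants} (hc : c.Valid) : 0 < c.LD := by
  have := deriv_zero_pos hc.linkD.strictMono hc.linkD.differentiable hc.ratioD
  rw [Constants.LD]; positivity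

lemma Valid.LY_pos {c : Constants} (hc : c.Valid) : 0 < c.LY := by
  have := deriv_zero_pos hc.linkY.strictMono hc.linkY.differentiable hc.ratioY
  rw [Constants.LY]; positivity

lemma Lm_nonneg (c : Constants) : 0 ≤ c.Lm := le_max_of_le_left (abs_nonneg _)

end Constants

namespace Sample

variable {n p q₁ q₂ : ℕ} {s : Sample n p q₁ q₂} {c : Constants}

lemma Good.abs_m2_le (hs : s.Good c) (hc : c.Valid) (i : Fin n) : |s.m2 c i| ≤ c.Lm := by
  have h := abs_le.1 (hs.β_le i)
  exact abs_le_max_abs_abs (hc.linkY.strictMono.monotone h.1) (hc.linkY.strictMono.monotone h.2)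

lemma Good.abs_m1'_sub_le (hs : s.Good c) (hc : c.Valid) (h : s.N₁ ≤ 1) (i : Fin n) :
    |s.m1' c i - s.m1 c i| ≤ c.LD * |s.dG i| := by
  have hd0 := deriv_zero_pos hc.linkD.strictMono hc.linkD.differentiable hc.ratioD
  have h1 := abs_sub_le_deriv hc.C₂ hc.ratioD hc.linkD.strictMono.monotone
    hc.linkD.differentiable (s.α' ⬝ᵥ s.G i) (s.α ⬝ᵥ s.G i)
  rw [dG_eq] at h1
  refine h1.trans (mul_le_mul_of_nonneg_right ?_ (abs_nonneg _))
  refine mul_le_mul (deriv_le_of_abs_le hc.C₂ hc.ratioD hd0.le (hs.α_le i))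
    (Real.exp_le_exp.2 (mul_le_mul_of_nonneg_left (hs.abs_dG_le' hc h i) hc.C₂))
    (Real.exp_pos _).le (by positivity)

lemma Good.abs_m2'_sub_le (hs : s.Good c) (hc : c.Valid) (h : s.N₂ ≤ 1) (i : Fin n) :
    |s.m2' c i - s.m2 c i| ≤ c.LY * |s.dH i| := by
  have hd0 := deriv_zero_pos hc.linkY.strictMono hc.linkY.differentiable hc.ratioY
  have h1 := abs_sub_le_deriv hc.C₃ hc.ratioY hc.linkY.strictMono.monotone
    hc.linkY.differentiable (s.β' ⬝ᵥ s.H i) (s.β ⬝ᵥ s.H i)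
  rw [dH_eq] at h1
  refine h1.trans (mul_le_mul_of_nonneg_right ?_ (abs_nonneg _))
  refine mul_le_mul (deriv_le_of_abs_le hc.C₃ hc.ratioY hd0.le (hs.β_le i))
    (Real.exp_le_exp.2 (mul_le_mul_of_nonneg_left (hs.abs_dH_le' hc h i) hc.C₃))
    (Real.exp_pos _).le (by positivity)

lemma Good.abs_m1'_taylor_le (hs : s.Good c) (hc : c.Valid) (h : s.N₁ ≤ 1) (i : Fin n) :
    |s.m1' c i - s.m1 c i - deriv c.ψD (s.α ⬝ᵥ s.G i) * s.dG i| ≤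
      c.LD * c.C₂ * s.dG i ^ 2 := by
  have hd0 := deriv_zero_pos hc.linkD.strictMono hc.linkD.differentiable hc.ratioD
  have h1 := abs_taylor_le_deriv hc.C₂ hc.ratioD hc.linkD.strictMono.monotone
    hc.linkD.differentiable (s.α' ⬝ᵥ s.G i) (s.α ⬝ᵥ s.G i)
  rw [dG_eq] at h1
  refine h1.trans (mul_le_mul_of_nonneg_right ?_ (sq_nonneg _))
  rw [mul_comm c.C₂, ← mul_assoc]
  refine mul_le_mul_of_nonneg_right ?_ hc.C₂
  refine mul_le_mul (deriv_le_of_abs_le hc.C₂ hc.ratioD hd0.le (hs.α_le i))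
    (Real.exp_le_exp.2 ?_) (Real.exp_pos _).le (by positivity)
  exact mul_le_mul_of_nonneg_left (hs.abs_dG_le' hc h i) hc.C₂

lemma Good.abs_m2'_taylor_le (hs : s.Good c) (hc : c.Valid) (h : s.N₂ ≤ 1) (i : Fin n) :
    |s.m2' c i - s.m2 c i - deriv c.ψY (s.β ⬝ᵥ s.H i) * s.dH i| ≤
      c.LY * c.C₃ * s.dH i ^ 2 := by
  have hd0 := deriv_zero_pos hc.linkY.strictMono hc.linkY.differentiable hc.ratioY
  have h1 := abs_taylor_le_deriv hc.C₃ hc.ratioY hc.linkY.strictMono.monotone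
    hc.linkY.differentiable (s.β' ⬝ᵥ s.H i) (s.β ⬝ᵥ s.H i)
  rw [dH_eq] at h1
  refine h1.trans (mul_le_mul_of_nonneg_right ?_ (sq_nonneg _))
  rw [mul_comm c.C₃, ← mul_assoc]
  refine mul_le_mul_of_nonneg_right ?_ hc.C₃
  refine mul_le_mul (deriv_le_of_abs_le hc.C₃ hc.ratioY hd0.le (hs.β_le i))
    (Real.exp_le_exp.2 ?_) (Real.exp_pos _).le (by positivity)
  exact mul_le_mul_of_nonneg_left (hs.abs_dH_le' hc h i) hc.C₃

end Sample

namespace Sample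

variable {c : Constants}

/-- The loss of `α₁₁` has two nuisance parameters: the weights contribute `O(√Qe √Q₂)` to the
gradient and the estimate of `m₁` contributes `O(√Q₁ √Q₂)`. -/
theorem bound_β (hc : c.Valid) {M₀ : ℝ} (hM₀ : 0 < M₀) : ∃ M η : ℝ, 0 < M ∧ 0 < η ∧
    ∀ {n p q₁ q₂ : ℕ} (s : Sample n p q₁ q₂), s.Good c → s.Small η → s.N₀ ≤ 1 → s.N₁ ≤ 1 →
      s.Qe c ≤ M₀ * s.r₁ → s.Q₁ ≤ M₀ * s.r₁ →
      s.l₂ * s.N₂ ≤ M * s.r₂ ∧ s.Q₂ ≤ M * s.r₂ ∧ s.N₂ ≤ 1 := by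
  have hd0 := deriv_zero_pos hc.linkY.strictMono hc.linkY.differentiable hc.ratioY
  have hmono := hc.linkY.strictMono.monotone
  have hm0 := hc.linkD.pos (-(c.Ca + c.CG))
  set m := c.ψD (-(c.Ca + c.CG)) with hm
  set κ := Real.exp (-c.CF) * m * Real.exp (-1) *
    (deriv c.ψY 0 * Real.exp (-(c.C₃ * c.Cb))) with hκ
  have hκ0 : 0 < κ := by positivity
  obtain ⟨M, η, hM, hη, H⟩ := lasso_bound (κ := κ) (C := c.C₃ * c.CH) (G := c.K)
    hc.B₂ hκ0 (mul_nonneg hc.C₃ hc.CH) hc.ν₂ hc.μ₂ hc.K hc.A₂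
  set E := Real.exp c.CF with hE
  have hE0 : 0 < E := Real.exp_pos _
  have hLD := hc.LD_pos
  have hLm := c.Lm_nonneg
  set L := c.LD * c.Lm with hL
  have hL0 : 0 ≤ L := by positivity
  set T := 2 * E ^ 2 * (1 + L ^ 2) * M₀ with hT
  have hT0 : 0 < T := by positivity
  set M' := M * (T + 1) with hM'
  have hM'0 : 0 < M' := by positivity
  refine ⟨M', min η (min (η / (2 * T)) (1 / (3 * M'))), hM'0, by positivity,
    fun {n p q₁ q₂} s hs hsm hN₀ hN₁ hQe hQ₁ => ?_⟩
  have hl₂ := hs.l₂_pos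
  have hsl : 0 ≤ sparsity s.β * s.l₂ ^ 2 := mul_nonneg (Nat.cast_nonneg _) (sq_nonneg _)
  set R := E * √(s.Qe c) + E * L * √s.Q₁ with hR
  have hr₁ : ∀ {η' : ℝ}, 0 ≤ η' → s.Small η' → s.r₁ ≤ 2 * η' * s.l₂ := fun {η'} h0 h => by
    have h1 := h.r₀_le h0 hs.l₀_pos.le hs.l₀_le_l₂
    have h2 := h.α'
    rw [r₁]; linarith
  have hR2 : R ^ 2 ≤ T * s.r₁ := by
    have h1 : R ^ 2 ≤ 2 * ((E * √(s.Qe c)) ^ 2 + (E * L * √s.Q₁) ^ 2) := add_sq_le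
    rw [mul_pow, mul_pow, Real.sq_sqrt hs.Qe_nonneg, Real.sq_sqrt hs.Q₁_nonneg] at h1
    refine h1.trans ?_
    have h2 := mul_le_mul_of_nonneg_left hQe (sq_nonneg E)
    have h3 := mul_le_mul_of_nonneg_left hQ₁ (sq_nonneg (E * L))
    rw [hT]
    linarith
  have key := H n q₂ s.H (fun i => s.Z i * s.w' i * s.m1' c i)
    (fun i => s.Z i * s.w' i * (s.D i * s.Y i)) s.q
    (antideriv c.ψY) c.ψY s.β' s.β s.VH s.l₂ R hl₂ (by positivity)
    (fun i => mul_nonneg (mul_nonneg (hs.Z_nonneg i) (w'_pos i).le) (hc.linkD.pos _).le)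
    hs.q_nonneg (antideriv_sub_le hmono) hc.linkY.differentiable.continuous
    (fun b => ?_) (fun i => ?_) ?_ hs.gram₂ hs.compat₂ (hsm.β.trans (min_le_left _ _)) ?_
  · have hle : M * (R ^ 2 + sparsity s.β * s.l₂ ^ 2) ≤ M' * s.r₂ := by
      rw [hM', mul_assoc]
      refine mul_le_mul_of_nonneg_left ?_ hM.le
      have h2 : 0 ≤ T * (sparsity s.β * s.l₂ ^ 2) := by positivity
      have h3 := (r₀_nonneg (s := s)).trans r₀_le_r₁
      rw [r₂]
      linarith
    refine ⟨key.1.trans hle, key.2.trans hle, ?_⟩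
    refine le_of_mul_le_mul_left ((key.1.trans hle).trans ?_) hl₂
    have h1 : s.r₂ ≤ 2 * (1 / (3 * M')) * s.l₂ + 1 / (3 * M') * s.l₂ := by
      refine add_le_add ?_ ?_
      · exact hr₁ (by positivity) (hsm.mono ((min_le_right _ _).trans (min_le_right _ _)) hl₂.le)
      · rw [sq, ← mul_assoc]
        exact mul_le_mul_of_nonneg_right
          (hsm.β.trans ((min_le_right _ _).trans (min_le_right _ _))) hl₂.le
    refine (mul_le_mul_of_nonneg_left h1 hM'0.le).trans_eq ?_
    field_simp
    ring
  · convert hs.fit₂ b using 3 <;> · ext i; ring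
  · have h := weighted_curvature (q := s.q i) (θ := Real.exp (-c.CF) * m)
      (a := s.Z i * s.w' i * s.m1' c i) hc.C₃
      hc.ratioY hmono hc.linkY.differentiable
      (u := s.β' ⬝ᵥ s.H i) (v := s.β ⬝ᵥ s.H i) (X := c.CH * s.N₂)
      (by rw [dH_eq]; exact hs.abs_dH_le i)
      (le_deriv_of_abs_le hc.C₃ hc.ratioY hmono (hs.β_le i)) (by positivity) (hs.q_nonneg i)
      (by positivity) (by
        have h1 := mul_le_mul_of_nonneg_left (hs.le_w' hc hN₀ i) (hs.Z_nonneg i)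
        have h2 : m ≤ s.m1' c i := by
          refine hc.linkD.strictMono.monotone ?_
          have h3 := (abs_le.1 (hs.α_le i)).1
          have h4 := (abs_le.1 (hs.abs_dG_le' hc hN₁ i)).1
          have h5 := dG_eq (s := s) i
          linarith
        calc Real.exp (-c.CF) * m * s.q i = s.Z i * (Real.exp (-c.CF) * s.w i) * m := by
              rw [q]; ring
          _ ≤ _ := mul_le_mul h1 h2 hm0.le (mul_nonneg (hs.Z_nonneg i) (w'_pos i).le))
    rw [← mul_assoc c.C₃] at h
    rw [dH_eq] at h ⊢
    exact h
  · have e1 : (avg fun i => (s.Z i * s.w' i * (s.D i * s.Y i) -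
        s.Z i * s.w' i * s.m1' c i * c.ψY (s.β ⬝ᵥ s.H i)) * ((s.β' - s.β) ⬝ᵥ s.H i)) =
        (avg fun i => s.q i * s.e c i * ((s.β' - s.β) ⬝ᵥ s.H i)) +
        ((avg fun i => s.Z i * (s.w' i - s.w i) * s.e c i * s.dH i) +
        avg fun i => -(s.Z i * s.w' i * (s.m1' c i - s.m1 c i) * s.m2 c i * s.dH i)) := by
      rw [← avg_add, ← avg_add]
      congr 1; ext i
      simp only [q, e, m1, m2, dH]
      ring
    rw [e1]
    refine add_le_add ((le_abs_self _).trans (abs_avg_mul_dotProduct_le hs.grad₂ _)) ?_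
    rw [hR, add_mul]
    refine add_le_add ?_ ?_
    · calc (avg fun i => s.Z i * (s.w' i - s.w i) * s.e c i * s.dH i)
          ≤ avg fun i => E * (s.q i * (|s.e c i * s.dF i| * |s.dH i|)) := avg_mono fun i => by
            refine (le_abs_self _).trans ?_
            rw [abs_mul, abs_mul, abs_mul, abs_of_nonneg (hs.Z_nonneg i)]
            have h1 := mul_le_mul_of_nonneg_left (hs.abs_w'_sub_le hc hN₀ i) (hs.Z_nonneg i)
            have h2 := mul_le_mul_of_nonneg_right
              (mul_le_mul_of_nonneg_right h1 (abs_nonneg (s.e c i))) (abs_nonneg (s.dH i))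
            refine h2.trans_eq ?_
            rw [q, abs_mul]; ring
        _ = E * avg fun i => s.q i * (|s.e c i * s.dF i| * |s.dH i|) := avg_const_mul _ _
        _ ≤ E * (√(avg fun i => s.q i * (s.e c i * s.dF i) ^ 2) * √s.Q₂) :=
          mul_le_mul_of_nonneg_left (avg_mul_mul_le hs.q_nonneg _ _) hE0.le
        _ = _ := by
          rw [← mul_assoc]
          simp only [mul_pow, ← mul_assoc]
          rfl
    · calc (avg fun i => -(s.Z i * s.w' i * (s.m1' c i - s.m1 c i) * s.m2 c i * s.dH i))
          ≤ avg fun i => E * L * (s.q i * (|s.dG i| * |s.dH i|)) := avg_mono fun i => by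
            refine (neg_le_abs _).trans ?_
            rw [abs_mul, abs_mul, abs_mul, abs_of_nonneg
              (mul_nonneg (hs.Z_nonneg i) (w'_pos i).le)]
            have hZw : 0 ≤ s.Z i * (E * s.w i) :=
              mul_nonneg (hs.Z_nonneg i) (mul_nonneg hE0.le (w_pos i).le)
            have h1 : s.Z i * s.w' i * |s.m1' c i - s.m1 c i| * |s.m2 c i| ≤
                s.Z i * (E * s.w i) * (c.LD * |s.dG i|) * c.Lm := by
              refine mul_le_mul (mul_le_mul ?_ (hs.abs_m1'_sub_le hc hN₁ i) (abs_nonneg _) hZw)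
                (hs.abs_m2_le hc i) (abs_nonneg _) (mul_nonneg hZw (by positivity))
              exact mul_le_mul_of_nonneg_left (hs.w'_le hc hN₀ i) (hs.Z_nonneg i)
            refine (mul_le_mul_of_nonneg_right h1 (abs_nonneg _)).trans_eq ?_
            rw [q, hL]; ring
        _ = E * L * avg fun i => s.q i * (|s.dG i| * |s.dH i|) := avg_const_mul _ _
        _ ≤ E * L * (√s.Q₁ * √s.Q₂) :=
          mul_le_mul_of_nonneg_left (avg_mul_mul_le hs.q_nonneg _ _) (by positivity)
        _ = _ := by rw [← mul_assoc]; rfl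
  · refine hR2.trans ?_
    have h1 := hr₁ (by positivity)
      (hsm.mono ((min_le_right _ _).trans (min_le_left _ _)) hl₂.le)
    refine (mul_le_mul_of_nonneg_left h1 hT0.le).trans_eq ?_
    field_simp

/-- The rates of convergence of the three estimates, with a common constant. -/
structure Rates (c : Constants) {n p q₁ q₂ : ℕ} (s : Sample n p q₁ q₂) (M : ℝ) : Prop where
  N₀ : s.N₀ ≤ 1
  N₁ : s.N₁ ≤ 1
  N₂ : s.N₂ ≤ 1
  γ : s.l₀ * s.N₀ ≤ M * s.r₀
  α : s.l₁ * s.N₁ ≤ M * s.r₂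
  β : s.l₂ * s.N₂ ≤ M * s.r₂
  Q₀ : s.Q₀ ≤ M * s.r₂
  Q₁ : s.Q₁ ≤ M * s.r₂
  Q₂ : s.Q₂ ≤ M * s.r₂
  Qe : s.Qe c ≤ M * s.r₂

theorem exists_rates (hc : c.Valid) : ∃ M η : ℝ, 0 < M ∧ 0 < η ∧
    ∀ {n p q₁ q₂ : ℕ} (s : Sample n p q₁ q₂), s.Good c → s.Small η → s.Rates c M := by
  obtain ⟨M₀, η₀, hM₀, hη₀, H₀⟩ := bound_γ hc
  obtain ⟨M₁, η₁, hM₁, hη₁, H₁⟩ := bound_α hc hM₀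
  set Me := c.K * (2 + c.K) * M₀ with hMe
  have hMe0 : 0 ≤ Me := by have := hc.K; positivity
  obtain ⟨M₂, η₂, hM₂, hη₂, H₂⟩ := bound_β hc (M₀ := Me + M₁) (by positivity)
  refine ⟨M₀ + M₁ + M₂ + Me, min η₀ (min η₁ η₂), by positivity, by positivity,
    fun {n p q₁ q₂} s hs hsm => ?_⟩
  have hl₂ := hs.l₂_pos.le
  have r0 := r₀_nonneg (s := s)
  have r01 := r₀_le_r₁ (s := s)
  have r12 := r₁_le_r₂ (s := s)
  have up : ∀ {m r r' x : ℝ}, x ≤ m * r → 0 ≤ m → m ≤ M₀ + M₁ + M₂ + Me → 0 ≤ r → r ≤ r' →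
      x ≤ (M₀ + M₁ + M₂ + Me) * r' := fun hx hm hm' hr hr' =>
    hx.trans (mul_le_mul hm' hr' hr (hm.trans hm'))
  obtain ⟨a1, a2, a3⟩ := H₀ s hs (hsm.mono (min_le_left _ _) hl₂)
  obtain ⟨b1, b2, b3⟩ := H₁ s hs
    (hsm.mono ((min_le_right _ _).trans (min_le_left _ _)) hl₂) a3 a2
  have e1 := hs.Qe_le hc a1 a2 a3
  have e2 : s.Qe c ≤ (Me + M₁) * s.r₁ :=
    e1.trans (mul_le_mul (by linarith) r01 r0 (by positivity))
  have e3 : s.Q₁ ≤ (Me + M₁) * s.r₁ :=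
    b2.trans (mul_le_mul_of_nonneg_right (by linarith) (by linarith))
  obtain ⟨d1, d2, d3⟩ := H₂ s hs
    (hsm.mono ((min_le_right _ _).trans (min_le_right _ _)) hl₂) a3 b3 e2 e3
  exact ⟨a3, b3, d3, up a1 hM₀.le (by linarith) r0 le_rfl,
    up b1 hM₁.le (by linarith) (by linarith) r12,
    up d1 hM₂.le (by linarith) (by linarith) le_rfl,
    up a2 hM₀.le (by linarith) r0 (by linarith),
    up b2 hM₁.le (by linarith) (by linarith) r12,
    up d2 hM₂.le (by linarith) (by linarith) le_rfl,
    up e1 hMe0 (by linarith) r0 (by linarith)⟩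

end Sample

namespace Sample

/-! ### Expansion of the augmented inverse probability weighted function -/

section

variable {n p q₁ q₂ : ℕ} (s : Sample n p q₁ q₂) (c : Constants)

/-- The error of the product `m₁ m₁₁`. -/
noncomputable def δ (i : Fin n) : ℝ := s.m1' c i * s.m2' c i - s.m1 c i * s.m2 c i

/-- The error of the augmented inverse probability weighted function, written in terms of the errors
of the weight and of `m₁ m₁₁`. -/
noncomputable def dphi (i : Fin n) : ℝ :=
  s.Z i * (s.w' i - s.w i) * s.e c i - s.Z i * (s.w' i - s.w i) * s.δ c i + s.r i * s.δ c i

variable {s c}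

/-- `r` is `1` if `Z = 0` and `-q` if `Z = 1`. -/
lemma Good.abs_r_le (hs : s.Good c) (i : Fin n) : |s.r i| ≤ s.r i + 2 * s.q i := by
  have h := hs.q_nonneg i
  have h1 : s.r i = 1 - s.Z i - s.q i := rfl
  have h2 : s.Z i ≤ 1 := by rcases hs.Z01 i with h | h <;> simp [h]
  rw [abs_le]
  constructor <;> linarith

lemma Good.avg_abs_r_le (hs : s.Good c) (x : Fin n → ℝ) :
    (avg fun i => |s.r i| * x i ^ 2) ≤
      (avg fun i => s.r i * x i ^ 2) + 2 * avg fun i => s.q i * x i ^ 2 := by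
  rw [← avg_const_mul, ← avg_add]
  refine avg_mono fun i => ?_
  have := mul_le_mul_of_nonneg_right (hs.abs_r_le i) (sq_nonneg (x i))
  linarith

lemma Rates.nonneg {M : ℝ} (hr : s.Rates c M) (hs : s.Good c) : 0 ≤ M * s.r₂ :=
  hs.Q₀_nonneg.trans hr.Q₀

/-- Units with `Z = 0` carry no weight in the fitted losses. Their prediction errors are controlled
because the correctly specified propensity score balances the second moments of the regressors. -/
lemma Good.avg_abs_r_dG_le (hs : s.Good c) (hc : c.Valid) {M : ℝ} (hr : s.Rates c M) :
    (avg fun i => |s.r i| * s.dG i ^ 2) ≤ (c.K + 2) * (M * s.r₂) := by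
  have h1 := hs.avg_abs_r_le s.dG
  have h2 := abs_avg_quad_sub_le (M := 0) (fun j l => by simpa using hs.bal₁ j l) (s.α' - s.α)
  simp only [Matrix.zero_mulVec, dotProduct_zero, sub_zero] at h2
  have h3 : (avg fun i => s.r i * s.dG i ^ 2) ≤ c.K * s.l₁ * s.N₁ ^ 2 := (le_abs_self _).trans h2
  have h4 : s.l₁ * s.N₁ * s.N₁ ≤ M * s.r₂ :=
    (mul_le_of_le_one_right (mul_nonneg hs.l₁_pos.le N₁_nonneg) hr.N₁).trans hr.α
  have h5 := mul_le_mul_of_nonneg_left h4 hc.K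
  have h6 : (avg fun i => s.q i * s.dG i ^ 2) ≤ M * s.r₂ := hr.Q₁
  linarith

lemma Good.avg_abs_r_dH_le (hs : s.Good c) (hc : c.Valid) {M : ℝ} (hr : s.Rates c M) :
    (avg fun i => |s.r i| * s.dH i ^ 2) ≤ (c.K + 2) * (M * s.r₂) := by
  have h1 := hs.avg_abs_r_le s.dH
  have h2 := abs_avg_quad_sub_le (M := 0) (fun j l => by simpa using hs.bal₂ j l) (s.β' - s.β)
  simp only [Matrix.zero_mulVec, dotProduct_zero, sub_zero] at h2
  have h3 : (avg fun i => s.r i * s.dH i ^ 2) ≤ c.K * s.l₂ * s.N₂ ^ 2 := (le_abs_self _).trans h2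
  have h4 : s.l₂ * s.N₂ * s.N₂ ≤ M * s.r₂ :=
    (mul_le_of_le_one_right (mul_nonneg hs.l₂_pos.le N₂_nonneg) hr.N₂).trans hr.β
  have h5 := mul_le_mul_of_nonneg_left h4 hc.K
  have h6 : (avg fun i => s.q i * s.dH i ^ 2) ≤ M * s.r₂ := hr.Q₂
  linarith

lemma abs_m1'_sub_le_one (hc : c.Valid) (i : Fin n) : |s.m1' c i - s.m1 c i| ≤ 1 := by
  have h1 := hc.linkD.pos (s.α ⬝ᵥ s.G i)
  have h2 := hc.linkD.le_one (s.α ⬝ᵥ s.G i)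
  have h3 := hc.linkD.pos (s.α' ⬝ᵥ s.G i)
  have h4 := hc.linkD.le_one (s.α' ⬝ᵥ s.G i)
  rw [abs_le, m1, m1']
  constructor <;> linarith

lemma abs_m1_le_one (hc : c.Valid) (i : Fin n) : |s.m1 c i| ≤ 1 := by
  rw [m1, abs_of_pos (hc.linkD.pos _)]
  exact hc.linkD.le_one _

lemma Good.abs_δ_le (hs : s.Good c) (hc : c.Valid) (h₁ : s.N₁ ≤ 1) (h₂ : s.N₂ ≤ 1) (i : Fin n) :
    |s.δ c i| ≤ (c.Lm * c.LD + 2 * c.LY) * (|s.dG i| + |s.dH i|) := by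
  have e : s.δ c i = s.m2 c i * (s.m1' c i - s.m1 c i) + s.m1 c i * (s.m2' c i - s.m2 c i) +
      (s.m1' c i - s.m1 c i) * (s.m2' c i - s.m2 c i) := by
    rw [δ]; ring
  have hLm := c.Lm_nonneg
  have hLD := hc.LD_pos
  have hLY := hc.LY_pos
  have b2 := hs.abs_m2'_sub_le hc h₂ i
  have h1 : |s.m2 c i * (s.m1' c i - s.m1 c i)| ≤ c.Lm * (c.LD * |s.dG i|) := by
    rw [abs_mul]
    exact mul_le_mul (hs.abs_m2_le hc i) (hs.abs_m1'_sub_le hc h₁ i) (abs_nonneg _) hLm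
  have h2 : |s.m1 c i * (s.m2' c i - s.m2 c i)| ≤ 1 * (c.LY * |s.dH i|) := by
    rw [abs_mul]
    exact mul_le_mul (abs_m1_le_one hc i) b2 (abs_nonneg _) zero_le_one
  have h3 : |(s.m1' c i - s.m1 c i) * (s.m2' c i - s.m2 c i)| ≤ 1 * (c.LY * |s.dH i|) := by
    rw [abs_mul]
    exact mul_le_mul (abs_m1'_sub_le_one hc i) b2 (abs_nonneg _) zero_le_one
  have h4 := (abs_add_le (s.m2 c i * (s.m1' c i - s.m1 c i) + s.m1 c i * (s.m2' c i - s.m2 c i))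
    ((s.m1' c i - s.m1 c i) * (s.m2' c i - s.m2 c i)))
  have h5 := abs_add_le (s.m2 c i * (s.m1' c i - s.m1 c i)) (s.m1 c i * (s.m2' c i - s.m2 c i))
  rw [e]
  have p1 : 0 ≤ c.Lm * c.LD * |s.dH i| := by positivity
  have p2 : 0 ≤ c.LY * |s.dG i| := by positivity
  linarith

lemma Good.δ_sq_le (hs : s.Good c) (hc : c.Valid) (h₁ : s.N₁ ≤ 1) (h₂ : s.N₂ ≤ 1) (i : Fin n) :
    s.δ c i ^ 2 ≤ 2 * (c.Lm * c.LD + 2 * c.LY) ^ 2 * (s.dG i ^ 2 + s.dH i ^ 2) := by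
  have h := pow_le_pow_left₀ (abs_nonneg _) (hs.abs_δ_le hc h₁ h₂ i) 2
  rw [sq_abs, mul_pow] at h
  have h1 : (|s.dG i| + |s.dH i|) ^ 2 ≤ 2 * (|s.dG i| ^ 2 + |s.dH i| ^ 2) := add_sq_le
  rw [sq_abs, sq_abs] at h1
  have h2 := mul_le_mul_of_nonneg_left h1 (sq_nonneg (c.Lm * c.LD + 2 * c.LY))
  linarith

/-- First order expansion of `m₁ m₁₁` in the two linear predictors. -/
lemma Good.abs_δ_taylor_le (hs : s.Good c) (hc : c.Valid) (h₁ : s.N₁ ≤ 1) (h₂ : s.N₂ ≤ 1)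
    (i : Fin n) :
    |s.δ c i - s.m2 c i * deriv c.ψD (s.α ⬝ᵥ s.G i) * s.dG i -
        s.m1 c i * deriv c.ψY (s.β ⬝ᵥ s.H i) * s.dH i| ≤
      (c.Lm * (c.LD * c.C₂) + c.LY * c.C₃ + c.LD * c.LY) * (s.dG i ^ 2 + s.dH i ^ 2) := by
  have e : s.δ c i - s.m2 c i * deriv c.ψD (s.α ⬝ᵥ s.G i) * s.dG i -
        s.m1 c i * deriv c.ψY (s.β ⬝ᵥ s.H i) * s.dH i =
      s.m2 c i * (s.m1' c i - s.m1 c i - deriv c.ψD (s.α ⬝ᵥ s.G i) * s.dG i) +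
      s.m1 c i * (s.m2' c i - s.m2 c i - deriv c.ψY (s.β ⬝ᵥ s.H i) * s.dH i) +
      (s.m1' c i - s.m1 c i) * (s.m2' c i - s.m2 c i) := by
    rw [δ]; ring
  have hLm := c.Lm_nonneg
  have hLD := hc.LD_pos
  have hLY := hc.LY_pos
  have hC₂ := hc.C₂
  have hC₃ := hc.C₃
  have h1 : |s.m2 c i * (s.m1' c i - s.m1 c i - deriv c.ψD (s.α ⬝ᵥ s.G i) * s.dG i)| ≤
      c.Lm * (c.LD * c.C₂ * s.dG i ^ 2) := by
    rw [abs_mul]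
    exact mul_le_mul (hs.abs_m2_le hc i) (hs.abs_m1'_taylor_le hc h₁ i) (abs_nonneg _) hLm
  have h2 : |s.m1 c i * (s.m2' c i - s.m2 c i - deriv c.ψY (s.β ⬝ᵥ s.H i) * s.dH i)| ≤
      1 * (c.LY * c.C₃ * s.dH i ^ 2) := by
    rw [abs_mul]
    exact mul_le_mul (abs_m1_le_one hc i) (hs.abs_m2'_taylor_le hc h₂ i) (abs_nonneg _)
      zero_le_one
  have h3 : |(s.m1' c i - s.m1 c i) * (s.m2' c i - s.m2 c i)| ≤
      c.LD * c.LY * (s.dG i ^ 2 + s.dH i ^ 2) := by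
    rw [abs_mul]
    have h4 := mul_le_mul (hs.abs_m1'_sub_le hc h₁ i) (hs.abs_m2'_sub_le hc h₂ i) (abs_nonneg _)
      (by positivity)
    have h5 := two_mul_le_add_sq |s.dG i| |s.dH i|
    rw [sq_abs, sq_abs] at h5
    have h6 : |s.dG i| * |s.dH i| ≤ s.dG i ^ 2 + s.dH i ^ 2 := by
      have : 0 ≤ |s.dG i| * |s.dH i| := by positivity
      linarith
    have h7 := mul_le_mul_of_nonneg_left h6 (by positivity : 0 ≤ c.LD * c.LY)
    linarith
  have h4 := (abs_add_le
    (s.m2 c i * (s.m1' c i - s.m1 c i - deriv c.ψD (s.α ⬝ᵥ s.G i) * s.dG i) +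
      s.m1 c i * (s.m2' c i - s.m2 c i - deriv c.ψY (s.β ⬝ᵥ s.H i) * s.dH i))
    ((s.m1' c i - s.m1 c i) * (s.m2' c i - s.m2 c i)))
  have h5 := abs_add_le (s.m2 c i * (s.m1' c i - s.m1 c i - deriv c.ψD (s.α ⬝ᵥ s.G i) * s.dG i))
    (s.m1 c i * (s.m2' c i - s.m2 c i - deriv c.ψY (s.β ⬝ᵥ s.H i) * s.dH i))
  rw [e]
  have p1 : 0 ≤ c.Lm * (c.LD * c.C₂) * s.dH i ^ 2 := by positivity
  have p2 : 0 ≤ c.LY * c.C₃ * s.dG i ^ 2 := by positivity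
  linarith

/-- The first order part in the weight is handled by the estimating equation of `α₁₁`, whose
regressors include those of the propensity score; the remainder by the noise moment. -/
lemma Good.abs_avg_weight_resid_le (hs : s.Good c) (hc : c.Valid) {M : ℝ} (hr : s.Rates c M) :
    |avg fun i => s.Z i * (s.w' i - s.w i) * s.e c i| ≤
      c.B₂ * s.l₂ * s.N₀ + 2 * Real.exp c.CF * (M * s.r₂) := by
  have e : (avg fun i => s.Z i * (s.w' i - s.w i) * s.e c i) =
      -(avg fun i => s.q i * s.e c i * ((s.γ' - s.γ) ⬝ᵥ s.F i)) +
      avg fun i => s.Z i * (s.w' i - s.w i + s.w i * s.dF i) * s.e c i := by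
    rw [eq_neg_add_iff_add_eq, ← avg_add]
    congr 1; ext i
    simp only [q, dF]
    ring
  have h1 : |avg fun i => s.q i * s.e c i * ((s.γ' - s.γ) ⬝ᵥ s.F i)| ≤ c.B₂ * s.l₂ * s.N₀ :=
    abs_avg_mul_dotProduct_le hs.resid _
  have h2 : |avg fun i => s.Z i * (s.w' i - s.w i + s.w i * s.dF i) * s.e c i| ≤
      Real.exp c.CF * (s.Q₀ + s.Qe c) := by
    refine (abs_avg_le _).trans ?_
    rw [Q₀, Qe, ← avg_add, ← avg_const_mul]
    refine avg_mono fun i => ?_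
    rw [abs_mul, abs_mul, abs_of_nonneg (hs.Z_nonneg i)]
    have h3 := mul_le_mul_of_nonneg_right (mul_le_mul_of_nonneg_left
      (hs.abs_w'_taylor_le hc hr.N₀ i) (hs.Z_nonneg i)) (abs_nonneg (s.e c i))
    have h4 : |s.e c i| ≤ 1 + s.e c i ^ 2 := by
      have := two_mul_le_add_sq 1 |s.e c i|
      rw [sq_abs] at this
      have := abs_nonneg (s.e c i)
      linarith
    have h5 : 0 ≤ Real.exp c.CF * (s.q i * s.dF i ^ 2) :=
      mul_nonneg (Real.exp_pos _).le (mul_nonneg (hs.q_nonneg i) (sq_nonneg _))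
    have h6 := mul_le_mul_of_nonneg_left h4 h5
    calc _ ≤ _ := h3
      _ = Real.exp c.CF * (s.q i * s.dF i ^ 2) * |s.e c i| := by rw [q]; ring
      _ ≤ _ := h6
      _ = _ := by ring
  have h3 := abs_add_le (-(avg fun i => s.q i * s.e c i * ((s.γ' - s.γ) ⬝ᵥ s.F i)))
    (avg fun i => s.Z i * (s.w' i - s.w i + s.w i * s.dF i) * s.e c i)
  rw [abs_neg] at h3
  rw [e]
  have h4 := mul_le_mul_of_nonneg_left (add_le_add hr.Q₀ hr.Qe) (Real.exp_pos c.CF).le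
  linarith

/-- The product of the error of the weight and the error of `m₁ m₁₁` is of second order. -/
lemma Good.abs_avg_weight_δ_le (hs : s.Good c) (hc : c.Valid) {M : ℝ} (hr : s.Rates c M) :
    |avg fun i => s.Z i * (s.w' i - s.w i) * s.δ c i| ≤
      3 * Real.exp c.CF * (c.Lm * c.LD + 2 * c.LY) * (M * s.r₂) := by
  have hLm := c.Lm_nonneg
  have hLD := hc.LD_pos
  have hLY := hc.LY_pos
  have h0 : 0 ≤ Real.exp c.CF * (c.Lm * c.LD + 2 * c.LY) := by positivity
  have h1 : |avg fun i => s.Z i * (s.w' i - s.w i) * s.δ c i| ≤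
      Real.exp c.CF * (c.Lm * c.LD + 2 * c.LY) * (s.Q₀ + s.Q₁ + s.Q₂) := by
    refine (abs_avg_le _).trans ?_
    rw [Q₀, Q₁, Q₂, ← avg_add, ← avg_add, ← avg_const_mul]
    refine avg_mono fun i => ?_
    rw [abs_mul, abs_mul, abs_of_nonneg (hs.Z_nonneg i)]
    have hw := w_pos (s := s) i
    have h3 := mul_le_mul (mul_le_mul_of_nonneg_left
      (hs.abs_w'_sub_le hc hr.N₀ i) (hs.Z_nonneg i)) (hs.abs_δ_le hc hr.N₁ hr.N₂ i)
      (abs_nonneg _) (mul_nonneg (hs.Z_nonneg i) (by positivity))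
    have h4 : |s.dF i| * (|s.dG i| + |s.dH i|) ≤ s.dF i ^ 2 + s.dG i ^ 2 + s.dH i ^ 2 := by
      have a1 := two_mul_le_add_sq |s.dF i| |s.dG i|
      have a2 := two_mul_le_add_sq |s.dF i| |s.dH i|
      simp only [sq_abs] at a1 a2
      have a3 := sq_nonneg (s.dG i)
      have a4 := sq_nonneg (s.dH i)
      linarith
    have h5 := mul_le_mul_of_nonneg_left h4 (mul_nonneg h0 (hs.q_nonneg i))
    calc _ ≤ _ := h3
      _ = Real.exp c.CF * (c.Lm * c.LD + 2 * c.LY) * s.q i *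
          (|s.dF i| * (|s.dG i| + |s.dH i|)) := by rw [q]; ring
      _ ≤ _ := h5
      _ = _ := by ring
  have h2 := mul_le_mul_of_nonneg_left (add_le_add (add_le_add hr.Q₀ hr.Q₁) hr.Q₂) h0
  linarith

/-- The part of `δ` that is linear in `α₁` and `α₁₁` is balanced, being a function of the covariates;
the rest is quadratic. -/
lemma Good.abs_avg_balance_δ_le (hs : s.Good c) (hc : c.Valid) {M : ℝ} (hr : s.Rates c M) :
    |avg fun i => s.r i * s.δ c i| ≤
      (2 * c.K + 2 * (c.Lm * (c.LD * c.C₂) + c.LY * c.C₃ + c.LD * c.LY) * (c.K + 2)) *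
        (M * s.r₂) := by
  have hLm := c.Lm_nonneg
  have hLD := hc.LD_pos
  have hLY := hc.LY_pos
  have hC₂ := hc.C₂
  have hC₃ := hc.C₃
  set T := c.Lm * (c.LD * c.C₂) + c.LY * c.C₃ + c.LD * c.LY with hT
  have hT0 : 0 ≤ T := by positivity
  have e : (avg fun i => s.r i * s.δ c i) =
      (avg fun i => s.r i * (s.m2 c i * deriv c.ψD (s.α ⬝ᵥ s.G i)) * ((s.α' - s.α) ⬝ᵥ s.G i)) +
      (avg fun i => s.r i * (s.m1 c i * deriv c.ψY (s.β ⬝ᵥ s.H i)) * ((s.β' - s.β) ⬝ᵥ s.H i)) +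
      avg fun i => s.r i * (s.δ c i - s.m2 c i * deriv c.ψD (s.α ⬝ᵥ s.G i) * s.dG i -
        s.m1 c i * deriv c.ψY (s.β ⬝ᵥ s.H i) * s.dH i) := by
    rw [← avg_add, ← avg_add]
    congr 1; ext i
    simp only [dG, dH]
    ring
  have h1 : _ ≤ c.K * s.l₁ * s.N₁ := abs_avg_mul_dotProduct_le hs.lin₁ (s.α' - s.α)
  have h2 : _ ≤ c.K * s.l₂ * s.N₂ := abs_avg_mul_dotProduct_le hs.lin₂ (s.β' - s.β)
  have h3 : |avg fun i => s.r i * (s.δ c i - s.m2 c i * deriv c.ψD (s.α ⬝ᵥ s.G i) * s.dG i -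
        s.m1 c i * deriv c.ψY (s.β ⬝ᵥ s.H i) * s.dH i)| ≤
      T * ((avg fun i => |s.r i| * s.dG i ^ 2) + avg fun i => |s.r i| * s.dH i ^ 2) := by
    refine (abs_avg_le _).trans ?_
    rw [← avg_add, ← avg_const_mul]
    refine avg_mono fun i => ?_
    rw [abs_mul]
    have := mul_le_mul_of_nonneg_left (hs.abs_δ_taylor_le hc hr.N₁ hr.N₂ i) (abs_nonneg (s.r i))
    linarith
  have h4 := mul_le_mul_of_nonneg_left
    (add_le_add (hs.avg_abs_r_dG_le hc hr) (hs.avg_abs_r_dH_le hc hr)) hT0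
  have h5 := mul_le_mul_of_nonneg_left hr.α hc.K
  have h6 := mul_le_mul_of_nonneg_left hr.β hc.K
  rw [e]
  refine (abs_add_le _ _).trans ?_
  refine (add_le_add_left (abs_add_le _ _) _).trans ?_
  linarith

lemma Good.dphi_sq_le (hs : s.Good c) (hc : c.Valid) (h₀ : s.N₀ ≤ 1) (i : Fin n) :
    s.dphi c i ^ 2 ≤ 3 * (Real.exp (-c.cF) * Real.exp c.CF ^ 2) *
        (s.q i * s.e c i ^ 2 * s.dF i ^ 2 + c.CF ^ 2 * (s.q i * s.δ c i ^ 2)) +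
      3 * (1 + Real.exp (-c.cF)) * (|s.r i| * s.δ c i ^ 2) := by
  have hZ := hs.Z_nonneg i
  have hw := w_pos (s := s) i
  have hwle : s.w i ≤ Real.exp (-c.cF) := Real.exp_le_exp.2 (neg_le_neg (hs.γ_ge i))
  have hdF := hs.abs_dF_le' hc h₀ i
  have hdF2 : s.dF i ^ 2 ≤ c.CF ^ 2 := by
    rw [← sq_abs]; exact pow_le_pow_left₀ (abs_nonneg _) hdF 2
  set x := s.Z i * (s.w' i - s.w i) with hx
  have hx2 : x ^ 2 ≤ Real.exp (-c.cF) * Real.exp c.CF ^ 2 * (s.q i * s.dF i ^ 2) := by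
    have h1 := pow_le_pow_left₀ (abs_nonneg _) (hs.abs_w'_sub_le hc h₀ i) 2
    rw [sq_abs] at h1
    have hZ2 : s.Z i ^ 2 = s.Z i := by rcases hs.Z01 i with h | h <;> simp [h]
    calc x ^ 2 = s.Z i * (s.w' i - s.w i) ^ 2 := by rw [hx, mul_pow, hZ2]
      _ ≤ s.Z i * (Real.exp c.CF * s.w i * |s.dF i|) ^ 2 := mul_le_mul_of_nonneg_left h1 hZ
      _ = s.w i * (Real.exp c.CF ^ 2 * (s.q i * s.dF i ^ 2)) := by
        rw [mul_pow, sq_abs, q]; ring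
      _ ≤ Real.exp (-c.cF) * (Real.exp c.CF ^ 2 * (s.q i * s.dF i ^ 2)) := by
        have := hs.q_nonneg i
        gcongr
      _ = _ := by ring
  have hr1 : |s.r i| ≤ 1 + Real.exp (-c.cF) := by
    have h1 : s.r i = 1 - s.Z i - s.Z i * s.w i := rfl
    rw [h1, abs_le]
    have := Real.exp_pos (-c.cF)
    rcases hs.Z01 i with h | h <;> rw [h] <;> constructor <;> linarith
  have hr2 : s.r i ^ 2 ≤ (1 + Real.exp (-c.cF)) * |s.r i| := by
    rw [← sq_abs, sq]; exact mul_le_mul_of_nonneg_right hr1 (abs_nonneg _)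
  have h3 : s.dphi c i ^ 2 ≤ 3 * (x ^ 2 * s.e c i ^ 2 + x ^ 2 * s.δ c i ^ 2 +
      s.r i ^ 2 * s.δ c i ^ 2) := by
    rw [dphi, ← hx]
    nlinarith [sq_nonneg (x * s.e c i + x * s.δ c i), sq_nonneg (x * s.e c i - s.r i * s.δ c i),
      sq_nonneg (x * s.δ c i + s.r i * s.δ c i)]
  have h4 := mul_le_mul_of_nonneg_right hx2 (sq_nonneg (s.e c i))
  have h5 : x ^ 2 * s.δ c i ^ 2 ≤
      Real.exp (-c.cF) * Real.exp c.CF ^ 2 * (s.q i * c.CF ^ 2) * s.δ c i ^ 2 := by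
    refine mul_le_mul_of_nonneg_right (hx2.trans ?_) (sq_nonneg _)
    have := hs.q_nonneg i
    gcongr
  have h6 := mul_le_mul_of_nonneg_right hr2 (sq_nonneg (s.δ c i))
  linarith

end

/-- On a good sample the error of the augmented inverse probability weighted estimator, and the mean
squared error of its summands, are of second order. -/
theorem aipw_bound {c : Constants} (hc : c.Valid) : ∃ M η : ℝ, 0 < M ∧ 0 < η ∧
    ∀ {n p q₁ q₂ : ℕ} (s : Sample n p q₁ q₂), s.Good c → s.Small η →
      |avg fun i => s.dphi c i| ≤ M * (sparsity s.γ * s.l₀ * s.l₂ + s.r₂) ∧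
      (avg fun i => s.dphi c i ^ 2) ≤ M * s.r₂ := by
  obtain ⟨M, η, hM, hη, H⟩ := exists_rates hc
  have hLm := c.Lm_nonneg
  have hLD := hc.LD_pos
  have hLY := hc.LY_pos
  have hC₂ := hc.C₂
  have hC₃ := hc.C₃
  have hK := hc.K
  have hB₂ := hc.B₂
  set U := c.Lm * c.LD + 2 * c.LY with hU
  set M₁ := 2 * Real.exp c.CF + 3 * Real.exp c.CF * U +
    (2 * c.K + 2 * (c.Lm * (c.LD * c.C₂) + c.LY * c.C₃ + c.LD * c.LY) * (c.K + 2)) with hM₁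
  set k₁ := 3 * (Real.exp (-c.cF) * Real.exp c.CF ^ 2) with hk₁
  set k₂ := 3 * (1 + Real.exp (-c.cF)) with hk₂
  set M₂ := k₁ * (1 + c.CF ^ 2 * (2 * U ^ 2 * 2)) + k₂ * (2 * U ^ 2 * (2 * (c.K + 2))) with hM₂
  have hM₁0 : 0 < M₁ := by positivity
  have hM₂0 : 0 < M₂ := by positivity
  refine ⟨(c.B₂ + M₁ + M₂) * M, η, by positivity, hη, fun {n p q₁ q₂} s hs hsm => ?_⟩
  have hr := H s hs hsm
  have hMr := hr.nonneg hs
  have hr₂ : 0 ≤ s.r₂ := nonneg_of_mul_nonneg_right hMr hM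
  constructor
  · have h1 := hs.abs_avg_weight_resid_le hc hr
    have h2 := hs.abs_avg_weight_δ_le hc hr
    have h3 := hs.abs_avg_balance_δ_le hc hr
    have hN : s.N₀ ≤ M * (sparsity s.γ * s.l₀) := by
      have : s.l₀ * s.N₀ ≤ s.l₀ * (M * (sparsity s.γ * s.l₀)) := by
        refine hr.γ.trans_eq ?_
        rw [r₀]; ring
      exact le_of_mul_le_mul_left this hs.l₀_pos
    have hN2 := mul_le_mul_of_nonneg_left hN (mul_nonneg hB₂ hs.l₂_pos.le)
    have e : (avg fun i => s.dphi c i) = (avg fun i => s.Z i * (s.w' i - s.w i) * s.e c i) -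
        (avg fun i => s.Z i * (s.w' i - s.w i) * s.δ c i) + avg fun i => s.r i * s.δ c i := by
      rw [← avg_sub, ← avg_add]; rfl
    have h4 : |avg fun i => s.dphi c i| ≤
        c.B₂ * s.l₂ * (M * (sparsity s.γ * s.l₀)) + M₁ * (M * s.r₂) := by
      rw [e]
      refine (abs_add_le _ _).trans ?_
      refine (add_le_add_left (abs_sub _ _) _).trans ?_
      rw [hM₁]
      linarith
    refine h4.trans ?_
    have hl := hs.l₂_pos
    have hl0 := hs.l₀_pos
    have hsp := one_le_sparsity s.γ
    have p1 : 0 ≤ (M₁ + M₂) * M * (sparsity s.γ * s.l₀ * s.l₂) := by positivity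
    have p2 : 0 ≤ (c.B₂ + M₂) * (M * s.r₂) := by positivity
    linarith
  · have h1 : (avg fun i => s.dphi c i ^ 2) ≤
        k₁ * (s.Qe c + c.CF ^ 2 * (2 * U ^ 2 * (s.Q₁ + s.Q₂))) +
        k₂ * (2 * U ^ 2 * ((avg fun i => |s.r i| * s.dG i ^ 2) +
          avg fun i => |s.r i| * s.dH i ^ 2)) := by
      rw [Q₁, Q₂, Qe, ← avg_add, ← avg_add, ← avg_const_mul, ← avg_const_mul, ← avg_const_mul,
        ← avg_const_mul, ← avg_add, ← avg_const_mul, ← avg_add]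
      refine avg_mono fun i => (hs.dphi_sq_le hc hr.N₀ i).trans ?_
      have h2 := hs.δ_sq_le hc hr.N₁ hr.N₂ i
      have h3 := mul_le_mul_of_nonneg_left h2 (hs.q_nonneg i)
      have h4 := mul_le_mul_of_nonneg_left h2 (abs_nonneg (s.r i))
      have hk₁0 : 0 ≤ k₁ * c.CF ^ 2 := by positivity
      have hk₂0 : 0 ≤ k₂ := by positivity
      have h5 := mul_le_mul_of_nonneg_left h3 hk₁0
      have h6 := mul_le_mul_of_nonneg_left h4 hk₂0
      linarith
    refine h1.trans ?_
    have h2 : k₁ * (s.Qe c + c.CF ^ 2 * (2 * U ^ 2 * (s.Q₁ + s.Q₂))) ≤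
        k₁ * (M * s.r₂ + c.CF ^ 2 * (2 * U ^ 2 * (M * s.r₂ + M * s.r₂))) := by
      have := hr.Qe
      have := hr.Q₁
      have := hr.Q₂
      gcongr
    have h3 : k₂ * (2 * U ^ 2 * ((avg fun i => |s.r i| * s.dG i ^ 2) +
          avg fun i => |s.r i| * s.dH i ^ 2)) ≤
        k₂ * (2 * U ^ 2 * ((c.K + 2) * (M * s.r₂) + (c.K + 2) * (M * s.r₂))) := by
      have := hs.avg_abs_r_dG_le hc hr
      have := hs.avg_abs_r_dH_le hc hr
      gcongr
    have p1 : 0 ≤ (c.B₂ + M₁) * (M * s.r₂) := by positivity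
    have e : (c.B₂ + M₁ + M₂) * M * s.r₂ = (c.B₂ + M₁) * (M * s.r₂) + M₂ * (M * s.r₂) := by ring
    rw [e, hM₂]
    linarith

end Sample

/-! ### Concentration of sample averages -/

lemma exp_le_one_add_add_sq_mul (y : ℝ) : Real.exp y ≤ 1 + y + y ^ 2 * Real.exp |y| := by
  have h1 : Real.exp y - 1 ≤ y * Real.exp y := by
    have h := Real.add_one_le_exp (-y)
    have h2 : Real.exp (-y) * Real.exp y = 1 := by rw [← Real.exp_add]; simp
    nlinarith [Real.exp_pos y]
  rcases le_total 0 y with hy | hy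
  · rw [abs_of_nonneg hy]
    nlinarith
  · have h2 := Real.add_one_le_exp y
    have h3 : (1 : ℝ) ≤ Real.exp |y| := Real.one_le_exp (abs_nonneg y)
    have h4 : Real.exp y - 1 - y ≤ y * (Real.exp y - 1) := by linarith
    have h5 : y * (Real.exp y - 1) ≤ y * y := by nlinarith
    nlinarith [mul_le_mul_of_nonneg_left h3 (sq_nonneg y)]

lemma exp_mul_le {s : ℝ} (hs : |s| ≤ 1 / 2) (x : ℝ) :
    Real.exp (s * x) ≤ 1 + s * x + 8 * s ^ 2 * Real.exp |x| := by
  refine (exp_le_one_add_add_sq_mul (s * x)).trans ?_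
  have h1 : |s * x| ≤ |x| / 2 := by
    rw [abs_mul]
    nlinarith [abs_nonneg x]
  have h2 : x ^ 2 ≤ 8 * Real.exp (|x| / 2) := by
    have := Real.quadratic_le_exp_of_nonneg (by positivity : 0 ≤ |x| / 2)
    have h3 := sq_abs x
    nlinarith [abs_nonneg x]
  have h3 : Real.exp |x| = Real.exp (|x| / 2) * Real.exp (|x| / 2) := by
    rw [← Real.exp_add]; congr 1; ring
  have h4 : (s * x) ^ 2 * Real.exp |s * x| ≤
      s ^ 2 * (8 * Real.exp (|x| / 2)) * Real.exp (|x| / 2) := by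
    rw [mul_pow]
    gcongr
  rw [h3]
  linarith

section concentration

variable {Ω E : Type*} [MeasurableSpace Ω] [MeasurableSpace E]

/-- Bernstein-type bound for the moment generating function of a centred variable with an
exponential moment. -/
lemma mgf_le_of_exp_abs {ρ : Measure E} [IsProbabilityMeasure ρ] {V : E → ℝ} {K s : ℝ}
    (hV : Integrable V ρ) (hexp : Integrable (fun o => Real.exp |V o|) ρ)
    (hK : ∫ o, Real.exp |V o| ∂ρ ≤ K) (h0 : ∫ o, V o ∂ρ = 0) (hs : |s| ≤ 1 / 2) :
    Integrable (fun o => Real.exp (s * V o)) ρ ∧ mgf V ρ s ≤ Real.exp (8 * K * s ^ 2) := by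
  have hlin : Integrable (fun o => 1 + s * V o) ρ := (integrable_const _).add (hV.const_mul _)
  have hint : Integrable (fun o => 1 + s * V o + 8 * s ^ 2 * Real.exp |V o|) ρ :=
    hlin.add (hexp.const_mul _)
  have hI : Integrable (fun o => Real.exp (s * V o)) ρ := by
    refine hint.mono' (Real.measurable_exp.comp_aemeasurable
      (hV.aemeasurable.const_mul s)).aestronglyMeasurable (ae_of_all _ fun o => ?_)
    rw [Real.norm_eq_abs, Real.abs_exp]
    exact exp_mul_le hs _
  refine ⟨hI, ?_⟩
  have h1 : mgf V ρ s ≤ ∫ o, (1 + s * V o + 8 * s ^ 2 * Real.exp |V o|) ∂ρ :=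
    integral_mono hI hint fun o => exp_mul_le hs _
  rw [integral_add hlin (hexp.const_mul _),
    integral_add (integrable_const _) (hV.const_mul _), integral_const_mul, integral_const_mul,
    h0] at h1
  simp only [integral_const, probReal_univ, smul_eq_mul, mul_one, mul_zero, add_zero] at h1
  have h2 := mul_le_mul_of_nonneg_left hK (by positivity : 0 ≤ 8 * s ^ 2)
  have h3 := Real.add_one_le_exp (8 * K * s ^ 2)
  linarith

/-- The constant in the concentration inequality for a variable `W` with
`E exp(|W| / σ) ≤ K`. -/
noncomputable def concConst (σ K : ℝ) : ℝ := σ * (8 * (Real.exp K * K) + 2)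

lemma concConst_pos {σ K : ℝ} (hσ : 0 < σ) (hK : 0 < K) : 0 < concConst σ K := by
  rw [concConst]; positivity

lemma integrable_of_exp_abs_div {ρ : Measure E} {W : E → ℝ} {σ : ℝ} (hσ : 0 < σ)
    (hW : AEStronglyMeasurable W ρ) (hexp : Integrable (fun o => Real.exp (|W o| / σ)) ρ) :
    Integrable W ρ := by
  refine (hexp.const_mul σ).mono' hW (ae_of_all _ fun o => ?_)
  have h1 := Real.add_one_le_exp (|W o| / σ)
  rw [Real.norm_eq_abs, ← div_le_iff₀' hσ]
  linarith

variable {ρ : Measure E} [IsProbabilityMeasure ρ] {P : Measure Ω} [IsProbabilityMeasure P]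
  {n : ℕ} {O : Fin n → Ω → E}

/-- Chernoff bound for `W / σ` at the exponent `lam ≤ 1 / 2`. -/
lemma measure_avg_ge_le (hn : 0 < n) (hO : ∀ i, Measurable (O i)) (hind : iIndepFun O P)
    (hlaw : ∀ i, P.map (O i) = ρ) {W : E → ℝ} (hW : Measurable W) {σ K lam : ℝ} (hσ : 0 < σ)
    (hexp : Integrable (fun o => Real.exp (|W o| / σ)) ρ)
    (hK : ∫ o, Real.exp (|W o| / σ) ∂ρ ≤ K) (hl0 : 0 ≤ lam) (hl : lam ≤ 1 / 2) :
    P {ω | concConst σ K * lam ≤ (avg fun i => W (O i ω)) - ∫ o, W o ∂ρ} ≤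
      ENNReal.ofReal (Real.exp (-2 * (n * lam ^ 2))) := by
  set m := ∫ o, W o ∂ρ with hm
  have hWi := integrable_of_exp_abs_div hσ hW.aestronglyMeasurable hexp
  have hmK : |m| / σ ≤ K := by
    have h1 : |m| ≤ ∫ o, |W o| ∂ρ := abs_integral_le_integral_abs
    have h2 : ∫ o, |W o| ∂ρ ≤ ∫ o, σ * Real.exp (|W o| / σ) ∂ρ := by
      refine integral_mono hWi.abs (hexp.const_mul σ) fun o => ?_
      have h1 := Real.add_one_le_exp (|W o| / σ)
      rw [← div_le_iff₀' hσ]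
      linarith
    rw [integral_const_mul] at h2
    rw [div_le_iff₀' hσ]
    exact h1.trans (h2.trans (mul_le_mul_of_nonneg_left hK hσ.le))
  set V : E → ℝ := fun o => (W o - m) / σ with hV
  have hVm : Measurable V := (hW.sub_const m).div_const σ
  have hVi : Integrable V ρ := (hWi.sub (integrable_const m)).div_const σ
  have hV0 : ∫ o, V o ∂ρ = 0 := by
    rw [hV, integral_div, integral_sub hWi (integrable_const m)]
    simp [hm]
  have hVle : ∀ o, Real.exp |V o| ≤ Real.exp K * Real.exp (|W o| / σ) := fun o => by
    rw [← Real.exp_add]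
    refine Real.exp_le_exp.2 ?_
    rw [hV]
    simp only
    rw [abs_div, abs_of_pos hσ]
    have : |W o - m| / σ ≤ (|W o| + |m|) / σ := by gcongr; exact abs_sub _ _
    rw [add_div] at this
    linarith
  have hVexp : Integrable (fun o => Real.exp |V o|) ρ := by
    refine (hexp.const_mul (Real.exp K)).mono'
      (Real.measurable_exp.comp (measurable_norm.comp hVm)).aestronglyMeasurable
      (ae_of_all _ fun o => ?_)
    rw [Real.norm_eq_abs, Real.abs_exp]
    exact hVle o
  have hVK : ∫ o, Real.exp |V o| ∂ρ ≤ Real.exp K * K := by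
    refine (integral_mono hVexp (hexp.const_mul _) hVle).trans ?_
    rw [integral_const_mul]
    exact mul_le_mul_of_nonneg_left hK (Real.exp_pos K).le
  obtain ⟨hint, hmgf⟩ := mgf_le_of_exp_abs (s := lam) hVi hVexp hVK hV0
    (by rwa [abs_of_nonneg hl0])
  have hindV : iIndepFun (fun i => V ∘ O i) P := hind.comp (fun _ => V) fun _ => hVm
  have hmV : ∀ i, Measurable (V ∘ O i) := fun i => hVm.comp (hO i)
  have hmgfi : ∀ i, mgf (V ∘ O i) P lam = mgf V ρ lam := fun i => by
    rw [mgf, mgf, ← hlaw i, integral_map (hO i).aemeasurable]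
    · rfl
    · exact (Real.measurable_exp.comp (hVm.const_mul lam)).aestronglyMeasurable
  have hinti : Integrable (fun ω => Real.exp (lam * (∑ i, V ∘ O i) ω)) P := by
    refine hindV.integrable_exp_mul_sum hmV fun i _ => ?_
    rw [← hlaw i] at hint
    exact hint.comp_measurable (hO i)
  have hn' : (0 : ℝ) < n := Nat.cast_pos.2 hn
  set t := (8 * (Real.exp K * K) + 2) * lam with ht
  have hch := measure_ge_le_exp_mul_mgf (X := ∑ i, V ∘ O i) (μ := P) (n * t) hl0 hinti
  rw [hindV.mgf_sum hmV Finset.univ] at hch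
  simp only [hmgfi, Finset.prod_const, Finset.card_univ, Fintype.card_fin] at hch
  have hle : Real.exp (-lam * (n * t)) * mgf V ρ lam ^ n ≤ Real.exp (-2 * (n * lam ^ 2)) := by
    refine (mul_le_mul_of_nonneg_left (pow_le_pow_left₀ mgf_nonneg hmgf n)
      (Real.exp_pos _).le).trans_eq ?_
    rw [← Real.exp_nat_mul, ← Real.exp_add, ht]
    congr 1; ring
  have hset : {ω | concConst σ K * lam ≤ (avg fun i => W (O i ω)) - m} ⊆
      {ω | n * t ≤ (∑ i, V ∘ O i) ω} := fun ω hω => by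
    simp only [Set.mem_ofPred_eq, Finset.sum_apply, Function.comp_apply] at hω ⊢
    have e : ∑ i, V (O i ω) = n * (((avg fun i => W (O i ω)) - m) / σ) := by
      rw [hV]
      simp only [avg]
      rw [← Finset.sum_div, Finset.sum_sub_distrib]
      simp only [Finset.sum_const, Finset.card_univ, Fintype.card_fin, nsmul_eq_mul]
      field_simp
    rw [e]
    refine mul_le_mul_of_nonneg_left ?_ hn'.le
    rw [le_div_iff₀ hσ, ht]
    rw [concConst] at hω
    linarith
  refine (measure_mono hset).trans ?_
  rw [← ofReal_measureReal]
  exact ENNReal.ofReal_le_ofReal (hch.trans hle)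

lemma measure_abs_avg_sub_gt_le (hn : 0 < n) (hO : ∀ i, Measurable (O i)) (hind : iIndepFun O P)
    (hlaw : ∀ i, P.map (O i) = ρ) {W : E → ℝ} (hW : Measurable W) {σ K lam : ℝ} (hσ : 0 < σ)
    (hexp : Integrable (fun o => Real.exp (|W o| / σ)) ρ)
    (hK : ∫ o, Real.exp (|W o| / σ) ∂ρ ≤ K) (hl0 : 0 ≤ lam) (hl : lam ≤ 1 / 2) :
    P {ω | concConst σ K * lam < |(avg fun i => W (O i ω)) - ∫ o, W o ∂ρ|} ≤
      ENNReal.ofReal (2 * Real.exp (-2 * (n * lam ^ 2))) := by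
  have h1 := measure_avg_ge_le hn hO hind hlaw hW hσ hexp hK hl0 hl
  have h2 := measure_avg_ge_le (W := fun o => -W o) hn hO hind hlaw hW.neg hσ
    (by simpa only [abs_neg] using hexp) (by simpa only [abs_neg] using hK) hl0 hl
  rw [two_mul, ENNReal.ofReal_add (Real.exp_pos _).le (Real.exp_pos _).le]
  refine (measure_mono fun ω hω => ?_).trans ((measure_union_le _ _).trans (add_le_add h1 h2))
  rw [Set.mem_ofPred_eq] at hω
  rcases lt_abs.1 hω with h | h
  · exact Or.inl h.le
  · right
    have e : (avg fun i => -W (O i ω)) = -avg fun i => W (O i ω) := by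
      simp only [avg, Finset.sum_neg_distrib, neg_div]
    simp only [Set.mem_ofPred_eq, integral_neg, e]
    linarith

lemma rate_sq {n k : ℕ} {ε : ℝ} (hε : 0 < ε) (hε1 : ε < 1) :
    rate n k ε ^ 2 = Real.log ((1 + k) / ε) / n := by
  rw [rate, Real.sq_sqrt]
  refine div_nonneg (Real.log_nonneg ?_) (Nat.cast_nonneg n)
  rw [le_div_iff₀ hε]
  have : (0 : ℝ) ≤ k := Nat.cast_nonneg k
  linarith

lemma rate_pos {n k : ℕ} {ε : ℝ} (hn : 0 < n) (hε : 0 < ε) (hε1 : ε < 1) : 0 < rate n k ε := by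
  refine Real.sqrt_pos.2 (div_pos (Real.log_pos ?_) (Nat.cast_pos.2 hn))
  rw [lt_div_iff₀ hε]
  have : (0 : ℝ) ≤ k := Nat.cast_nonneg k
  linarith

lemma rate_mono {n k l : ℕ} {ε : ℝ} (hε : 0 < ε) (hkl : k ≤ l) : rate n k ε ≤ rate n l ε := by
  have : (k : ℝ) ≤ l := Nat.cast_le.2 hkl
  unfold rate
  gcongr

/-- Uniform concentration at the rate `{log((1 + k)/ε)/n}^{1/2}` of at most `(1 + k)²` sample
averages. -/
theorem measure_exists_abs_avg_sub_gt_le (hn : 0 < n) (hO : ∀ i, Measurable (O i))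
    (hind : iIndepFun O P) (hlaw : ∀ i, P.map (O i) = ρ) {ι : Type*} [Fintype ι] {k : ℕ}
    (hι : Fintype.card ι ≤ (k + 1) ^ 2) {W : ι → E → ℝ} (hW : ∀ j, Measurable (W j))
    {σ K ε : ℝ} (hσ : 0 < σ) (hε : 0 < ε) (hε1 : ε < 1)
    (hexp : ∀ j, Integrable (fun o => Real.exp (|W j o| / σ)) ρ)
    (hK : ∀ j, ∫ o, Real.exp (|W j o| / σ) ∂ρ ≤ K) (hl : rate n k ε ≤ 1 / 2) :
    P {ω | ∃ j, concConst σ K * rate n k ε < |(avg fun i => W j (O i ω)) - ∫ o, W j o ∂ρ|} ≤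
      ENNReal.ofReal (2 * ε) := by
  have hn' : (0 : ℝ) < n := Nat.cast_pos.2 hn
  have hk : (0 : ℝ) < 1 + k := by positivity
  have e1 : Real.exp (-2 * (n * rate n k ε ^ 2)) = (ε / (1 + k)) ^ 2 := by
    rw [rate_sq hε hε1, mul_div_cancel₀ _ hn'.ne',
      show -2 * Real.log ((1 + k) / ε) = (2 : ℕ) * Real.log (ε / (1 + k)) by
        rw [← inv_div, Real.log_inv]; push_cast; ring,
      Real.exp_nat_mul, Real.exp_log (by positivity)]
  rw [Set.ofPred_exists]
  refine (measure_iUnion_fintype_le _ _).trans ?_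
  refine (Finset.sum_le_sum fun j _ => measure_abs_avg_sub_gt_le hn hO hind hlaw (hW j) hσ
    (hexp j) (hK j) (rate_pos hn hε hε1).le hl).trans ?_
  rw [Finset.sum_const, nsmul_eq_mul, ← ENNReal.ofReal_natCast, e1,
    ← ENNReal.ofReal_mul (Nat.cast_nonneg _)]
  refine ENNReal.ofReal_le_ofReal ?_
  have h1 : ((Finset.univ : Finset ι).card : ℝ) ≤ (1 + k) ^ 2 := by
    rw [Finset.card_univ]
    calc (Fintype.card ι : ℝ) ≤ (((k + 1) ^ 2 : ℕ) : ℝ) := Nat.cast_le.2 hι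
      _ = _ := by push_cast; ring
  calc _ ≤ (1 + (k : ℝ)) ^ 2 * (2 * (ε / (1 + k)) ^ 2) :=
        mul_le_mul_of_nonneg_right h1 (by positivity)
    _ = 2 * (ε * ε) := by field_simp
    _ ≤ 2 * ε := by nlinarith

end concentration

/-! ### Population moments -/

lemma obsZ_eq {𝒳 : Type*} (o : Obs 𝒳) : o.Z = 0 ∨ o.Z = 1 := by
  unfold Obs.Z; split_ifs <;> simp

lemma obsD_eq {𝒳 : Type*} (o : Obs 𝒳) : o.D = 0 ∨ o.D = 1 := by
  unfold Obs.D; split_ifs <;> simp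

lemma obsZ_nonneg {𝒳 : Type*} (o : Obs 𝒳) : 0 ≤ o.Z := by rcases obsZ_eq o with h | h <;> simp [h]

lemma obsZ_le_one {𝒳 : Type*} (o : Obs 𝒳) : o.Z ≤ 1 := by rcases obsZ_eq o with h | h <;> simp [h]

lemma abs_obsZ_le_one {𝒳 : Type*} (o : Obs 𝒳) : |o.Z| ≤ 1 := by rcases obsZ_eq o with h | h <;> simp [h]

section population

variable {𝒳 : Type*} [MeasurableSpace 𝒳]

@[fun_prop]
lemma measurable_obsX : Measurable (Obs.X : Obs 𝒳 → 𝒳) :=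
  measurable_snd.comp (measurable_snd.comp measurable_snd)

@[fun_prop]
lemma measurable_obsY : Measurable (Obs.Y : Obs 𝒳 → ℝ) := measurable_fst

@[fun_prop]
lemma measurable_obsD : Measurable (Obs.D : Obs 𝒳 → ℝ) :=
  (measurable_from_top (f := fun b : Bool => if b then (1 : ℝ) else 0)).comp
    (measurable_fst.comp measurable_snd)

@[fun_prop]
lemma measurable_obsZ : Measurable (Obs.Z : Obs 𝒳 → ℝ) :=
  (measurable_from_top (f := fun b : Bool => if b then (1 : ℝ) else 0)).comp
    (measurable_fst.comp (measurable_snd.comp measurable_snd))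

lemma IsRegressor.measurable_apply {k : ℕ} {g : 𝒳 → Fin (k + 1) → ℝ} (hg : IsRegressor g)
    (j : Fin (k + 1)) : Measurable fun x => g x j := (measurable_pi_apply j).comp hg.measurable

lemma IsRegressor.measurable_dot {k : ℕ} {g : 𝒳 → Fin (k + 1) → ℝ} (hg : IsRegressor g)
    (b : Fin (k + 1) → ℝ) : Measurable fun x => b ⬝ᵥ g x := by
  simp only [dotProduct]
  exact Finset.measurable_sum _ fun j _ => (hg.measurable_apply j).const_mul _

/-- The quadratic form of a matrix of second moments. -/
lemma integral_quad {k : ℕ} {ρ : Measure (Obs 𝒳)} {x : Obs 𝒳 → Fin k → ℝ} {a : Obs 𝒳 → ℝ}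
    (hi : ∀ j l, Integrable (fun o => a o * (x o j * x o l)) ρ) (b : Fin k → ℝ) :
    b ⬝ᵥ (Matrix.of fun j l => ∫ o, a o * (x o j * x o l) ∂ρ).mulVec b =
      ∫ o, a o * (b ⬝ᵥ x o) ^ 2 ∂ρ := by
  have e : ∀ o, a o * (b ⬝ᵥ x o) ^ 2 =
      ∑ j, ∑ l, b j * b l * (a o * (x o j * x o l)) := fun o => by
    simp only [dotProduct, sq, Finset.sum_mul_sum]
    simp only [Finset.mul_sum]
    exact Finset.sum_congr rfl fun j _ => Finset.sum_congr rfl fun l _ => by ring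
  simp only [e]
  rw [integral_finsetSum _ fun j _ => integrable_finsetSum _ fun l _ => (hi j l).const_mul _]
  simp only [dotProduct, Matrix.mulVec, Finset.mul_sum, Matrix.of_apply]
  refine Finset.sum_congr rfl fun j _ => ?_
  rw [integral_finsetSum _ fun l _ => (hi j l).const_mul _]
  refine Finset.sum_congr rfl fun l _ => ?_
  rw [integral_const_mul]
  ring

variable {ρ : Measure (Obs 𝒳)} [IsProbabilityMeasure ρ]

lemma exp_moment_of_bounded {W : Obs 𝒳 → ℝ} {C : ℝ} (hC : 0 < C) (hW : Measurable W)
    (hb : ∀ᵐ o ∂ρ, |W o| ≤ C) :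
    Integrable (fun o => Real.exp (|W o| / C)) ρ ∧
      ∫ o, Real.exp (|W o| / C) ∂ρ ≤ Real.exp 1 := by
  have hle : ∀ᵐ o ∂ρ, Real.exp (|W o| / C) ≤ Real.exp 1 := hb.mono fun o ho =>
    Real.exp_le_exp.2 ((div_le_one hC).2 ho)
  have hm : Measurable fun o => Real.exp (|W o| / C) :=
    Real.measurable_exp.comp ((measurable_norm.comp hW).div_const C)
  have hi : Integrable (fun o => Real.exp (|W o| / C)) ρ := by
    refine Integrable.of_bound hm.aestronglyMeasurable (Real.exp 1) (hle.mono fun o ho => ?_)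
    rwa [Real.norm_eq_abs, Real.abs_exp]
  refine ⟨hi, ?_⟩
  have := integral_mono_ae hi (integrable_const (Real.exp 1)) hle
  simpa using this

lemma integrable_of_abs_le {W : Obs 𝒳 → ℝ} {C : ℝ} (hW : Measurable W)
    (hb : ∀ᵐ o ∂ρ, |W o| ≤ C) : Integrable W ρ :=
  Integrable.of_bound hW.aestronglyMeasurable C hb

/-! ### Estimating equations of the target values -/

/-- The gradient of an expected loss `E[wt {-y u + a Ψ(u)}]`, `u = bᵀx`, vanishes at a minimizer.
Convexity of `Ψ` bounds the increments of the loss, so no differentiation under the integral sign is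
needed. -/
lemma target_gradient {k : ℕ} {wt y a : Obs 𝒳 → ℝ} {x : Obs 𝒳 → Fin k → ℝ} {ψ : ℝ → ℝ}
    {C Cw Ca Cx R : ℝ} {b : Fin k → ℝ} (hC : 0 ≤ C) (hψm : Monotone ψ)
    (hψ : Differentiable ℝ ψ) (hr : DerivRatioBound ψ C)
    (hmin : ∀ c, ∫ o, wt o * (-(y o * (b ⬝ᵥ x o)) + a o * antideriv ψ (b ⬝ᵥ x o)) ∂ρ ≤
      ∫ o, wt o * (-(y o * (c ⬝ᵥ x o)) + a o * antideriv ψ (c ⬝ᵥ x o)) ∂ρ)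
    (hwt : Measurable wt) (hwt0 : ∀ o, 0 ≤ wt o) (hwtC : ∀ᵐ o ∂ρ, wt o ≤ Cw)
    (ha : Measurable a) (ha0 : ∀ o, 0 ≤ a o) (haC : ∀ᵐ o ∂ρ, a o ≤ Ca)
    (hy : Integrable y ρ) (hx : Measurable x) (hxC : ∀ᵐ o ∂ρ, ∀ j, |x o j| ≤ Cx)
    (hb : ∀ᵐ o ∂ρ, |b ⬝ᵥ x o| ≤ R) (j : Fin k) :
    ∫ o, wt o * (y o - a o * ψ (b ⬝ᵥ x o)) * x o j ∂ρ = 0 := by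
  have hxm : ∀ c : Fin k → ℝ, Measurable fun o => c ⬝ᵥ x o := fun c => by
    simp only [dotProduct]
    exact Finset.measurable_sum _ fun j _ => ((measurable_pi_apply j).comp hx).const_mul _
  have hψc := hψ.continuous
  have hd0 : 0 ≤ deriv ψ 0 := hψm.deriv_nonneg
  -- linear predictors are bounded, hence so are continuous functions of them
  have hxb : ∀ c : Fin k → ℝ, ∀ᵐ o ∂ρ, |c ⬝ᵥ x o| ≤ Cx * l1norm c := fun c =>
    hxC.mono fun o ho => abs_dotProduct_le ho c
  have hcomp : ∀ (F : ℝ → ℝ), Continuous F → ∀ c : Fin k → ℝ, ∃ B, ∀ᵐ o ∂ρ,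
      |F (c ⬝ᵥ x o)| ≤ B := fun F hF c => by
    obtain ⟨B, hB⟩ := (isCompact_Icc (a := -(Cx * l1norm c)) (b := Cx * l1norm c)
      ).exists_bound_of_continuousOn hF.continuousOn
    exact ⟨B, (hxb c).mono fun o ho => hB _ (abs_le.1 ho)⟩
  have hwtC' : ∀ᵐ o ∂ρ, ‖wt o‖ ≤ Cw := hwtC.mono fun o ho => by
    rwa [Real.norm_eq_abs, abs_of_nonneg (hwt0 o)]
  have haC' : ∀ᵐ o ∂ρ, ‖a o‖ ≤ Ca := haC.mono fun o ho => by
    rwa [Real.norm_eq_abs, abs_of_nonneg (ha0 o)]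
  -- integrability of `wt * y * u` and `wt * a * F u` for linear predictors `u`
  have hI1 : ∀ c : Fin k → ℝ, Integrable (fun o => wt o * (y o * (c ⬝ᵥ x o))) ρ := fun c => by
    refine Integrable.bdd_mul ?_ hwt.aestronglyMeasurable hwtC'
    exact hy.mul_bdd (hxm c).aestronglyMeasurable (hxb c)
  have hI2 : ∀ (F : ℝ → ℝ), Continuous F → ∀ c : Fin k → ℝ,
      Integrable (fun o => wt o * (a o * F (c ⬝ᵥ x o))) ρ := fun F hF c => by
    obtain ⟨B, hB⟩ := hcomp F hF c
    refine Integrable.bdd_mul ?_ hwt.aestronglyMeasurable hwtC'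
    refine Integrable.bdd_mul ?_ ha.aestronglyMeasurable haC'
    exact Integrable.of_bound (hF.measurable.comp (hxm c)).aestronglyMeasurable B hB
  have hI3 : ∀ c d : Fin k → ℝ,
      Integrable (fun o => wt o * (a o * ψ (c ⬝ᵥ x o)) * (d ⬝ᵥ x o)) ρ := fun c d =>
    (hI2 ψ hψc c).mul_bdd (hxm d).aestronglyMeasurable (hxb d)
  have hIL : ∀ c : Fin k → ℝ, Integrable
      (fun o => wt o * (-(y o * (c ⬝ᵥ x o)) + a o * antideriv ψ (c ⬝ᵥ x o))) ρ := fun c => by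
    refine ((hI1 c).neg.add (hI2 _ (continuous_antideriv hψm) c)).congr (ae_of_all _ fun o => ?_)
    simp only [Pi.add_apply, Pi.neg_apply]
    ring
  have hIG : ∀ d : Fin k → ℝ, Integrable
      (fun o => wt o * (y o - a o * ψ (b ⬝ᵥ x o)) * (d ⬝ᵥ x o)) ρ := fun d => by
    refine ((hI1 d).sub (hI3 b d)).congr (ae_of_all _ fun o => ?_)
    simp only [Pi.sub_apply]
    ring
  have key : ∀ d : Fin k → ℝ, ∫ o, wt o * (y o - a o * ψ (b ⬝ᵥ x o)) * (d ⬝ᵥ x o) ∂ρ ≤ 0 := by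
    intro d
    set X := Cx * l1norm d with hX
    set L := Cw * (Ca * (deriv ψ 0 * Real.exp (C * R) * Real.exp (C * X) * X)) * X with hL
    have step : ∀ t : ℝ, 0 < t → t ≤ 1 →
        ∫ o, wt o * (y o - a o * ψ (b ⬝ᵥ x o)) * (d ⬝ᵥ x o) ∂ρ ≤ L * t := by
      intro t ht ht1
      have h1 := hmin (b + t • d)
      have h2 : ∫ o, wt o * (-(y o * ((b + t • d) ⬝ᵥ x o)) +
          a o * antideriv ψ ((b + t • d) ⬝ᵥ x o)) ∂ρ -
          ∫ o, wt o * (-(y o * (b ⬝ᵥ x o)) + a o * antideriv ψ (b ⬝ᵥ x o)) ∂ρ ≤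
          ∫ o, (t * (L * t) - t * (wt o * (y o - a o * ψ (b ⬝ᵥ x o)) * (d ⬝ᵥ x o))) ∂ρ := by
        rw [← integral_sub (hIL _) (hIL _)]
        refine integral_mono_ae ((hIL _).sub (hIL _))
          ((integrable_const _).sub ((hIG d).const_mul t)) ?_
        filter_upwards [hwtC, haC, hb, hxb d] with o h3 h4 h5 h6
        simp only [add_dotProduct, smul_dotProduct, smul_eq_mul]
        set δ := d ⬝ᵥ x o
        set u := b ⬝ᵥ x o
        have h7 := antideriv_sub_le hψm u (u + t * δ)
        have h8 := abs_sub_le_deriv hC hr hψm hψ (u + t * δ) u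
        rw [add_sub_cancel_left, abs_mul, abs_of_pos ht] at h8
        have hX0 : 0 ≤ X := (abs_nonneg δ).trans h6
        have htX : t * |δ| ≤ X := (mul_le_of_le_one_left (abs_nonneg _) ht1).trans h6
        have h9 : |ψ (u + t * δ) - ψ u| ≤
            deriv ψ 0 * Real.exp (C * R) * Real.exp (C * X) * (t * X) := by
          refine h8.trans (mul_le_mul (mul_le_mul (deriv_le_of_abs_le hC hr hd0 h5)
            (Real.exp_le_exp.2 (mul_le_mul_of_nonneg_left htX hC)) (Real.exp_pos _).le
            (by positivity)) (mul_le_mul_of_nonneg_left h6 ht.le) (by positivity)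
            (by positivity))
        have h10 : (ψ (u + t * δ) - ψ u) * δ ≤
            deriv ψ 0 * Real.exp (C * R) * Real.exp (C * X) * (t * X) * X := by
          refine (le_abs_self _).trans ?_
          rw [abs_mul]
          exact mul_le_mul h9 h6 (abs_nonneg _) (by positivity)
        have hCw : 0 ≤ Cw := (hwt0 o).trans h3
        have hCa : 0 ≤ Ca := (ha0 o).trans h4
        have h11 : wt o * (a o * ((ψ (u + t * δ) - ψ u) * δ)) ≤ L * t := by
          calc wt o * (a o * ((ψ (u + t * δ) - ψ u) * δ))
              ≤ wt o * (a o * (deriv ψ 0 * Real.exp (C * R) * Real.exp (C * X) * (t * X) * X)) :=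
                mul_le_mul_of_nonneg_left (mul_le_mul_of_nonneg_left h10 (ha0 o)) (hwt0 o)
            _ ≤ Cw * (Ca * (deriv ψ 0 * Real.exp (C * R) * Real.exp (C * X) * (t * X) * X)) := by
                have : 0 ≤ deriv ψ 0 * Real.exp (C * R) * Real.exp (C * X) * (t * X) * X := by
                  positivity
                have := ha0 o
                have := hwt0 o
                gcongr
            _ = L * t := by rw [hL]; ring
        have h12 := mul_le_mul_of_nonneg_left h7 (mul_nonneg (hwt0 o) (ha0 o))
        have h13 := mul_le_mul_of_nonneg_left h11 ht.le
        rw [add_sub_cancel_left] at h12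
        linarith
      rw [integral_sub (integrable_const _) ((hIG d).const_mul t)] at h2
      simp only [integral_const, probReal_univ, smul_eq_mul, one_mul] at h2
      rw [integral_const_mul] at h2
      have h3 : t * ∫ o, wt o * (y o - a o * ψ (b ⬝ᵥ x o)) * (d ⬝ᵥ x o) ∂ρ ≤ t * (L * t) := by
        linarith
      exact le_of_mul_le_mul_left h3 ht
    have hlim : Filter.Tendsto (fun t : ℝ => L * t) (nhdsWithin 0 (Set.Ioi 0))
        (nhds (L * 0)) :=
      tendsto_nhdsWithin_of_tendsto_nhds (Continuous.tendsto (by fun_prop) 0)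
    rw [mul_zero] at hlim
    refine ge_of_tendsto hlim ?_
    filter_upwards [Ioc_mem_nhdsGT (zero_lt_one (α := ℝ))] with t ht
    exact step t ht.1 ht.2
  have k1 := key (Pi.single j 1)
  have k2 := key (-Pi.single j 1)
  simp only [neg_dotProduct, mul_neg, integral_neg, single_dotProduct, one_mul] at k1 k2
  linarith

/-! ### Consequences of a correct propensity score model -/

lemma covariateAlgebra_le : covariateAlgebra 𝒳 ≤ (inferInstance : MeasurableSpace (Obs 𝒳)) :=
  measurable_obsX.comap_le

/-- Tower property with a bounded function of the covariates. -/
lemma integral_mul_condExp {k : 𝒳 → ℝ} (hk : Measurable k) {C : ℝ}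
    (hkC : ∀ᵐ o ∂ρ, |k o.X| ≤ C) {U : Obs 𝒳 → ℝ} (hU : Integrable U ρ) :
    ∫ o, k o.X * U o ∂ρ = ∫ o, k o.X * (ρ[U | covariateAlgebra 𝒳]) o ∂ρ := by
  have hsm : StronglyMeasurable[covariateAlgebra 𝒳] (fun o : Obs 𝒳 => k o.X) :=
    (hk.comp (comap_measurable _)).stronglyMeasurable
  have hint : Integrable ((fun o : Obs 𝒳 => k o.X) * U) ρ :=
    hU.bdd_mul (hk.comp measurable_obsX).aestronglyMeasurable hkC
  have h := condExp_mul_of_stronglyMeasurable_left hsm hint hU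
  have h2 := integral_condExp (μ := ρ) (f := (fun o : Obs 𝒳 => k o.X) * U)
    (covariateAlgebra_le (𝒳 := 𝒳))
  rw [integral_congr_ae h] at h2
  exact h2.symm

/-- A correctly specified propensity score is consistent: the target linear predictor agrees almost
surely with the true one. The excess calibration loss of `γ` over the truth `γ*` has conditional mean
`(1 - π) (e^{-d} - 1 + d)`, where `d` is the difference of the linear predictors. -/
lemma propensity_target_eq {p : ℕ} {f : 𝒳 → Fin (p + 1) → ℝ} {γ γs : Fin (p + 1) → ℝ} {Cf : ℝ}
    (hf : IsRegressor f) (hfC : ∀ᵐ o ∂ρ, ∀ j, |f o.X j| ≤ Cf)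
    (hγs : ρ[fun o => o.Z | covariateAlgebra 𝒳] =ᵐ[ρ] fun o => propensity f γs o.X)
    (hγ : IsTarget ρ (lossCAL f) γ) : ∀ᵐ o ∂ρ, γ ⬝ᵥ f o.X = γs ⬝ᵥ f o.X := by
  have hZ : Integrable (fun o : Obs 𝒳 => o.Z) ρ :=
    integrable_of_abs_le measurable_obsZ (ae_of_all _ abs_obsZ_le_one)
  have hb : ∀ b : Fin (p + 1) → ℝ, ∀ᵐ o ∂ρ, |b ⬝ᵥ f o.X| ≤ Cf * l1norm b := fun b =>
    hfC.mono fun o ho => abs_dotProduct_le ho b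
  -- the part of the loss that multiplies `Z`
  set k : (Fin (p + 1) → ℝ) → 𝒳 → ℝ := fun b x => Real.exp (-(b ⬝ᵥ f x)) - b ⬝ᵥ f x with hk
  have hkm : ∀ b, Measurable (k b) := fun b => by
    have := hf.measurable_dot b
    simp only [hk]; fun_prop
  have hkb : ∀ b, ∀ᵐ o ∂ρ, |k b o.X| ≤ Real.exp (Cf * l1norm b) + Cf * l1norm b := fun b =>
    (hb b).mono fun o ho => by
      refine (abs_sub _ _).trans (add_le_add ?_ ho)
      rw [Real.abs_exp]
      exact Real.exp_le_exp.2 (by linarith [(abs_le.1 ho).1])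
  have hdm : ∀ b : Fin (p + 1) → ℝ, Integrable (fun o : Obs 𝒳 => b ⬝ᵥ f o.X) ρ := fun b =>
    integrable_of_abs_le ((hf.measurable_dot b).comp measurable_obsX) (hb b)
  have hπm : Measurable fun o : Obs 𝒳 => propensity f γs o.X := by
    unfold propensity
    exact Real.sigmoid_monotone.measurable.comp
      ((hf.measurable_dot γs).comp measurable_obsX)
  have hπ01 : ∀ o : Obs 𝒳, |propensity f γs o.X| ≤ 1 := fun o => by
    rw [propensity, abs_of_pos (Real.sigmoid_pos _)]; exact Real.sigmoid_le_one _
  have hπi : Integrable (fun o : Obs 𝒳 => propensity f γs o.X) ρ :=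
    integrable_of_abs_le hπm (ae_of_all _ hπ01)
  have hkZ : ∀ b, Integrable (fun o : Obs 𝒳 => k b o.X * o.Z) ρ := fun b =>
    hZ.bdd_mul ((hkm b).comp measurable_obsX).aestronglyMeasurable (hkb b)
  have hkπ : ∀ b, Integrable (fun o : Obs 𝒳 => k b o.X * propensity f γs o.X) ρ := fun b =>
    hπi.bdd_mul ((hkm b).comp measurable_obsX).aestronglyMeasurable (hkb b)
  have hloss : ∀ b, ∫ o, lossCAL f b o ∂ρ =
      ∫ o, (k b o.X * propensity f γs o.X + b ⬝ᵥ f o.X) ∂ρ := fun b => by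
    have e : ∀ o, lossCAL f b o = k b o.X * o.Z + b ⬝ᵥ f o.X := fun o => by
      simp only [lossCAL, hk]; ring
    simp only [e]
    rw [integral_add (hkZ b) (hdm b), integral_add (hkπ b) (hdm b),
      integral_mul_condExp (hkm b) (hkb b) hZ]
    congr 1
    refine integral_congr_ae (hγs.mono fun o ho => ?_)
    simp only [ho]
  have hmin : ∫ o, lossCAL f γ o ∂ρ ≤ ∫ o, lossCAL f γs o ∂ρ := hγ (Set.mem_univ γs)
  rw [hloss, hloss] at hmin
  set gap : Obs 𝒳 → ℝ := fun o => (k γ o.X * propensity f γs o.X + γ ⬝ᵥ f o.X) -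
    (k γs o.X * propensity f γs o.X + γs ⬝ᵥ f o.X) with hgap
  have hli : ∀ b, Integrable (fun o => k b o.X * propensity f γs o.X + b ⬝ᵥ f o.X) ρ := fun b =>
    (hkπ b).add (hdm b)
  have hgi : Integrable gap ρ := (hli γ).sub (hli γs)
  have hgeq : ∀ o, gap o = (1 - propensity f γs o.X) *
      (Real.exp (-(γ ⬝ᵥ f o.X - γs ⬝ᵥ f o.X)) - 1 + (γ ⬝ᵥ f o.X - γs ⬝ᵥ f o.X)) := fun o => by
    have h1 : propensity f γs o.X * Real.exp (-(γs ⬝ᵥ f o.X)) = 1 - propensity f γs o.X := by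
      rw [propensity, Real.sigmoid_mul_rexp_neg, Real.sigmoid_neg]
    have h2 : Real.exp (-(γ ⬝ᵥ f o.X)) =
        Real.exp (-(γs ⬝ᵥ f o.X)) * Real.exp (-(γ ⬝ᵥ f o.X - γs ⬝ᵥ f o.X)) := by
      rw [← Real.exp_add]; congr 1; ring
    simp only [hgap, hk]
    rw [h2]
    linear_combination (Real.exp (-(γ ⬝ᵥ f o.X - γs ⬝ᵥ f o.X)) - 1) * h1
  have hg0 : ∀ o, 0 ≤ gap o := fun o => by
    rw [hgeq]
    refine mul_nonneg (sub_nonneg.2 (Real.sigmoid_le_one _)) ?_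
    have := Real.add_one_le_exp (-(γ ⬝ᵥ f o.X - γs ⬝ᵥ f o.X))
    linarith
  have hzero : ∫ o, gap o ∂ρ = 0 := by
    refine le_antisymm ?_ (integral_nonneg hg0)
    rw [hgap, integral_sub (hli γ) (hli γs)]
    linarith
  filter_upwards [(integral_eq_zero_iff_of_nonneg hg0 hgi).1 hzero] with o ho
  simp only [hgeq, Pi.zero_apply, mul_eq_zero] at ho
  rcases ho with h | h
  · exact absurd h (sub_pos.2 (Real.sigmoid_lt_one _)).ne'
  · by_contra hne
    have := Real.add_one_lt_exp (x := -(γ ⬝ᵥ f o.X - γs ⬝ᵥ f o.X))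
      (by rw [ne_eq, neg_eq_zero, sub_eq_zero]; exact hne)
    linarith

end population

/-! ### The moments that enter the error analysis -/

section moments

variable {𝒳 : Type*}

/-- `Z w₁` at the parameter `γ`. -/
noncomputable def obsQ {p : ℕ} (f : 𝒳 → Fin (p + 1) → ℝ) (γ : Fin (p + 1) → ℝ) (o : Obs 𝒳) : ℝ :=
  o.Z * Real.exp (-(γ ⬝ᵥ f o.X))

/-- The balancing variable `1 - Z / π` at the parameter `γ`. -/
noncomputable def obsR {p : ℕ} (f : 𝒳 → Fin (p + 1) → ℝ) (γ : Fin (p + 1) → ℝ) (o : Obs 𝒳) : ℝ :=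
  1 - o.Z - o.Z * Real.exp (-(γ ⬝ᵥ f o.X))

/-- The residual `DY - m₁ m₁₁`. -/
noncomputable def obsE {q₁ q₂ : ℕ} (c : Constants) (g : 𝒳 → Fin (q₁ + 1) → ℝ)
    (h : 𝒳 → Fin (q₂ + 1) → ℝ) (α : Fin (q₁ + 1) → ℝ) (β : Fin (q₂ + 1) → ℝ) (o : Obs 𝒳) : ℝ :=
  o.D * o.Y - c.ψD (α ⬝ᵥ g o.X) * c.ψY (β ⬝ᵥ h o.X)

variable [MeasurableSpace 𝒳]

/-- A population that satisfies the assumptions of the theorem, with target values `γ, α, β`. -/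
structure Population {p q₁ q₂ : ℕ} (c : Constants) (σ₀ σ₁ : ℝ) (ρ : Measure (Obs 𝒳))
    (f : 𝒳 → Fin (p + 1) → ℝ) (g : 𝒳 → Fin (q₁ + 1) → ℝ) (h : 𝒳 → Fin (q₂ + 1) → ℝ)
    (γ : Fin (p + 1) → ℝ) (α : Fin (q₁ + 1) → ℝ) (β : Fin (q₂ + 1) → ℝ) : Prop where
  reg_f : IsRegressor f
  reg_g : IsRegressor g
  reg_h : IsRegressor h
  target_γ : IsTarget ρ (lossCAL f) γ
  target_α : IsTarget ρ (lossD c.ψD f g γ) α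
  target_β : IsTarget ρ (lossDY c.ψD c.ψY f g h γ α) β
  asm_γ : PropensityAssumption ρ f γ c.CF c.cF c.ν₀ c.μ₀
  asm_α : TreatmentAssumption ρ f g γ α c.CG c.Ca c.ν₁ c.μ₁
  asm_β : OutcomeAssumption ρ c.ψD c.ψY f g h γ α β c.CH c.Cb σ₀ σ₁ c.ν₂ c.μ₂
  correct : PropensityCorrect ρ f

namespace Population

variable {p q₁ q₂ : ℕ} {c : Constants} {σ₀ σ₁ : ℝ} {ρ : Measure (Obs 𝒳)}
  {f : 𝒳 → Fin (p + 1) → ℝ} {g : 𝒳 → Fin (q₁ + 1) → ℝ} {h : 𝒳 → Fin (q₂ + 1) → ℝ}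
  {γ : Fin (p + 1) → ℝ} {α : Fin (q₁ + 1) → ℝ} {β : Fin (q₂ + 1) → ℝ}

lemma gram_eq {k : ℕ} (x : 𝒳 → Fin (k + 1) → ℝ) : gram ρ f γ x =
    Matrix.of fun i j => ∫ o, obsQ f γ o * (x o.X i * x o.X j) ∂ρ := by
  unfold gram obsQ
  simp only [weight_eq_exp]

variable (pop : Population c σ₀ σ₁ ρ f g h γ α β)
include pop

lemma measurable_q : Measurable (obsQ f γ) := by
  have := (pop.reg_f.measurable_dot γ).comp measurable_obsX
  unfold obsQ
  exact measurable_obsZ.mul this.neg.exp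

lemma measurable_r : Measurable (obsR f γ) := by
  have := pop.measurable_q
  unfold obsR
  exact (measurable_obsZ.const_sub 1).sub this

lemma measurable_m1 (hc : c.Valid) : Measurable fun x => c.ψD (α ⬝ᵥ g x) :=
  hc.linkD.differentiable.continuous.measurable.comp (pop.reg_g.measurable_dot α)

lemma measurable_m2 (hc : c.Valid) : Measurable fun x => c.ψY (β ⬝ᵥ h x) :=
  hc.linkY.differentiable.continuous.measurable.comp (pop.reg_h.measurable_dot β)

lemma measurable_e (hc : c.Valid) : Measurable (obsE c g h α β) := by
  unfold obsE
  exact (measurable_obsD.mul measurable_obsY).sub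
    (((pop.measurable_m1 hc).mul (pop.measurable_m2 hc)).comp measurable_obsX)

lemma measurable_f (j : Fin (p + 1)) : Measurable fun o : Obs 𝒳 => f o.X j :=
  (pop.reg_f.measurable_apply j).comp measurable_obsX

lemma measurable_g (j : Fin (q₁ + 1)) : Measurable fun o : Obs 𝒳 => g o.X j :=
  (pop.reg_g.measurable_apply j).comp measurable_obsX

lemma measurable_h (j : Fin (q₂ + 1)) : Measurable fun o : Obs 𝒳 => h o.X j :=
  (pop.reg_h.measurable_apply j).comp measurable_obsX

lemma abs_q_le : ∀ᵐ o ∂ρ, |obsQ f γ o| ≤ Real.exp (-c.cF) := by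
  filter_upwards [pop.asm_γ.lower] with o ho
  rw [obsQ, abs_mul, Real.abs_exp]
  exact (mul_le_of_le_one_left (Real.exp_pos _).le (abs_obsZ_le_one o)).trans
    (Real.exp_le_exp.2 (neg_le_neg ho))

lemma abs_r_le : ∀ᵐ o ∂ρ, |obsR f γ o| ≤ 1 + Real.exp (-c.cF) := by
  filter_upwards [pop.abs_q_le] with o ho
  have e : obsR f γ o = 1 - o.Z - obsQ f γ o := rfl
  rw [e]
  refine (abs_sub _ _).trans (add_le_add ?_ ho)
  rcases obsZ_eq o with h | h <;> simp [h]

lemma abs_m2_le (hc : c.Valid) : ∀ᵐ o ∂ρ, |c.ψY (β ⬝ᵥ h o.X)| ≤ c.Lm := by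
  filter_upwards [pop.asm_β.predictor] with o ho
  have h := abs_le.1 ho
  exact abs_le_max_abs_abs (hc.linkY.strictMono.monotone h.1) (hc.linkY.strictMono.monotone h.2)

variable [IsProbabilityMeasure ρ]

lemma integral_mul_Z {k : 𝒳 → ℝ} (hk : Measurable k) {C : ℝ} (hkC : ∀ᵐ o ∂ρ, |k o.X| ≤ C) :
    ∫ o, k o.X * o.Z ∂ρ = ∫ o, k o.X * Real.sigmoid (γ ⬝ᵥ f o.X) ∂ρ := by
  obtain ⟨γs, hγs⟩ := pop.correct
  rw [integral_mul_condExp hk hkC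
    (integrable_of_abs_le measurable_obsZ (ae_of_all _ abs_obsZ_le_one))]
  refine integral_congr_ae ?_
  filter_upwards [hγs, propensity_target_eq pop.reg_f pop.asm_γ.bounded hγs pop.target_γ]
    with o h1 h2
  rw [h1, h2, propensity]

/-- With a correctly specified propensity score every function of the covariates is balanced. -/
lemma integral_r_mul {k : 𝒳 → ℝ} (hk : Measurable k) {C : ℝ} (hkC : ∀ᵐ o ∂ρ, |k o.X| ≤ C) :
    ∫ o, obsR f γ o * k o.X ∂ρ = 0 := by
  set k' : 𝒳 → ℝ := fun x => k x * (1 + Real.exp (-(γ ⬝ᵥ f x))) with hk'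
  have hk'm : Measurable k' := by
    have := pop.reg_f.measurable_dot γ
    exact hk.mul (this.neg.exp.const_add 1)
  have hk'C : ∀ᵐ o ∂ρ, |k' o.X| ≤ C * (1 + Real.exp (-c.cF)) := by
    filter_upwards [hkC, pop.asm_γ.lower] with o h1 h2
    have h3 : Real.exp (-(γ ⬝ᵥ f o.X)) ≤ Real.exp (-c.cF) := Real.exp_le_exp.2 (neg_le_neg h2)
    rw [hk', abs_mul, abs_of_pos (by positivity : 0 < 1 + Real.exp (-(γ ⬝ᵥ f o.X)))]
    exact mul_le_mul h1 (by linarith) (by positivity) ((abs_nonneg _).trans h1)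
  have hZ : Integrable (fun o : Obs 𝒳 => o.Z) ρ :=
    integrable_of_abs_le measurable_obsZ (ae_of_all _ abs_obsZ_le_one)
  have h1 : Integrable (fun o : Obs 𝒳 => k o.X) ρ :=
    integrable_of_abs_le (hk.comp measurable_obsX) hkC
  have h2 : Integrable (fun o : Obs 𝒳 => k' o.X * o.Z) ρ :=
    hZ.bdd_mul (hk'm.comp measurable_obsX).aestronglyMeasurable hk'C
  have e : ∀ o, obsR f γ o * k o.X = k o.X - k' o.X * o.Z := fun o => by
    simp only [obsR, hk']; ring
  simp only [e]
  rw [integral_sub h1 h2, pop.integral_mul_Z hk'm hk'C, sub_eq_zero]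
  refine integral_congr_ae (ae_of_all _ fun o => ?_)
  simp only [hk']
  rw [← one_div_sigmoid, mul_assoc, one_div_mul_cancel (Real.sigmoid_pos _).ne', mul_one]

lemma exp_sq_moment (hσ₀ : 0 < σ₀) :
    Integrable (fun o => Real.exp (obsE c g h α β o ^ 2 / σ₀ ^ 2)) ρ ∧
      ∫ o, Real.exp (obsE c g h α β o ^ 2 / σ₀ ^ 2) ∂ρ ≤ 1 + σ₁ ^ 2 / σ₀ ^ 2 := by
  obtain ⟨h1, h2⟩ := pop.asm_β.subGaussian
  change Integrable (fun o => Real.exp (obsE c g h α β o ^ 2 / σ₀ ^ 2)) ρ at h1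
  refine ⟨h1, ?_⟩
  have h3 := integral_condExp (μ := ρ) (f := fun o => Real.exp (obsE c g h α β o ^ 2 / σ₀ ^ 2) - 1)
    (covariateAlgebra_le (𝒳 := 𝒳))
  have h4 : ∫ o, (ρ[fun o => Real.exp (obsE c g h α β o ^ 2 / σ₀ ^ 2) - 1 |
      covariateAlgebra 𝒳]) o ∂ρ ≤ ∫ _, σ₁ ^ 2 / σ₀ ^ 2 ∂ρ := by
    refine integral_mono_ae integrable_condExp (integrable_const _) (h2.mono fun o ho => ?_)
    rw [le_div_iff₀' (by positivity)]
    exact ho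
  rw [h3, integral_sub h1 (integrable_const 1)] at h4
  simp only [integral_const, probReal_univ, smul_eq_mul, one_mul] at h4
  linarith

lemma integrable_e_sq (hc : c.Valid) (hσ₀ : 0 < σ₀) :
    Integrable (fun o => obsE c g h α β o ^ 2) ρ := by
  refine ((pop.exp_sq_moment hσ₀).1.const_mul (σ₀ ^ 2)).mono'
    ((pop.measurable_e hc).pow_const 2).aestronglyMeasurable (ae_of_all _ fun o => ?_)
  rw [Real.norm_eq_abs, abs_of_nonneg (sq_nonneg _), ← div_le_iff₀' (by positivity)]
  linarith [Real.add_one_le_exp (obsE c g h α β o ^ 2 / σ₀ ^ 2)]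

/-- `E(e² | X) ≤ σ₁²`, integrated against a nonnegative function of the covariates. -/
lemma integral_mul_e_sq_le (hc : c.Valid) (hσ₀ : 0 < σ₀) {k : 𝒳 → ℝ} (hk : Measurable k)
    (hk0 : ∀ x, 0 ≤ k x) {C : ℝ} (hkC : ∀ᵐ o ∂ρ, |k o.X| ≤ C) :
    ∫ o, k o.X * obsE c g h α β o ^ 2 ∂ρ ≤ σ₁ ^ 2 * ∫ o, k o.X ∂ρ := by
  obtain ⟨h1, h2⟩ := pop.asm_β.subGaussian
  set U : Obs 𝒳 → ℝ := fun o => Real.exp (obsE c g h α β o ^ 2 / σ₀ ^ 2) - 1 with hU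
  have hUi : Integrable U ρ := h1.sub (integrable_const 1)
  have hkm := (hk.comp (measurable_obsX (𝒳 := 𝒳))).aestronglyMeasurable (μ := ρ)
  have h3 : ∫ o, k o.X * obsE c g h α β o ^ 2 ∂ρ ≤ ∫ o, σ₀ ^ 2 * (k o.X * U o) ∂ρ := by
    refine integral_mono ((pop.integrable_e_sq hc hσ₀).bdd_mul hkm hkC)
      ((hUi.bdd_mul hkm hkC).const_mul _) fun o => ?_
    have h4 := Real.add_one_le_exp (obsE c g h α β o ^ 2 / σ₀ ^ 2)
    have h5 : obsE c g h α β o ^ 2 ≤ σ₀ ^ 2 * U o := by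
      rw [← div_le_iff₀' (by positivity), hU]; linarith
    have h6 := mul_le_mul_of_nonneg_left h5 (hk0 o.X)
    simp only
    linarith
  refine h3.trans ?_
  rw [integral_const_mul, integral_mul_condExp hk hkC hUi, ← integral_const_mul,
    ← integral_const_mul]
  refine integral_mono_ae ((integrable_condExp.bdd_mul hkm hkC).const_mul _)
    ((integrable_of_abs_le (hk.comp measurable_obsX) hkC).const_mul _) (h2.mono fun o ho => ?_)
  have h6 := mul_le_mul_of_nonneg_right (show σ₀ ^ 2 * (ρ[U | covariateAlgebra 𝒳]) o ≤ σ₁ ^ 2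
    from ho) (hk0 o.X)
  simp only
  linarith

lemma integrable_q_mul_f (i j : Fin (p + 1)) :
    Integrable (fun o => obsQ f γ o * (f o.X i * f o.X j)) ρ := by
  refine integrable_of_abs_le (pop.measurable_q.mul ((pop.measurable_f i).mul (pop.measurable_f j)))
    (C := Real.exp (-c.cF) * (c.CF * c.CF)) ?_
  filter_upwards [pop.abs_q_le, pop.asm_γ.bounded] with o h1 h2
  rw [abs_mul, abs_mul]
  exact mul_le_mul h1 (mul_le_mul (h2 i) (h2 j) (abs_nonneg _) ((abs_nonneg _).trans (h2 i)))
    (by positivity) (Real.exp_pos _).le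

lemma integrable_noise (hc : c.Valid) (hσ₀ : 0 < σ₀) (i j : Fin (p + 1)) :
    Integrable (fun o => obsQ f γ o * obsE c g h α β o ^ 2 * (f o.X i * f o.X j)) ρ := by
  refine Integrable.mul_bdd (c := c.CF * c.CF) ?_
    ((pop.measurable_f i).mul (pop.measurable_f j)).aestronglyMeasurable ?_
  · exact (pop.integrable_e_sq hc hσ₀).bdd_mul pop.measurable_q.aestronglyMeasurable pop.abs_q_le
  · filter_upwards [pop.asm_γ.bounded] with o h2
    rw [Real.norm_eq_abs, abs_mul]
    exact mul_le_mul (h2 i) (h2 j) (abs_nonneg _) ((abs_nonneg _).trans (h2 i))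

/-- The sub-Gaussian condition is given `X` only, not `(X, Z)`. The factor `Z` is traded for the
propensity score, which is bounded from below. -/
lemma noise_quad_le (hc : c.Valid) (hσ₀ : 0 < σ₀) (b : Fin (p + 1) → ℝ) :
    b ⬝ᵥ (Matrix.of fun i j => ∫ o, obsQ f γ o * obsE c g h α β o ^ 2 *
      (f o.X i * f o.X j) ∂ρ).mulVec b ≤
      σ₁ ^ 2 / Real.sigmoid c.cF * (b ⬝ᵥ (gram ρ f γ f).mulVec b) := by
  rw [integral_quad (x := fun o => f o.X) (pop.integrable_noise hc hσ₀), gram_eq,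
    integral_quad (x := fun o => f o.X) pop.integrable_q_mul_f]
  set k : 𝒳 → ℝ := fun x => Real.exp (-(γ ⬝ᵥ f x)) * (b ⬝ᵥ f x) ^ 2 with hk
  have hkm : Measurable k :=
    (pop.reg_f.measurable_dot γ).neg.exp.mul ((pop.reg_f.measurable_dot b).pow_const 2)
  have hk0 : ∀ x, 0 ≤ k x := fun x => mul_nonneg (Real.exp_pos _).le (sq_nonneg _)
  have hkC : ∀ᵐ o ∂ρ, |k o.X| ≤ Real.exp (-c.cF) * (c.CF * l1norm b) ^ 2 := by
    filter_upwards [pop.asm_γ.lower, pop.asm_γ.bounded] with o h1 h2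
    rw [abs_of_nonneg (hk0 _)]
    refine mul_le_mul (Real.exp_le_exp.2 (neg_le_neg h1)) ?_ (sq_nonneg _) (Real.exp_pos _).le
    rw [← sq_abs]
    exact pow_le_pow_left₀ (abs_nonneg _) (abs_dotProduct_le h2 b) 2
  have hkmo := (hkm.comp (measurable_obsX (𝒳 := 𝒳)))
  have hki := integrable_of_abs_le hkmo hkC
  have h1 : ∫ o, obsQ f γ o * obsE c g h α β o ^ 2 * (b ⬝ᵥ f o.X) ^ 2 ∂ρ ≤
      ∫ o, k o.X * obsE c g h α β o ^ 2 ∂ρ := by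
    have hint := (pop.integrable_e_sq hc hσ₀).bdd_mul hkmo.aestronglyMeasurable hkC
    have e : ∀ o, obsQ f γ o * obsE c g h α β o ^ 2 * (b ⬝ᵥ f o.X) ^ 2 =
        o.Z * (k o.X * obsE c g h α β o ^ 2) := fun o => by
      simp only [obsQ, hk]; ring
    simp only [e]
    refine integral_mono (hint.bdd_mul measurable_obsZ.aestronglyMeasurable
      (ae_of_all _ abs_obsZ_le_one)) hint fun o => ?_
    exact mul_le_of_le_one_left (mul_nonneg (hk0 _) (sq_nonneg _)) (obsZ_le_one o)
  have hs := Real.sigmoid_pos c.cF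
  have h2 : Real.sigmoid c.cF * ∫ o, k o.X ∂ρ ≤ ∫ o, obsQ f γ o * (b ⬝ᵥ f o.X) ^ 2 ∂ρ := by
    have e : ∀ o, obsQ f γ o * (b ⬝ᵥ f o.X) ^ 2 = k o.X * o.Z := fun o => by
      simp only [obsQ, hk]; ring
    simp only [e]
    rw [pop.integral_mul_Z hkm hkC, ← integral_const_mul]
    refine integral_mono_ae (hki.const_mul _) (hki.mul_bdd (c := 1)
      (Real.sigmoid_monotone.measurable.comp
        ((pop.reg_f.measurable_dot γ).comp measurable_obsX)).aestronglyMeasurable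
      (ae_of_all _ fun o => ?_)) ?_
    · rw [Real.norm_eq_abs, abs_of_pos (Real.sigmoid_pos _)]; exact Real.sigmoid_le_one _
    · filter_upwards [pop.asm_γ.lower] with o ho
      rw [mul_comm]
      exact mul_le_mul_of_nonneg_left (Real.sigmoid_le ho) (hk0 _)
  calc _ ≤ _ := h1
    _ ≤ σ₁ ^ 2 * ∫ o, k o.X ∂ρ := pop.integral_mul_e_sq_le hc hσ₀ hkm hk0 hkC
    _ ≤ σ₁ ^ 2 / Real.sigmoid c.cF * ∫ o, obsQ f γ o * (b ⬝ᵥ f o.X) ^ 2 ∂ρ := by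
      rw [div_mul_eq_mul_div, le_div_iff₀ hs, mul_assoc]
      refine mul_le_mul_of_nonneg_left ?_ (sq_nonneg _)
      linarith

/-- Estimating equation of `α₁`. -/
lemma integral_grad_α (hc : c.Valid) (j : Fin (q₁ + 1)) :
    ∫ o, obsQ f γ o * (o.D - c.ψD (α ⬝ᵥ g o.X)) * g o.X j ∂ρ = 0 := by
  have key := target_gradient (ρ := ρ) (wt := obsQ f γ) (y := Obs.D) (a := fun _ => 1)
    (x := fun o => g o.X) (ψ := c.ψD) (C := c.C₂) (Cw := Real.exp (-c.cF)) (Ca := 1) (Cx := c.CG)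
    (R := c.Ca) (b := α) hc.C₂ hc.linkD.strictMono.monotone hc.linkD.differentiable hc.ratioD
    (fun b => by
      have := pop.target_α (Set.mem_univ b)
      simpa only [Set.mem_ofPred_eq, lossD, weight_eq_exp, obsQ, one_mul] using this)
    pop.measurable_q (fun o => mul_nonneg (obsZ_nonneg o) (Real.exp_pos _).le)
    (pop.abs_q_le.mono fun o ho => (le_abs_self _).trans ho) measurable_const
    (fun _ => zero_le_one) (ae_of_all _ fun _ => le_rfl)
    (integrable_of_abs_le measurable_obsD (C := 1) (ae_of_all _ fun o => by
      rcases obsD_eq o with h | h <;> simp [h]))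
    (pop.reg_g.measurable.comp measurable_obsX) pop.asm_α.bounded pop.asm_α.predictor j
  simpa only [one_mul] using key

lemma integrable_DY (hc : c.Valid) (hσ₀ : 0 < σ₀) :
    Integrable (fun o : Obs 𝒳 => o.D * o.Y) ρ := by
  have h1 : Integrable (obsE c g h α β) ρ := by
    refine ((integrable_const (1 : ℝ)).add (pop.integrable_e_sq hc hσ₀)).mono'
      (pop.measurable_e hc).aestronglyMeasurable (ae_of_all _ fun o => ?_)
    rw [Real.norm_eq_abs]
    have := two_mul_le_add_sq 1 |obsE c g h α β o|
    rw [sq_abs] at this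
    have := abs_nonneg (obsE c g h α β o)
    simp only [Pi.add_apply]
    linarith
  have h2 : Integrable (fun o : Obs 𝒳 => c.ψD (α ⬝ᵥ g o.X) * c.ψY (β ⬝ᵥ h o.X)) ρ := by
    refine integrable_of_abs_le (((pop.measurable_m1 hc).mul (pop.measurable_m2 hc)).comp
      measurable_obsX) (C := 1 * c.Lm) ?_
    filter_upwards [pop.abs_m2_le hc] with o ho
    rw [abs_mul]
    refine mul_le_mul ?_ ho (abs_nonneg _) zero_le_one
    rw [abs_of_pos (hc.linkD.pos _)]
    exact hc.linkD.le_one _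
  refine (h1.add h2).congr (ae_of_all _ fun o => ?_)
  simp only [Pi.add_apply, obsE]
  ring

/-- Estimating equation of `α₁₁`. -/
lemma integral_grad_β (hc : c.Valid) (hσ₀ : 0 < σ₀) (j : Fin (q₂ + 1)) :
    ∫ o, obsQ f γ o * obsE c g h α β o * h o.X j ∂ρ = 0 :=
  target_gradient (ρ := ρ) (wt := obsQ f γ) (y := fun o => o.D * o.Y)
    (a := fun o => c.ψD (α ⬝ᵥ g o.X))
    (x := fun o => h o.X) (ψ := c.ψY) (C := c.C₃) (Cw := Real.exp (-c.cF)) (Ca := 1) (Cx := c.CH)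
    (R := c.Cb) (b := β) hc.C₃ hc.linkY.strictMono.monotone hc.linkY.differentiable hc.ratioY
    (fun b => by
      have := pop.target_β (Set.mem_univ b)
      simpa only [Set.mem_ofPred_eq, lossDY, weight_eq_exp, obsQ, regression] using this)
    pop.measurable_q (fun o => mul_nonneg (obsZ_nonneg o) (Real.exp_pos _).le)
    (pop.abs_q_le.mono fun o ho => (le_abs_self _).trans ho)
    ((pop.measurable_m1 hc).comp measurable_obsX)
    (fun _ => (hc.linkD.pos _).le) (ae_of_all _ fun _ => hc.linkD.le_one _)
    (pop.integrable_DY hc hσ₀)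
    (pop.reg_h.measurable.comp measurable_obsX) pop.asm_β.bounded pop.asm_β.predictor j

end Population

end moments

/-! ### Probability of close moments -/

/-- The constants `B₀, B₁, B₂, K` dominate the constants of the concentration inequalities for the
moments that enter the error analysis. -/
structure Constants.Dominates (c : Constants) (σ₀ σ₁ : ℝ) : Prop where
  CF : 0 < c.CF
  CG : 0 < c.CG
  CH : 0 < c.CH
  grad₀ : concConst ((1 + Real.exp (-c.cF)) * c.CF) (Real.exp 1) ≤ c.B₀
  grad₁ : concConst (Real.exp (-c.cF) * c.CG) (Real.exp 1) ≤ c.B₁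
  grad₂ : concConst 1 (Real.exp ((Real.exp (-c.cF) * c.CH) ^ 2 * σ₀ ^ 2 / 4) *
    (1 + σ₁ ^ 2 / σ₀ ^ 2)) ≤ c.B₂
  gram₀ : concConst (Real.exp (-c.cF) * (c.CF * c.CF)) (Real.exp 1) ≤ c.K
  gram₁ : concConst (Real.exp (-c.cF) * (c.CG * c.CG)) (Real.exp 1) ≤ c.K
  gram₂ : concConst (Real.exp (-c.cF) * (c.CH * c.CH)) (Real.exp 1) ≤ c.K
  noise : concConst (Real.exp (-c.cF) * (c.CF * c.CF) * σ₀ ^ 2) (1 + σ₁ ^ 2 / σ₀ ^ 2) ≤ c.K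
  noise' : σ₁ ^ 2 / Real.sigmoid c.cF ≤ c.K
  bal₁ : concConst ((1 + Real.exp (-c.cF)) * (c.CG * c.CG)) (Real.exp 1) ≤ c.K
  bal₂ : concConst ((1 + Real.exp (-c.cF)) * (c.CH * c.CH)) (Real.exp 1) ≤ c.K
  lin₁ : concConst ((1 + Real.exp (-c.cF)) * ((c.Lm + 1) * (deriv c.ψD 0 *
    Real.exp (c.C₂ * c.Ca)) * c.CG)) (Real.exp 1) ≤ c.K
  lin₂ : concConst ((1 + Real.exp (-c.cF)) * (1 * (deriv c.ψY 0 *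
    Real.exp (c.C₃ * c.Cb)) * c.CH)) (Real.exp 1) ≤ c.K

lemma abs_mul_mul_le {a x y A X Y : ℝ} (ha : |a| ≤ A) (hx : |x| ≤ X) (hy : |y| ≤ Y) :
    |a * (x * y)| ≤ A * (X * Y) := by
  rw [abs_mul, abs_mul]
  exact mul_le_mul ha (mul_le_mul hx hy (abs_nonneg _) ((abs_nonneg _).trans hx)) (by positivity)
    ((abs_nonneg _).trans ha)

section event

variable {Ω : Type*} [MeasurableSpace Ω] {P : Measure Ω}

lemma measure_not_and_le {A B : Ω → Prop} {a b : ℝ} (ha : 0 ≤ a) (hb : 0 ≤ b)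
    (hA : P {ω | ¬ A ω} ≤ ENNReal.ofReal a) (hB : P {ω | ¬ B ω} ≤ ENNReal.ofReal b) :
    P {ω | ¬ (A ω ∧ B ω)} ≤ ENNReal.ofReal (a + b) := by
  rw [ENNReal.ofReal_add ha hb]
  refine (measure_mono fun ω hω => ?_).trans ((measure_union_le _ _).trans (add_le_add hA hB))
  exact not_and_or.1 hω

variable {𝒳 : Type*} [MeasurableSpace 𝒳] {ρ : Measure (Obs 𝒳)} [IsProbabilityMeasure ρ]
  [IsProbabilityMeasure P] {n : ℕ} {O : Fin n → Ω → Obs 𝒳}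

/-- The observations are independent with common law `ρ`. -/
structure IsIIDSample (ρ : Measure (Obs 𝒳)) (P : Measure Ω) (O : Fin n → Ω → Obs 𝒳) : Prop where
  pos : 0 < n
  measurable : ∀ i, Measurable (O i)
  indep : iIndepFun O P
  law : ∀ i, P.map (O i) = ρ

/-- Concentration of a family of at most `(k + 1)²` sample moments. -/
lemma measure_not_forall_abs_avg_sub_le (hO : IsIIDSample ρ P O) {ι : Type*} [Fintype ι] {k : ℕ}
    (hι : Fintype.card ι ≤ (k + 1) ^ 2) {W : ι → Obs 𝒳 → ℝ} (hW : ∀ j, Measurable (W j))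
    {σ K ε C : ℝ} (hσ : 0 < σ) (hε : 0 < ε) (hε1 : ε < 1)
    (hexp : ∀ j, Integrable (fun o => Real.exp (|W j o| / σ)) ρ ∧
      ∫ o, Real.exp (|W j o| / σ) ∂ρ ≤ K) (hl : rate n k ε ≤ 1 / 2) {m : ι → ℝ}
    (hm : ∀ j, ∫ o, W j o ∂ρ = m j) (hC : concConst σ K ≤ C) :
    P {ω | ¬ ∀ j, |(avg fun i => W j (O i ω)) - m j| ≤ C * rate n k ε} ≤
      ENNReal.ofReal (2 * ε) := by
  refine (measure_mono fun ω hω => ?_).trans (measure_exists_abs_avg_sub_gt_le hO.pos hO.measurable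
    hO.indep hO.law hι hW hσ hε hε1 (fun j => (hexp j).1) (fun j => (hexp j).2) hl)
  simp only [Set.mem_ofPred_eq, not_forall, not_le] at hω ⊢
  obtain ⟨j, hj⟩ := hω
  refine ⟨j, lt_of_le_of_lt ?_ (by rwa [hm j])⟩
  exact mul_le_mul_of_nonneg_right hC (rate_pos hO.pos hε hε1).le

/-- Concentration of `k + 1` bounded centred sample moments. -/
lemma measure_not_forall_abs_avg_le (hO : IsIIDSample ρ P O) {k : ℕ}
    {W : Fin (k + 1) → Obs 𝒳 → ℝ} (hW : ∀ j, Measurable (W j))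
    {σ ε C : ℝ} (hσ : 0 < σ) (hε : 0 < ε) (hε1 : ε < 1) (hb : ∀ j, ∀ᵐ o ∂ρ, |W j o| ≤ σ)
    (hl : rate n k ε ≤ 1 / 2) (hm : ∀ j, ∫ o, W j o ∂ρ = 0) (hC : concConst σ (Real.exp 1) ≤ C) :
    P {ω | ¬ ∀ j, |avg fun i => W j (O i ω)| ≤ C * rate n k ε} ≤ ENNReal.ofReal (2 * ε) := by
  simpa only [sub_zero] using measure_not_forall_abs_avg_sub_le hO (m := fun _ => 0)
    (by rw [Fintype.card_fin]; exact Nat.le_self_pow two_ne_zero _) hW hσ hε hε1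
    (fun j => exp_moment_of_bounded hσ (hW j) (hb j)) hl hm hC

/-- Concentration of a `(k + 1) × (k + 1)` matrix of sample moments. -/
lemma measure_not_forall₂_abs_avg_sub_le (hO : IsIIDSample ρ P O) {k : ℕ}
    {W : Fin (k + 1) → Fin (k + 1) → Obs 𝒳 → ℝ} (hW : ∀ j l, Measurable (W j l))
    {σ K ε C : ℝ} (hσ : 0 < σ) (hε : 0 < ε) (hε1 : ε < 1)
    (hexp : ∀ j l, Integrable (fun o => Real.exp (|W j l o| / σ)) ρ ∧
      ∫ o, Real.exp (|W j l o| / σ) ∂ρ ≤ K) (hl : rate n k ε ≤ 1 / 2)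
    {m : Fin (k + 1) → Fin (k + 1) → ℝ}
    (hm : ∀ j l, ∫ o, W j l o ∂ρ = m j l) (hC : concConst σ K ≤ C) :
    P {ω | ¬ ∀ j l, |(avg fun i => W j l (O i ω)) - m j l| ≤ C * rate n k ε} ≤
      ENNReal.ofReal (2 * ε) := by
  have := measure_not_forall_abs_avg_sub_le hO (ι := Fin (k + 1) × Fin (k + 1)) (k := k)
    (m := fun x => m x.1 x.2) (W := fun x => W x.1 x.2)
    (by rw [Fintype.card_prod, Fintype.card_fin, sq]) (fun x => hW x.1 x.2) hσ hε hε1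
    (fun x => hexp x.1 x.2) hl (fun x => hm x.1 x.2) hC
  simpa only [Prod.forall] using this

namespace Population

variable {p q₁ q₂ : ℕ} {c : Constants} {σ₀ σ₁ ε : ℝ}
  {f : 𝒳 → Fin (p + 1) → ℝ} {g : 𝒳 → Fin (q₁ + 1) → ℝ} {h : 𝒳 → Fin (q₂ + 1) → ℝ}
  {γ : Fin (p + 1) → ℝ} {α : Fin (q₁ + 1) → ℝ} {β : Fin (q₂ + 1) → ℝ}
  (pop : Population c σ₀ σ₁ ρ f g h γ α β)

include pop

lemma measure_grad₀ (hd : c.Dominates σ₀ σ₁) (hO : IsIIDSample ρ P O) (hε : 0 < ε) (hε1 : ε < 1)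
    (hl : rate n p ε ≤ 1 / 2) :
    P {ω | ¬ ∀ j, |avg fun i => obsR f γ (O i ω) * f (O i ω).X j| ≤ c.B₀ * rate n p ε} ≤
      ENNReal.ofReal (2 * ε) := by
  have hCF := hd.CF
  have hb : ∀ j, ∀ᵐ o ∂ρ, |f o.X j| ≤ c.CF := fun j => pop.asm_γ.bounded.mono fun o ho => ho j
  refine measure_not_forall_abs_avg_le (W := fun j o => obsR f γ o * f o.X j) hO
    (fun j => pop.measurable_r.mul (pop.measurable_f j)) (by positivity) hε hε1 (fun j => ?_) hl
    (fun j => pop.integral_r_mul (pop.reg_f.measurable_apply j) (hb j)) hd.grad₀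
  filter_upwards [pop.abs_r_le, hb j] with o h1 h2
  rw [abs_mul]
  exact mul_le_mul h1 h2 (abs_nonneg _) (by positivity)

lemma measure_grad₁ (hc : c.Valid) (hd : c.Dominates σ₀ σ₁) (hO : IsIIDSample ρ P O) (hε : 0 < ε)
    (hε1 : ε < 1) (hl : rate n q₁ ε ≤ 1 / 2) :
    P {ω | ¬ ∀ j, |avg fun i => obsQ f γ (O i ω) * ((O i ω).D - c.ψD (α ⬝ᵥ g (O i ω).X)) *
      g (O i ω).X j| ≤ c.B₁ * rate n q₁ ε} ≤ ENNReal.ofReal (2 * ε) := by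
  have hCG := hd.CG
  have hb : ∀ j, ∀ᵐ o ∂ρ, |g o.X j| ≤ c.CG := fun j => pop.asm_α.bounded.mono fun o ho => ho j
  refine measure_not_forall_abs_avg_le
    (W := fun j o => obsQ f γ o * (o.D - c.ψD (α ⬝ᵥ g o.X)) * g o.X j) hO
    (fun j => (pop.measurable_q.mul (measurable_obsD.sub ((pop.measurable_m1 hc).comp
      measurable_obsX))).mul (pop.measurable_g j))
    (by positivity) hε hε1 (fun j => ?_) hl (fun j => pop.integral_grad_α hc j) hd.grad₁
  filter_upwards [pop.abs_q_le, hb j] with o h1 h2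
  rw [abs_mul, abs_mul]
  refine mul_le_mul ?_ h2 (abs_nonneg _) (Real.exp_pos _).le
  refine (mul_le_of_le_one_right (abs_nonneg _) ?_).trans h1
  have h3 := hc.linkD.pos (α ⬝ᵥ g o.X)
  have h4 := hc.linkD.le_one (α ⬝ᵥ g o.X)
  rw [abs_le]
  rcases obsD_eq o with h | h <;> rw [h] <;> constructor <;> linarith

lemma measure_grad₂ (hc : c.Valid) (hσ₀ : 0 < σ₀) (hd : c.Dominates σ₀ σ₁)
    (hO : IsIIDSample ρ P O) (hε : 0 < ε) (hε1 : ε < 1) (hl : rate n q₂ ε ≤ 1 / 2) :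
    P {ω | ¬ ∀ j, |avg fun i => obsQ f γ (O i ω) * obsE c g h α β (O i ω) * h (O i ω).X j| ≤
      c.B₂ * rate n q₂ ε} ≤ ENNReal.ofReal (2 * ε) := by
  have hCH := hd.CH
  set T := Real.exp (-c.cF) * c.CH with hT
  have hWm : ∀ j, Measurable fun o => obsQ f γ o * obsE c g h α β o * h o.X j := fun j =>
    (pop.measurable_q.mul (pop.measurable_e hc)).mul (pop.measurable_h j)
  -- `T |e| ≤ e² / σ₀² + T² σ₀² / 4`
  have hle : ∀ j, ∀ᵐ o ∂ρ, Real.exp (|obsQ f γ o * obsE c g h α β o * h o.X j| / 1) ≤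
      Real.exp (T ^ 2 * σ₀ ^ 2 / 4) * Real.exp (obsE c g h α β o ^ 2 / σ₀ ^ 2) := fun j => by
    filter_upwards [pop.abs_q_le, pop.asm_β.bounded] with o h1 h2
    rw [← Real.exp_add]
    refine Real.exp_le_exp.2 ?_
    rw [abs_mul, abs_mul, div_one]
    have h3 : |obsQ f γ o| * |obsE c g h α β o| * |h o.X j| ≤ T * |obsE c g h α β o| := by
      calc |obsQ f γ o| * |obsE c g h α β o| * |h o.X j|
          = |obsQ f γ o| * |h o.X j| * |obsE c g h α β o| := by ring
        _ ≤ T * |obsE c g h α β o| := mul_le_mul_of_nonneg_right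
          (mul_le_mul h1 (h2 j) (abs_nonneg _) (Real.exp_pos _).le) (abs_nonneg _)
    have h4 := two_mul_le_add_sq (T * σ₀ / 2) (|obsE c g h α β o| / σ₀)
    have h5 : 2 * (T * σ₀ / 2) * (|obsE c g h α β o| / σ₀) = T * |obsE c g h α β o| := by
      field_simp
    rw [h5, div_pow, div_pow, mul_pow, sq_abs] at h4
    linarith
  obtain ⟨i1, i2⟩ := pop.exp_sq_moment hσ₀
  have key := measure_not_forall_abs_avg_sub_le (m := fun _ => 0)
    (W := fun j o => obsQ f γ o * obsE c g h α β o * h o.X j) hO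
    (by rw [Fintype.card_fin]; exact Nat.le_self_pow two_ne_zero _) hWm one_pos hε hε1
    (fun j => ?_) hl (fun j => pop.integral_grad_β hc hσ₀ j) hd.grad₂
  · simpa only [sub_zero] using key
  · have hint : Integrable (fun o =>
        Real.exp (|obsQ f γ o * obsE c g h α β o * h o.X j| / 1)) ρ := by
      refine (i1.const_mul (Real.exp (T ^ 2 * σ₀ ^ 2 / 4))).mono'
        ((measurable_norm.comp (hWm j)).div_const 1).exp.aestronglyMeasurable
        ((hle j).mono fun o ho => ?_)
      rwa [Real.norm_eq_abs, Real.abs_exp]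
    refine ⟨hint, (integral_mono_ae hint (i1.const_mul _) (hle j)).trans ?_⟩
    rw [integral_const_mul]
    exact mul_le_mul_of_nonneg_left i2 (Real.exp_pos _).le

lemma measure_gram {k : ℕ} {x : 𝒳 → Fin (k + 1) → ℝ} (hx : IsRegressor x) {C : ℝ} (hC : 0 < C)
    (hb : ∀ᵐ o ∂ρ, ∀ j, |x o.X j| ≤ C)
    (hK : concConst (Real.exp (-c.cF) * (C * C)) (Real.exp 1) ≤ c.K)
    (hO : IsIIDSample ρ P O) (hε : 0 < ε) (hε1 : ε < 1) (hl : rate n k ε ≤ 1 / 2) :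
    P {ω | ¬ ∀ j l, |(avg fun i => obsQ f γ (O i ω) * (x (O i ω).X j * x (O i ω).X l)) -
      gram ρ f γ x j l| ≤ c.K * rate n k ε} ≤ ENNReal.ofReal (2 * ε) := by
  have hxm := fun j => (hx.measurable_apply j).comp measurable_obsX
  have hm : ∀ j l, Measurable fun o => obsQ f γ o * (x o.X j * x o.X l) := fun j l =>
    pop.measurable_q.mul ((hxm j).mul (hxm l))
  have hpos : 0 < Real.exp (-c.cF) * (C * C) := by positivity
  refine measure_not_forall₂_abs_avg_sub_le
    (W := fun j l o => obsQ f γ o * (x o.X j * x o.X l)) hO hm hpos hε hε1 (fun j l => ?_) hl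
    (fun j l => ?_) hK
  · refine exp_moment_of_bounded hpos (hm j l) ?_
    filter_upwards [pop.abs_q_le, hb] with o h1 h2
    exact abs_mul_mul_le h1 (h2 j) (h2 l)
  · rw [gram_eq, Matrix.of_apply]

lemma measure_bal {k : ℕ} {x : 𝒳 → Fin (k + 1) → ℝ} (hx : IsRegressor x) {C : ℝ} (hC : 0 < C)
    (hb : ∀ᵐ o ∂ρ, ∀ j, |x o.X j| ≤ C)
    (hK : concConst ((1 + Real.exp (-c.cF)) * (C * C)) (Real.exp 1) ≤ c.K)
    (hO : IsIIDSample ρ P O) (hε : 0 < ε) (hε1 : ε < 1) (hl : rate n k ε ≤ 1 / 2) :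
    P {ω | ¬ ∀ j l, |avg fun i => obsR f γ (O i ω) * (x (O i ω).X j * x (O i ω).X l)| ≤
      c.K * rate n k ε} ≤ ENNReal.ofReal (2 * ε) := by
  have hxm := fun j => (hx.measurable_apply j).comp measurable_obsX
  have hm : ∀ j l, Measurable fun o => obsR f γ o * (x o.X j * x o.X l) := fun j l =>
    pop.measurable_r.mul ((hxm j).mul (hxm l))
  have hpos : 0 < (1 + Real.exp (-c.cF)) * (C * C) := by positivity
  have key := measure_not_forall₂_abs_avg_sub_le (m := fun _ _ => 0)
    (W := fun j l o => obsR f γ o * (x o.X j * x o.X l)) hO hm hpos hε hε1 (fun j l => ?_) hl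
    (fun j l => ?_) hK
  · simpa only [sub_zero] using key
  · refine exp_moment_of_bounded hpos (hm j l) ?_
    filter_upwards [pop.abs_r_le, hb] with o h1 h2
    exact abs_mul_mul_le h1 (h2 j) (h2 l)
  · refine pop.integral_r_mul (k := fun z => x z j * x z l) (C := C * C)
      ((hx.measurable_apply j).mul (hx.measurable_apply l)) ?_
    filter_upwards [hb] with o h2
    rw [abs_mul]
    exact mul_le_mul (h2 j) (h2 l) (abs_nonneg _) hC.le

lemma measure_noise (hc : c.Valid) (hσ₀ : 0 < σ₀) (hd : c.Dominates σ₀ σ₁)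
    (hO : IsIIDSample ρ P O) (hε : 0 < ε) (hε1 : ε < 1) (hl : rate n p ε ≤ 1 / 2) :
    P {ω | ¬ ∀ j l, |(avg fun i => obsQ f γ (O i ω) * obsE c g h α β (O i ω) ^ 2 *
      (f (O i ω).X j * f (O i ω).X l)) - ∫ o, obsQ f γ o * obsE c g h α β o ^ 2 *
      (f o.X j * f o.X l) ∂ρ| ≤ c.K * rate n p ε} ≤ ENNReal.ofReal (2 * ε) := by
  have hCF := hd.CF
  have hm : ∀ j l, Measurable fun o => obsQ f γ o * obsE c g h α β o ^ 2 *
      (f o.X j * f o.X l) := fun j l =>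
    (pop.measurable_q.mul ((pop.measurable_e hc).pow_const 2)).mul
      ((pop.measurable_f j).mul (pop.measurable_f l))
  have hpos : 0 < Real.exp (-c.cF) * (c.CF * c.CF) * σ₀ ^ 2 := by positivity
  refine measure_not_forall₂_abs_avg_sub_le
    (W := fun j l o => obsQ f γ o * obsE c g h α β o ^ 2 * (f o.X j * f o.X l)) hO hm hpos hε hε1
    (fun j l => ?_) hl (fun j l => rfl) hd.noise
  obtain ⟨i1, i2⟩ := pop.exp_sq_moment hσ₀
  have hle : ∀ᵐ o ∂ρ, Real.exp (|obsQ f γ o * obsE c g h α β o ^ 2 * (f o.X j * f o.X l)| /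
      (Real.exp (-c.cF) * (c.CF * c.CF) * σ₀ ^ 2)) ≤
      Real.exp (obsE c g h α β o ^ 2 / σ₀ ^ 2) := by
    filter_upwards [pop.abs_q_le, pop.asm_γ.bounded] with o h1 h2
    refine Real.exp_le_exp.2 ?_
    rw [div_le_div_iff₀ hpos (by positivity)]
    have h3 := abs_mul_mul_le h1 (h2 j) (h2 l)
    have h4 : |obsQ f γ o * obsE c g h α β o ^ 2 * (f o.X j * f o.X l)| =
        obsE c g h α β o ^ 2 * |obsQ f γ o * (f o.X j * f o.X l)| := by
      rw [← abs_of_nonneg (sq_nonneg (obsE c g h α β o)), ← abs_mul,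
        abs_of_nonneg (sq_nonneg (obsE c g h α β o))]
      congr 1; ring
    rw [h4]
    have h5 := mul_le_mul_of_nonneg_left h3 (sq_nonneg (obsE c g h α β o))
    have h6 := mul_le_mul_of_nonneg_right h5 (sq_nonneg σ₀)
    linarith
  have hint : Integrable (fun o => Real.exp (|obsQ f γ o * obsE c g h α β o ^ 2 *
      (f o.X j * f o.X l)| / (Real.exp (-c.cF) * (c.CF * c.CF) * σ₀ ^ 2))) ρ := by
    refine i1.mono' ((measurable_norm.comp (hm j l)).div_const _).exp.aestronglyMeasurable
      (hle.mono fun o ho => ?_)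
    rwa [Real.norm_eq_abs, Real.abs_exp]
  exact ⟨hint, (integral_mono_ae hint i1 hle).trans i2⟩

lemma measure_lin {k : ℕ} {x : 𝒳 → Fin (k + 1) → ℝ} (hx : IsRegressor x) {C A : ℝ} (hC : 0 < C)
    (hA : 0 < A) (hb : ∀ᵐ o ∂ρ, ∀ j, |x o.X j| ≤ C) {a : 𝒳 → ℝ} (ha : Measurable a)
    (haA : ∀ᵐ o ∂ρ, |a o.X| ≤ A)
    (hK : concConst ((1 + Real.exp (-c.cF)) * (A * C)) (Real.exp 1) ≤ c.K)
    (hO : IsIIDSample ρ P O) (hε : 0 < ε) (hε1 : ε < 1) (hl : rate n k ε ≤ 1 / 2) :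
    P {ω | ¬ ∀ j, |avg fun i => obsR f γ (O i ω) * a (O i ω).X * x (O i ω).X j| ≤
      c.K * rate n k ε} ≤ ENNReal.ofReal (2 * ε) := by
  have hpos : 0 < (1 + Real.exp (-c.cF)) * (A * C) := by positivity
  refine measure_not_forall_abs_avg_le (W := fun j o => obsR f γ o * a o.X * x o.X j) hO
    (fun j => (pop.measurable_r.mul (ha.comp measurable_obsX)).mul
      ((hx.measurable_apply j).comp measurable_obsX)) hpos hε hε1 (fun j => ?_) hl
    (fun j => ?_) hK
  · filter_upwards [pop.abs_r_le, haA, hb] with o h1 h2 h3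
    rw [mul_assoc]
    exact abs_mul_mul_le h1 h2 (h3 j)
  · simp only [mul_assoc]
    refine pop.integral_r_mul (k := fun z => a z * x z j) (C := A * C)
      (ha.mul (hx.measurable_apply j)) ?_
    filter_upwards [haA, hb] with o h1 h2
    rw [abs_mul]
    exact mul_le_mul h1 (h2 j) (abs_nonneg _) hA.le

end Population

end event

/-! ### High probability bound for the estimator -/

section assembly

variable {𝒳 : Type*}

/-- An observation at which the regressors and the target linear predictors obey their bounds. -/
structure InRange {p q₁ q₂ : ℕ} (c : Constants) (f : 𝒳 → Fin (p + 1) → ℝ)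
    (g : 𝒳 → Fin (q₁ + 1) → ℝ) (h : 𝒳 → Fin (q₂ + 1) → ℝ) (γ : Fin (p + 1) → ℝ)
    (α : Fin (q₁ + 1) → ℝ) (β : Fin (q₂ + 1) → ℝ) (o : Obs 𝒳) : Prop where
  f_le : ∀ j, |f o.X j| ≤ c.CF
  γ_ge : c.cF ≤ γ ⬝ᵥ f o.X
  g_le : ∀ j, |g o.X j| ≤ c.CG
  α_le : |α ⬝ᵥ g o.X| ≤ c.Ca
  h_le : ∀ j, |h o.X j| ≤ c.CH
  β_le : |β ⬝ᵥ h o.X| ≤ c.Cb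

variable [MeasurableSpace 𝒳]

/-- A sample all of whose relevant moments are close to their expectations. -/
structure Moments {n p q₁ q₂ : ℕ} (c : Constants) (ρ : Measure (Obs 𝒳))
    (f : 𝒳 → Fin (p + 1) → ℝ) (g : 𝒳 → Fin (q₁ + 1) → ℝ) (h : 𝒳 → Fin (q₂ + 1) → ℝ)
    (γ : Fin (p + 1) → ℝ) (α : Fin (q₁ + 1) → ℝ) (β : Fin (q₂ + 1) → ℝ) (l₀ l₁ l₂ : ℝ)
    (data : Fin n → Obs 𝒳) : Prop where
  grad₀ : ∀ j, |avg fun i => obsR f γ (data i) * f (data i).X j| ≤ c.B₀ * l₀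
  grad₁ : ∀ j, |avg fun i => obsQ f γ (data i) * ((data i).D - c.ψD (α ⬝ᵥ g (data i).X)) *
    g (data i).X j| ≤ c.B₁ * l₁
  grad₂ : ∀ j, |avg fun i => obsQ f γ (data i) * obsE c g h α β (data i) * h (data i).X j| ≤
    c.B₂ * l₂
  gram₀ : ∀ j l, |(avg fun i => obsQ f γ (data i) * (f (data i).X j * f (data i).X l)) -
    gram ρ f γ f j l| ≤ c.K * l₀
  gram₁ : ∀ j l, |(avg fun i => obsQ f γ (data i) * (g (data i).X j * g (data i).X l)) -
    gram ρ f γ g j l| ≤ c.K * l₁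
  gram₂ : ∀ j l, |(avg fun i => obsQ f γ (data i) * (h (data i).X j * h (data i).X l)) -
    gram ρ f γ h j l| ≤ c.K * l₂
  noise : ∀ j l, |(avg fun i => obsQ f γ (data i) * obsE c g h α β (data i) ^ 2 *
    (f (data i).X j * f (data i).X l)) - ∫ o, obsQ f γ o * obsE c g h α β o ^ 2 *
    (f o.X j * f o.X l) ∂ρ| ≤ c.K * l₀
  bal₁ : ∀ j l, |avg fun i => obsR f γ (data i) * (g (data i).X j * g (data i).X l)| ≤ c.K * l₁
  bal₂ : ∀ j l, |avg fun i => obsR f γ (data i) * (h (data i).X j * h (data i).X l)| ≤ c.K * l₂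
  lin₁ : ∀ j, |avg fun i => obsR f γ (data i) * (c.ψY (β ⬝ᵥ h (data i).X) *
    deriv c.ψD (α ⬝ᵥ g (data i).X)) * g (data i).X j| ≤ c.K * l₁
  lin₂ : ∀ j, |avg fun i => obsR f γ (data i) * (c.ψD (α ⬝ᵥ g (data i).X) *
    deriv c.ψY (β ⬝ᵥ h (data i).X)) * h (data i).X j| ≤ c.K * l₂

/-- The realized sample with estimates `γ', α', β'`. -/
noncomputable def toSample {n p q₁ q₂ : ℕ} (ρ : Measure (Obs 𝒳))
    (f : 𝒳 → Fin (p + 1) → ℝ) (g : 𝒳 → Fin (q₁ + 1) → ℝ) (h : 𝒳 → Fin (q₂ + 1) → ℝ)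
    (γ γ' : Fin (p + 1) → ℝ) (α α' : Fin (q₁ + 1) → ℝ) (β β' : Fin (q₂ + 1) → ℝ) (l₀ l₁ l₂ : ℝ)
    (data : Fin n → Obs 𝒳) : Sample n p q₁ q₂ where
  Z i := (data i).Z
  D i := (data i).D
  Y i := (data i).Y
  F i := f (data i).X
  G i := g (data i).X
  H i := h (data i).X
  γ := γ
  γ' := γ'
  α := α
  α' := α'
  β := β
  β' := β'
  VF := gram ρ f γ f
  VG := gram ρ f γ g
  VH := gram ρ f γ h
  l₀ := l₀
  l₁ := l₁
  l₂ := l₂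

lemma aipwParam_sub_eq_dphi {n p q₁ q₂ : ℕ} (c : Constants) (ρ : Measure (Obs 𝒳))
    (f : 𝒳 → Fin (p + 1) → ℝ) (g : 𝒳 → Fin (q₁ + 1) → ℝ) (h : 𝒳 → Fin (q₂ + 1) → ℝ)
    (γ γ' : Fin (p + 1) → ℝ) (α α' : Fin (q₁ + 1) → ℝ) (β β' : Fin (q₂ + 1) → ℝ) (l₀ l₁ l₂ : ℝ)
    (data : Fin n → Obs 𝒳) (i : Fin n) :
    aipwParam c.ψD c.ψY f g h γ' α' β' (data i) - aipwParam c.ψD c.ψY f g h γ α β (data i) =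
      (toSample ρ f g h γ γ' α α' β β' l₀ l₁ l₂ data).dphi c i := by
  simp only [aipwParam, aipw, propensity, regression, div_eq_mul_one_div (data i).Z,
    one_div_sigmoid, Sample.dphi, Sample.e, Sample.δ, Sample.r, Sample.w, Sample.w', Sample.m1,
    Sample.m1', Sample.m2, Sample.m2', toSample]
  ring

variable {ρ : Measure (Obs 𝒳)}

namespace Population

variable {n p q₁ q₂ : ℕ} {c : Constants} {σ₀ σ₁ ε l₀ l₁ l₂ : ℝ}
  {f : 𝒳 → Fin (p + 1) → ℝ} {g : 𝒳 → Fin (q₁ + 1) → ℝ} {h : 𝒳 → Fin (q₂ + 1) → ℝ}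
  {γ : Fin (p + 1) → ℝ} {α : Fin (q₁ + 1) → ℝ} {β : Fin (q₂ + 1) → ℝ}
  (pop : Population c σ₀ σ₁ ρ f g h γ α β)

include pop

lemma ae_inRange : ∀ᵐ o ∂ρ, InRange c f g h γ α β o := by
  filter_upwards [pop.asm_γ.bounded, pop.asm_γ.lower, pop.asm_α.bounded, pop.asm_α.predictor,
    pop.asm_β.bounded, pop.asm_β.predictor] with o h1 h2 h3 h4 h5 h6
  exact ⟨h1, h2, h3, h4, h5, h6⟩

variable [IsProbabilityMeasure ρ]

/-- Eleven families of moments, each with exceptional probability at most `2 ε`. The rates are at most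
`1 / 2`, which is the range of the exponential bound. -/
lemma measure_not_moments_le (hc : c.Valid) (hσ₀ : 0 < σ₀) (hd : c.Dominates σ₀ σ₁)
    {Ω : Type*} [MeasurableSpace Ω] {P : Measure Ω} [IsProbabilityMeasure P]
    {O : Fin n → Ω → Obs 𝒳} (hO : IsIIDSample ρ P O) (hε : 0 < ε) (hε1 : ε < 1)
    (hl₀ : rate n p ε ≤ 1 / 2) (hl₁ : rate n q₁ ε ≤ 1 / 2) (hl₂ : rate n q₂ ε ≤ 1 / 2) :
    P {ω | ¬ Moments c ρ f g h γ α β (rate n p ε) (rate n q₁ ε) (rate n q₂ ε)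
      (fun i => O i ω)} ≤ ENNReal.ofReal (22 * ε) := by
  have hDd := deriv_zero_pos hc.linkD.strictMono hc.linkD.differentiable hc.ratioD
  have hYd := deriv_zero_pos hc.linkY.strictMono hc.linkY.differentiable hc.ratioY
  have hLm := c.Lm_nonneg
  have hm1 := pop.measurable_m1 hc
  have hm2 := pop.measurable_m2 hc
  have hdD : Measurable fun x => deriv c.ψD (α ⬝ᵥ g x) :=
    (measurable_deriv c.ψD).comp (pop.reg_g.measurable_dot α)
  have hdY : Measurable fun x => deriv c.ψY (β ⬝ᵥ h x) :=
    (measurable_deriv c.ψY).comp (pop.reg_h.measurable_dot β)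
  have e1 := pop.measure_grad₀ hd hO hε hε1 hl₀
  have e2 := pop.measure_grad₁ hc hd hO hε hε1 hl₁
  have e3 := pop.measure_grad₂ hc hσ₀ hd hO hε hε1 hl₂
  have e4 := pop.measure_gram pop.reg_f hd.CF pop.asm_γ.bounded hd.gram₀ hO hε hε1 hl₀
  have e5 := pop.measure_gram pop.reg_g hd.CG pop.asm_α.bounded hd.gram₁ hO hε hε1 hl₁
  have e6 := pop.measure_gram pop.reg_h hd.CH pop.asm_β.bounded hd.gram₂ hO hε hε1 hl₂
  have e7 := pop.measure_noise hc hσ₀ hd hO hε hε1 hl₀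
  have e8 := pop.measure_bal pop.reg_g hd.CG pop.asm_α.bounded hd.bal₁ hO hε hε1 hl₁
  have e9 := pop.measure_bal pop.reg_h hd.CH pop.asm_β.bounded hd.bal₂ hO hε hε1 hl₂
  have e10 := pop.measure_lin pop.reg_g (a := fun x => c.ψY (β ⬝ᵥ h x) * deriv c.ψD (α ⬝ᵥ g x))
    hd.CG (by positivity) pop.asm_α.bounded (hm2.mul hdD) (by
      filter_upwards [pop.abs_m2_le hc, pop.asm_α.predictor] with o h1 h2
      rw [abs_mul, abs_of_nonneg hc.linkD.strictMono.monotone.deriv_nonneg]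
      exact mul_le_mul (h1.trans (by linarith)) (deriv_le_of_abs_le hc.C₂ hc.ratioD hDd.le h2)
        hc.linkD.strictMono.monotone.deriv_nonneg (by positivity)) hd.lin₁ hO hε hε1 hl₁
  have e11 := pop.measure_lin pop.reg_h (a := fun x => c.ψD (α ⬝ᵥ g x) * deriv c.ψY (β ⬝ᵥ h x))
    hd.CH (by positivity) pop.asm_β.bounded (hm1.mul hdY) (by
      filter_upwards [pop.asm_β.predictor] with o h2
      rw [abs_mul, abs_of_nonneg hc.linkY.strictMono.monotone.deriv_nonneg,
        abs_of_pos (hc.linkD.pos _)]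
      exact mul_le_mul (hc.linkD.le_one _) (deriv_le_of_abs_le hc.C₃ hc.ratioY hYd.le h2)
        hc.linkY.strictMono.monotone.deriv_nonneg zero_le_one) hd.lin₂ hO hε hε1 hl₂
  have h2ε : 0 ≤ 2 * ε := by positivity
  have a2 := measure_not_and_le h2ε h2ε e1 e2
  have a3 := measure_not_and_le (by positivity) h2ε a2 e3
  have a4 := measure_not_and_le (by positivity) h2ε a3 e4
  have a5 := measure_not_and_le (by positivity) h2ε a4 e5
  have a6 := measure_not_and_le (by positivity) h2ε a5 e6
  have a7 := measure_not_and_le (by positivity) h2ε a6 e7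
  have a8 := measure_not_and_le (by positivity) h2ε a7 e8
  have a9 := measure_not_and_le (by positivity) h2ε a8 e9
  have a10 := measure_not_and_le (by positivity) h2ε a9 e10
  have a11 := measure_not_and_le (by positivity) h2ε a10 e11
  refine (measure_mono fun ω hω => ?_).trans (a11.trans_eq (by congr 1; ring))
  rw [Set.mem_ofPred_eq] at hω ⊢
  refine fun hall => hω ?_
  obtain ⟨⟨⟨⟨⟨⟨⟨⟨⟨⟨h1, h2⟩, h3⟩, h4⟩, h5⟩, h6⟩, h7⟩, h8⟩, h9⟩, h10⟩, h11⟩ := hall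
  exact ⟨h1, h2, h3, h4, h5, h6, h7, h8, h9, h10, h11⟩

/-- The condition `resid`, on the residuals tested against `f`, follows from the one for `h` because `f`
is a subvector of `h`. -/
lemma good_toSample (hc : c.Valid) (hσ₀ : 0 < σ₀) (hd : c.Dominates σ₀ σ₁)
    (hfh : IsSubvector f h) {data : Fin n → Obs 𝒳}
    (hdata : ∀ i, InRange c f g h γ α β (data i)) (hl₀ : 0 < l₀) (hl₁ : l₀ ≤ l₁) (hl₂ : l₀ ≤ l₂)
    (hmom : Moments c ρ f g h γ α β l₀ l₁ l₂ data) {γ' : Fin (p + 1) → ℝ}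
    {α' : Fin (q₁ + 1) → ℝ} {β' : Fin (q₂ + 1) → ℝ}
    (hfit : IsFitted c.ψD c.ψY f g h data (c.A₀ * l₀) (c.A₁ * l₁) (c.A₂ * l₂) γ' α' β') :
    (toSample ρ f g h γ γ' α α' β β' l₀ l₁ l₂ data).Good c where
  Z01 i := obsZ_eq _
  D01 i := obsD_eq _
  F_le i := (hdata i).f_le
  γ_ge i := (hdata i).γ_ge
  G_le i := (hdata i).g_le
  α_le i := (hdata i).α_le
  H_le i := (hdata i).h_le
  β_le i := (hdata i).β_le
  l₀_pos := hl₀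
  l₀_le_l₁ := hl₁
  l₀_le_l₂ := hl₂
  grad₀ := hmom.grad₀
  grad₁ := hmom.grad₁
  grad₂ := hmom.grad₂
  resid j := by
    obtain ⟨ι, -, hι⟩ := hfh
    have := hmom.grad₂ (ι j)
    simp only [← hι] at this
    exact this
  gram₀ := hmom.gram₀
  gram₁ := hmom.gram₁
  gram₂ := hmom.gram₂
  noise b := by
    have h1 := (abs_le.1 (abs_avg_quad_sub_le (x := fun i => f (data i).X)
      (M := Matrix.of fun i j => ∫ o, obsQ f γ o * obsE c g h α β o ^ 2 *
        (f o.X i * f o.X j) ∂ρ) hmom.noise b)).2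
    have h2 := pop.noise_quad_le hc hσ₀ b
    have h3 : 0 ≤ b ⬝ᵥ (gram ρ f γ f).mulVec b := by
      rw [gram_eq, integral_quad (x := fun o => f o.X) pop.integrable_q_mul_f]
      exact integral_nonneg fun o => mul_nonneg
        (mul_nonneg (obsZ_nonneg o) (Real.exp_pos _).le) (sq_nonneg _)
    have h4 := mul_le_mul_of_nonneg_right hd.noise' h3
    change (avg fun i => obsQ f γ (data i) * obsE c g h α β (data i) ^ 2 *
      (b ⬝ᵥ f (data i).X) ^ 2) ≤ c.K * (b ⬝ᵥ (gram ρ f γ f).mulVec b + l₀ * l1norm b ^ 2)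
    linarith
  bal₁ := hmom.bal₁
  bal₂ := hmom.bal₂
  lin₁ := hmom.lin₁
  lin₂ := hmom.lin₂
  compat₀ := pop.asm_γ.compatible
  compat₁ := pop.asm_α.compatible
  compat₂ := pop.asm_β.compatible
  fit₀ b := hfit.fit_γ (Set.mem_univ b)
  fit₁ b := by
    have := hfit.fit_α₁ (Set.mem_univ b)
    simp only [Set.mem_ofPred_eq, sampleMean_eq_avg, lossD, weight_eq_exp] at this
    exact this
  fit₂ b := by
    have := hfit.fit_α₁₁ (Set.mem_univ b)
    simp only [Set.mem_ofPred_eq, sampleMean_eq_avg, lossDY, weight_eq_exp] at this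
    exact this

end Population

lemma IsSubvector.le {p k : ℕ} {𝒳 : Type*} {f : 𝒳 → Fin (p + 1) → ℝ} {g : 𝒳 → Fin (k + 1) → ℝ}
    (h : IsSubvector f g) : p ≤ k := by
  obtain ⟨ι, hι, -⟩ := h
  have := Fintype.card_le_of_injective ι hι
  simpa using this

/-- The exceptional set has probability at most `22 ε`, and outside it both conclusions hold. -/
theorem aipw_high_probability {c : Constants} {σ₀ σ₁ : ℝ} (hc : c.Valid) (hσ₀ : 0 < σ₀)
    (hd : c.Dominates σ₀ σ₁) : ∃ M η : ℝ, 0 < M ∧ 0 < η ∧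
    ∀ (n p q₁ q₂ : ℕ) (ε l₀ l₁ l₂ : ℝ), 0 < ε → ε < 1 →
      l₀ = rate n p ε → l₁ = rate n q₁ ε → l₂ = rate n q₂ ε →
    ∀ (𝒳 : Type u) [MeasurableSpace 𝒳] (ρ : Measure (Obs 𝒳)) [IsProbabilityMeasure ρ]
      (f : 𝒳 → Fin (p + 1) → ℝ) (g : 𝒳 → Fin (q₁ + 1) → ℝ) (h : 𝒳 → Fin (q₂ + 1) → ℝ)
      (γ : Fin (p + 1) → ℝ) (α : Fin (q₁ + 1) → ℝ) (β : Fin (q₂ + 1) → ℝ),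
      Population c σ₀ σ₁ ρ f g h γ α β → IsSubvector f g → IsSubvector f h →
      sparsity γ * l₀ + sparsity α * l₁ * max 1 (l₁ / l₂) + sparsity β * l₂ ≤ η →
    ∀ (Ω : Type v) [MeasurableSpace Ω] (P : Measure Ω) [IsProbabilityMeasure P]
      (O : Fin n → Ω → Obs 𝒳), IsIIDSample ρ P O →
      P {ω | ¬ ∀ γ' α' β',
          IsFitted c.ψD c.ψY f g h (fun i => O i ω) (c.A₀ * l₀) (c.A₁ * l₁) (c.A₂ * l₂) γ' α' β' →
          |sampleMean (fun i => O i ω) (aipwParam c.ψD c.ψY f g h γ' α' β') -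
              sampleMean (fun i => O i ω) (aipwParam c.ψD c.ψY f g h γ α β)| ≤
            M * (sparsity γ * l₀ * l₂ +
              (sparsity γ * l₀ ^ 2 + sparsity α * l₁ ^ 2 + sparsity β * l₂ ^ 2)) ∧
          |sampleMean (fun i => O i ω) (fun o => (aipwParam c.ψD c.ψY f g h γ' α' β' o -
              aipwParam c.ψD c.ψY f g h γ α β o) ^ 2)| ≤
            M * (sparsity γ * l₀ ^ 2 + sparsity α * l₁ ^ 2 + sparsity β * l₂ ^ 2)} ≤
        ENNReal.ofReal (22 * ε) := by
  obtain ⟨M, η, hM, hη, H⟩ := Sample.aipw_bound hc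
  refine ⟨M, min η (1 / 2), hM, by positivity, ?_⟩
  intro n p q₁ q₂ ε l₀ l₁ l₂ hε hε1 el₀ el₁ el₂ 𝒳 _ ρ _ f g h γ α β pop hfg hfh hη' Ω _ P _ O hO
  have hl₀ : 0 < l₀ := el₀ ▸ rate_pos hO.pos hε hε1
  have hl₁ : 0 < l₁ := el₁ ▸ rate_pos hO.pos hε hε1
  have hl₂ : 0 < l₂ := el₂ ▸ rate_pos hO.pos hε hε1
  have h01 : l₀ ≤ l₁ := by rw [el₀, el₁]; exact rate_mono hε hfg.le
  have h02 : l₀ ≤ l₂ := by rw [el₀, el₂]; exact rate_mono hε hfh.le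
  have s0 := one_le_sparsity γ
  have s1 := one_le_sparsity α
  have s2 := one_le_sparsity β
  have t0 : 0 ≤ sparsity γ * l₀ := by positivity
  have t1 : 0 ≤ sparsity α * l₁ := by positivity
  have t2 : 0 ≤ sparsity β * l₂ := by positivity
  have m1 : sparsity α * l₁ ≤ sparsity α * l₁ * max 1 (l₁ / l₂) :=
    le_mul_of_one_le_right t1 (le_max_left _ _)
  have m2 : sparsity α * l₁ * (l₁ / l₂) ≤ sparsity α * l₁ * max 1 (l₁ / l₂) :=
    mul_le_mul_of_nonneg_left (le_max_right _ _) t1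
  have hηa := hη'.trans (min_le_left _ _)
  have hηb := hη'.trans (min_le_right _ _)
  have b0 : l₀ ≤ sparsity γ * l₀ := le_mul_of_one_le_left hl₀.le s0
  have b1 : l₁ ≤ sparsity α * l₁ := le_mul_of_one_le_left hl₁.le s1
  have b2 : l₂ ≤ sparsity β * l₂ := le_mul_of_one_le_left hl₂.le s2
  have hmom := pop.measure_not_moments_le hc hσ₀ hd hO hε hε1 (by rw [← el₀]; linarith)
    (by rw [← el₁]; linarith) (by rw [← el₂]; linarith)
  rw [← el₀, ← el₁, ← el₂] at hmom
  have hrange : ∀ᵐ ω ∂P, ∀ i, InRange c f g h γ α β (O i ω) := by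
    rw [ae_all_iff]
    intro i
    refine ae_of_ae_map (hO.measurable i).aemeasurable ?_
    rw [hO.law i]
    exact pop.ae_inRange
  have hboth := measure_not_and_le (by positivity) le_rfl hmom (by
    rw [ENNReal.ofReal_zero]; exact (ae_iff.1 hrange).le)
  rw [add_zero] at hboth
  refine (measure_mono fun ω hω => ?_).trans hboth
  rw [Set.mem_ofPred_eq] at hω ⊢
  refine fun hall => hω ?_
  intro γ' α' β' hfit
  set s := toSample ρ f g h γ γ' α α' β β' l₀ l₁ l₂ (fun i => O i ω) with hs
  have hgood : s.Good c := pop.good_toSample hc hσ₀ hd hfh hall.2 hl₀ h01 h02 hall.1 hfit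
  have hsmall : s.Small η := by
    refine ⟨show sparsity γ * l₀ ≤ η by linarith, show sparsity α * l₁ ≤ η by linarith,
      show sparsity α * l₁ ^ 2 ≤ η * l₂ from ?_, show sparsity β * l₂ ≤ η by linarith⟩
    rw [← div_le_iff₀ hl₂]
    have e : sparsity α * l₁ ^ 2 / l₂ = sparsity α * l₁ * (l₁ / l₂) := by ring
    rw [e]; linarith
  obtain ⟨k1, k2⟩ := H s hgood hsmall
  constructor
  · rw [sampleMean_eq_avg, sampleMean_eq_avg, ← avg_sub]
    simp only [aipwParam_sub_eq_dphi c ρ f g h γ γ' α α' β β' l₀ l₁ l₂ (fun i => O i ω)]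
    exact k1
  · rw [sampleMean_eq_avg]
    simp only [aipwParam_sub_eq_dphi c ρ f g h γ γ' α α' β β' l₀ l₁ l₂ (fun i => O i ω)]
    rw [abs_of_nonneg (avg_nonneg fun i => sq_nonneg _)]
    exact k2

end assembly

/-! ### Choice of the constants -/

/-- A common upper bound for the constants of finitely many concentration inequalities: the sum of
their absolute values. -/
lemma exists_dominating (l : List ℝ) : ∃ K : ℝ, 0 ≤ K ∧ ∀ x ∈ l, x ≤ K := by
  refine ⟨(l.map abs).sum, List.sum_nonneg (by simp), fun x hx => (le_abs_self x).trans ?_⟩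
  exact List.single_le_sum (by simp) _ (List.mem_map_of_mem hx)

/-- With `B₀, B₁, B₂` the concentration constants of the three gradients, which involve neither
link, all requirements on the constants are met once `K` is large. -/
lemma exists_constants {ψD ψY : ℝ → ℝ}
    {CF cF CG Ca C₂ CH Cb C₃ A₀ A₁ A₂ ν₀ μ₀ ν₁ μ₁ ν₂ μ₂ B₀ B₁ B₂ σ₀ σ₁ : ℝ}
    (linkD : IsTreatmentLink ψD) (linkY : IsOutcomeLink ψY) (ratioD : DerivRatioBound ψD C₂)
    (ratioY : DerivRatioBound ψY C₃) (hCF : 0 < CF) (hCG : 0 < CG) (hCH : 0 < CH)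
    (hC₂ : 0 ≤ C₂) (hC₃ : 0 ≤ C₃)
    (hν₀ : 0 < ν₀) (hν₁ : 0 < ν₁) (hν₂ : 0 < ν₂) (hμ₀ : 1 < μ₀) (hμ₁ : 1 < μ₁) (hμ₂ : 1 < μ₂)
    (hB₀ : B₀ = concConst ((1 + Real.exp (-cF)) * CF) (Real.exp 1))
    (hB₁ : B₁ = concConst (Real.exp (-cF) * CG) (Real.exp 1))
    (hB₂ : B₂ = concConst 1 (Real.exp ((Real.exp (-cF) * CH) ^ 2 * σ₀ ^ 2 / 4) *
      (1 + σ₁ ^ 2 / σ₀ ^ 2)))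
    (hA₀ : B₀ * (μ₀ + 1) / (μ₀ - 1) < A₀) (hA₁ : B₁ * (μ₁ + 1) / (μ₁ - 1) < A₁)
    (hA₂ : B₂ * (μ₂ + 1) / (μ₂ - 1) < A₂) :
    ∃ K : ℝ, ∀ c : Constants, c = ⟨ψD, ψY, CF, cF, CG, Ca, C₂, CH, Cb, C₃, B₀, B₁, B₂, K,
      A₀, A₁, A₂, ν₀, μ₀, ν₁, μ₁, ν₂, μ₂⟩ → c.Valid ∧ c.Dominates σ₀ σ₁ := by
  obtain ⟨K, hK, hle⟩ := exists_dominating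
    [concConst (Real.exp (-cF) * (CF * CF)) (Real.exp 1),
     concConst (Real.exp (-cF) * (CG * CG)) (Real.exp 1),
     concConst (Real.exp (-cF) * (CH * CH)) (Real.exp 1),
     concConst (Real.exp (-cF) * (CF * CF) * σ₀ ^ 2) (1 + σ₁ ^ 2 / σ₀ ^ 2),
     σ₁ ^ 2 / Real.sigmoid cF,
     concConst ((1 + Real.exp (-cF)) * (CG * CG)) (Real.exp 1),
     concConst ((1 + Real.exp (-cF)) * (CH * CH)) (Real.exp 1),
     concConst ((1 + Real.exp (-cF)) * ((max |ψY (-Cb)| |ψY Cb| + 1) * (deriv ψD 0 *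
       Real.exp (C₂ * Ca)) * CG)) (Real.exp 1),
     concConst ((1 + Real.exp (-cF)) * (1 * (deriv ψY 0 * Real.exp (C₃ * Cb)) * CH))
       (Real.exp 1)]
  simp only [List.forall_mem_cons] at hle
  obtain ⟨k1, k2, k3, k4, k5, k6, k7, k8, k9, -⟩ := hle
  have b0 : 0 < B₀ := hB₀ ▸ concConst_pos (by positivity) (by positivity)
  have b1 : 0 < B₁ := hB₁ ▸ concConst_pos (by positivity) (by positivity)
  have b2 : 0 < B₂ := hB₂ ▸ concConst_pos one_pos (by positivity)
  refine ⟨K, ?_⟩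
  rintro c rfl
  exact ⟨⟨linkD, linkY, ratioD, ratioY, hCF.le, hCG.le, hCH.le, hC₂, hC₃, b0.le, b1.le, b2.le, hK,
    hν₀, hν₁, hν₂, hμ₀, hμ₁, hμ₂, hA₀, hA₁, hA₂⟩,
    ⟨hCF, hCG, hCH, hB₀.ge, hB₁.ge, hB₂.ge, k1, k2, k3, k4, k5, k6, k7, k8, k9⟩⟩

end RCAL

open RCAL

theorem theorem3 :
    ∃ c₀ : ℝ, 0 < c₀ ∧
    ∀ Cf₁ Ch₀ σ₀ σ₁ : ℝ, 1 ≤ Ch₀ → 0 < σ₀ → 0 < σ₁ →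
    ∃ B₁ : ℝ, 0 < B₁ ∧
    ∀ (ψD : ℝ → ℝ) (Cf₀ ν₀ μ₀ Cg₀ Cg₁ Cg₂ ν₁ μ₁ : ℝ),
      IsTreatmentLink ψD → 1 ≤ Cf₀ → 0 < ν₀ → 1 < μ₀ →
      1 ≤ Cg₀ → 0 < Cg₁ → 0 < Cg₂ → DerivRatioBound ψD Cg₂ → 0 < ν₁ → 1 < μ₁ →
    ∃ A₀min A₁min : ℝ, ∀ A₀ A₁ : ℝ, A₀min ≤ A₀ → A₁min ≤ A₁ →
    ∀ (ψY : ℝ → ℝ) (Ch₁ Ch₂ ν₂ μ₂ : ℝ),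
      IsOutcomeLink ψY → 0 < Ch₁ → 0 < Ch₂ → DerivRatioBound ψY Ch₂ → 0 < ν₂ → 1 < μ₂ →
    ∀ A₂ : ℝ, B₁ * (μ₂ + 1) / (μ₂ - 1) < A₂ →
    ∃ η M₃₀ M₃₁ M₃₂ M₄₀ M₄₁ : ℝ,
      0 < η ∧ 0 < M₃₀ ∧ 0 < M₃₁ ∧ 0 < M₃₂ ∧ 0 < M₄₀ ∧ 0 < M₄₁ ∧
    ∀ (n p q₁ q₂ : ℕ) (ε l₀ l₁ l₂ : ℝ), 0 < n → 0 < ε → ε < 1 →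
      l₀ = rate n p ε → l₁ = rate n q₁ ε → l₂ = rate n q₂ ε →
    ∀ (𝒳 : Type u) [MeasurableSpace 𝒳] (ρ : Measure (Obs 𝒳)) [IsProbabilityMeasure ρ]
      (f : 𝒳 → Fin (p + 1) → ℝ) (g : 𝒳 → Fin (q₁ + 1) → ℝ) (h : 𝒳 → Fin (q₂ + 1) → ℝ),
      IsRegressor f → IsRegressor g → IsRegressor h → IsSubvector f g → IsSubvector f h →
    ∀ (γbar : Fin (p + 1) → ℝ) (αbar₁ : Fin (q₁ + 1) → ℝ) (αbar₁₁ : Fin (q₂ + 1) → ℝ),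
      IsTarget ρ (lossCAL f) γbar →
      IsTarget ρ (lossD ψD f g γbar) αbar₁ →
      IsTarget ρ (lossDY ψD ψY f g h γbar αbar₁) αbar₁₁ →
      PropensityAssumption ρ f γbar Cf₀ Cf₁ ν₀ μ₀ →
      TreatmentAssumption ρ f g γbar αbar₁ Cg₀ Cg₁ ν₁ μ₁ →
      OutcomeAssumption ρ ψD ψY f g h γbar αbar₁ αbar₁₁ Ch₀ Ch₁ σ₀ σ₁ ν₂ μ₂ →
      l₀ ≤ 1 →
      sparsity γbar * l₀ + sparsity αbar₁ * l₁ * max 1 (l₁ / l₂) + sparsity αbar₁₁ * l₂ ≤ η →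
      PropensityCorrect ρ f →
    ∀ (Ω : Type v) [MeasurableSpace Ω] (P : Measure Ω) [IsProbabilityMeasure P]
      (O : Fin n → Ω → Obs 𝒳),
      (∀ i, Measurable (O i)) → iIndepFun O P → (∀ i, P.map (O i) = ρ) →
      P {ω | ¬ ∀ γ α₁ α₁₁,
          IsFitted ψD ψY f g h (fun i => O i ω) (A₀ * l₀) (A₁ * l₁) (A₂ * l₂) γ α₁ α₁₁ →
          |sampleMean (fun i => O i ω) (aipwParam ψD ψY f g h γ α₁ α₁₁) -
              sampleMean (fun i => O i ω) (aipwParam ψD ψY f g h γbar αbar₁ αbar₁₁)| ≤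
            M₃₀ * sparsity γbar * l₀ * max l₁ l₂ + M₃₁ * sparsity αbar₁ * l₁ * max l₁ l₂ +
              M₃₂ * sparsity αbar₁₁ * l₂ ^ 2} ≤ ENNReal.ofReal ((14 + c₀) * ε) ∧
      P {ω | ¬ ∀ γ α₁ α₁₁,
          IsFitted ψD ψY f g h (fun i => O i ω) (A₀ * l₀) (A₁ * l₁) (A₂ * l₂) γ α₁ α₁₁ →
          |sampleMean (fun i => O i ω) (fun o => (aipwParam ψD ψY f g h γ α₁ α₁₁ o -
              aipwParam ψD ψY f g h γbar αbar₁ αbar₁₁ o) ^ 2)| ≤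
            M₄₀ * (sparsity γbar * l₀ ^ 2 + sparsity αbar₁ * l₁ ^ 2 +
                sparsity αbar₁₁ * l₂ ^ 2) +
              M₄₁ * (sparsity γbar * l₀ + sparsity αbar₁ * l₁ + sparsity αbar₁₁ * l₂) ^ 2} ≤
        ENNReal.ofReal ((8 + c₀) * ε) := by
  refine ⟨14, by norm_num, fun Cf₁ Ch₀ σ₀ σ₁ hCh₀ hσ₀ hσ₁ => ?_⟩
  refine ⟨concConst 1 (Real.exp ((Real.exp (-Cf₁) * Ch₀) ^ 2 * σ₀ ^ 2 / 4) *
    (1 + σ₁ ^ 2 / σ₀ ^ 2)), concConst_pos one_pos (by positivity), ?_⟩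
  intro ψD Cf₀ ν₀ μ₀ Cg₀ Cg₁ Cg₂ ν₁ μ₁ hψD hCf₀ hν₀ hμ₀ hCg₀ hCg₁ hCg₂ hratD hν₁ hμ₁
  refine ⟨concConst ((1 + Real.exp (-Cf₁)) * Cf₀) (Real.exp 1) * (μ₀ + 1) / (μ₀ - 1) + 1,
    concConst (Real.exp (-Cf₁) * Cg₀) (Real.exp 1) * (μ₁ + 1) / (μ₁ - 1) + 1, ?_⟩
  intro A₀ A₁ hA₀ hA₁ ψY Ch₁ Ch₂ ν₂ μ₂ hψY hCh₁ hCh₂ hratY hν₂ hμ₂ A₂ hA₂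
  obtain ⟨K, hK⟩ := exists_constants (cF := Cf₁) (Ca := Cg₁) (Cb := Ch₁) hψD hψY hratD hratY
    (by linarith : 0 < Cf₀) (by linarith : 0 < Cg₀) (by linarith : 0 < Ch₀) hCg₂.le hCh₂.le
    hν₀ hν₁ hν₂ hμ₀ hμ₁ hμ₂ rfl rfl rfl ((lt_add_one _).trans_le hA₀)
    ((lt_add_one _).trans_le hA₁) hA₂
  obtain ⟨hc, hd⟩ := hK _ rfl
  obtain ⟨M, η, hM, hη, H⟩ := aipw_high_probability.{u, v} hc hσ₀ hd
  -- both `|S_γ| l₀ l₂` and `|S_γ| l₀²` are at most `|S_γ| l₀ max l₁ l₂`; in the second bound the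
  -- squared sum is nonnegative and not needed
  refine ⟨η, 2 * M, M, M, M, 1, hη, by positivity, hM, hM, hM, one_pos, ?_⟩
  intro n p q₁ q₂ ε l₀ l₁ l₂ hn hε hε1 el₀ el₁ el₂ 𝒳 _ ρ _ f g h hf hg hh hfg hfh
    γbar αbar₁ αbar₁₁ tγ tα tβ aγ aα aβ _ hsmall hcor Ω _ P _ O hO hind hlaw
  have key := H n p q₁ q₂ ε l₀ l₁ l₂ hε hε1 el₀ el₁ el₂ 𝒳 ρ f g h γbar αbar₁ αbar₁₁
    ⟨hf, hg, hh, tγ, tα, tβ, aγ, aα, aβ, hcor⟩ hfg hfh hsmall Ω P O ⟨hn, hO, hind, hlaw⟩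
  have hl₀ : 0 ≤ l₀ := el₀ ▸ (rate_pos hn hε hε1).le
  have hl₁ : 0 ≤ l₁ := el₁ ▸ (rate_pos hn hε hε1).le
  have h01 : l₀ ≤ l₁ := by rw [el₀, el₁]; exact rate_mono hε hfg.le
  have s0 : 0 ≤ sparsity γbar := zero_le_one.trans (one_le_sparsity γbar)
  have s1 : 0 ≤ sparsity αbar₁ := zero_le_one.trans (one_le_sparsity αbar₁)
  have m1 := le_max_left l₁ l₂
  have m2 := le_max_right l₁ l₂
  constructor
  · refine (measure_mono fun ω hω => ?_).trans (key.trans (ENNReal.ofReal_le_ofReal (by linarith)))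
    rw [Set.mem_ofPred_eq] at hω ⊢
    refine fun hall => hω fun γ α₁ α₁₁ hfit => (hall γ α₁ α₁₁ hfit).1.trans ?_
    have e1 : sparsity γbar * l₀ * l₂ ≤ sparsity γbar * l₀ * max l₁ l₂ := by gcongr
    have e2 : sparsity γbar * l₀ * l₀ ≤ sparsity γbar * l₀ * max l₁ l₂ := by
      gcongr; exact h01.trans m1
    have e3 : sparsity αbar₁ * l₁ * l₁ ≤ sparsity αbar₁ * l₁ * max l₁ l₂ := by gcongr
    calc _ = M * (sparsity γbar * l₀ * l₂ + sparsity γbar * l₀ * l₀ + sparsity αbar₁ * l₁ * l₁ +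
          sparsity αbar₁₁ * l₂ ^ 2) := by ring
      _ ≤ M * (sparsity γbar * l₀ * max l₁ l₂ + sparsity γbar * l₀ * max l₁ l₂ +
          sparsity αbar₁ * l₁ * max l₁ l₂ + sparsity αbar₁₁ * l₂ ^ 2) := by gcongr
      _ = _ := by ring
  · refine (measure_mono fun ω hω => ?_).trans (key.trans (ENNReal.ofReal_le_ofReal (by linarith)))
    rw [Set.mem_ofPred_eq] at hω ⊢
    refine fun hall => hω fun γ α₁ α₁₁ hfit => (hall γ α₁ α₁₁ hfit).2.trans ?_
    exact le_add_of_nonneg_right (by positivity)
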